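/- **Theorem (Faithfully Flat Descent).** Let $A$ be a ring with unit, and let $\omega:\mathcal A\to \mathrm{add}(A_A)$ be a faithful additive functor from a small preadditive category $\mathcal A$ to the category of finitely generated projective right $A$-modules. (A $K$-linear functor over a commutative ring $K$ is a special case; none of the notions below depends on $K$.) For $P\in\mathcal A$ write $P$ also for the right $A$-module $\omega(P)$, and $P^*=\mathrm{Hom}_A(P,A)$. Let $R=\bigoplus_{P,Q\in\mathcal A}\mathrm{Hom}_{\mathcal A}(P,Q)$ and $S=\bigoplus_{P,Q\in\mathcal A}\mathrm{Hom}_A(P,Q)$, rings (in general without unit) whose multiplication is given by composition, $fg=f\circ g$, where this is defined and by $0$ otherwise; $\omega$ induces a ring homomorphism $R\to S$, which makes $S$ a left $R$-module. Let $\mathrm{Mod}\text{-}R$ be the category of right $R$-modules $M$ that are unital, i.e. $M=MR$; a left $R$-module $N$ is called flat if $-\otimes_R N$ is exact on $\mathrm{Mod}\text{-}R$, and faithfully flat if this functor is exact and faithful. Put $\Sigma=\bigoplus_{P\in\mathcal A}P$, an $R$-$A$-bimodule with $tp=\omega(t)(p)$ for $t\in\mathrm{Hom}_{\mathcal A}(P,Q)$,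 $p\in P$, and $\Sigma^\dagger=\bigoplus_{P\in\mathcal A}P^*$, an $A$-$R$-bimodule with $\varphi t=\varphi\circ\omega(t)$ for $\varphi\in Q^*$, $t\in\mathrm{Hom}_{\mathcal A}(P,Q)$ (the actions between summands that do not match being $0$). For each $P$ let $\{e_i^*,e_i\}$ be a finite dual basis of $P_A$. The $A$-bimodule $\Sigma^\dagger\otimes_R\Sigma$ is an $A$-coring with comultiplication $\varphi\otimes_R p\mapsto\sum_i(\varphi\otimes_R e_i)\otimes_A(e_i^*\otimes_R p)$ and counit $\varphi\otimes_R p\mapsto\varphi(p)$, for $\varphi\in P^*$ and $p\in P$. For $X$ in $\mathrm{Mod}\text{-}R$, the right $A$-module $X\otimes_R\Sigma$ is a right $\Sigma^\dagger\otimes_R\Sigma$-comodule with coaction $x\otimes_R p\mapsto\sum_i(x\otimes_R e_i)\otimes_A(e_i^*\otimes_R p)$ for $p\in P$; and each $P\in\mathcal A$ is a right $\Sigma^\dagger\otimes_R\Sigma$-comodule with coaction $p\mapsto\sum_i e_i\otimes_A(e_i^*\otimes_R p)$. The maps $\omega(t)$ are comodule morphisms, so that $\omega$ induces a ring homomorphism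 $\lambda:R\to\overline R=\bigoplus_{P,Q\in\mathcal A}\mathrm{Hom}_{\Sigma^\dagger\otimes_R\Sigma}(P,Q)$. The following statements are equivalent. 1. ${}_A(\Sigma^\dagger\otimes_R\Sigma)$ is flat, $\mathcal A$ is a generating set of small projectives for the category $\mathrm{Comod}\text{-}(\Sigma^\dagger\otimes_R\Sigma)$ of right comodules (that is, $\mathrm{Hom}(P,-)$ preserves coproducts for each $P\in\mathcal A$, and the coproduct $\bigoplus_{P\in\mathcal A}P$ of comodules is a projective generator), and $\lambda$ is an isomorphism. 2. ${}_A(\Sigma^\dagger\otimes_R\Sigma)$ is flat and $-\otimes_R\Sigma:\mathrm{Mod}\text{-}R\to\mathrm{Comod}\text{-}(\Sigma^\dagger\otimes_R\Sigma)$ is an equivalence of categories. 3. ${}_R\Sigma$ is faithfully flat. 4. ${}_A(\Sigma^\dagger\otimes_R\Sigma)$ is flat and ${}_RS$ is faithfully flat. 5. ${}_R\Sigma$ is flat and ${}_RS$ is faithfully flat. -/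

import Mathlib

open CategoryTheory MulOpposite

universe u v w

namespace InfComatrix

open scoped DirectSum TensorProduct Classical

noncomputable section

/-! ### Modules over rings that need not have a unit -/

/-- A left module over a ring `R` that need not have a unit. A right `R`-module is a left module
over the opposite ring `Rᵐᵒᵖ`, with `op r • m` read as `m r`. -/
class NUModule (R : Type*) (M : Type*) [NonUnitalRing R] [AddCommGroup M] extends SMul R M where
  protected smul_add (r : R) (m n : M) : r • (m + n) = r • m + r • n
  protected add_smul (r s : R) (m : M) : (r + s) • m = r • m + s • m
  protected mul_smul (r s : R) (m : M) : (r * s) • m = r • s • m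

lemma NUModule.smul_zero' {R M : Type*} [NonUnitalRing R] [AddCommGroup M] [NUModule R M] (r : R) :
    r • (0 : M) = 0 := by
  have h := NUModule.smul_add r (0 : M) 0
  rwa [add_zero, left_eq_add] at h

lemma NUModule.zero_smul' {R M : Type*} [NonUnitalRing R] [AddCommGroup M] [NUModule R M] (m : M) :
    (0 : R) • m = 0 := by
  have h := NUModule.add_smul (0 : R) 0 m
  rwa [add_zero, left_eq_add] at h

/-! ### Tensor products over noncommutative rings, with or without unit -/

lemma toAddMonoidHom_smul_comm {E G M : Type*} [Monoid E] [AddCommGroup M]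
    [DistribMulAction E M] [SMul G M] [SMulCommClass E G M] (a : E) (b : G) (m : M) :
    DistribSMul.toAddMonoidHom M a (b • m) = b • DistribSMul.toAddMonoidHom M a m :=
  smul_comm a b m

section Tensor

variable (B : Type*) (M N : Type*) [AddCommGroup M] [AddCommGroup N] [SMul Bᵐᵒᵖ M] [SMul B N]

/-- The relations `m b ⊗ n = m ⊗ b n`. -/
def balanceRel : AddSubgroup (M ⊗[ℤ] N) :=
  AddSubgroup.closure {z | ∃ (m : M) (b : B) (n : N), z = (op b • m) ⊗ₜ[ℤ] n - m ⊗ₜ[ℤ] (b • n)}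

/-- The tensor product `M ⊗_B N` of a right `B`-module `M` and a left `B`-module `N`. -/
def BTensor : Type _ := (M ⊗[ℤ] N) ⧸ balanceRel B M N

instance : AddCommGroup (BTensor B M N) :=
  inferInstanceAs (AddCommGroup ((M ⊗[ℤ] N) ⧸ balanceRel B M N))

variable {M N}

/-- The elementary tensor `m ⊗_B n`. -/
def tmul (m : M) (n : N) : BTensor B M N := QuotientAddGroup.mk (m ⊗ₜ[ℤ] n)

lemma tmul_add (m : M) (n n' : N) : tmul B m (n + n') = tmul B m n + tmul B m n' := by
  simp only [tmul, TensorProduct.tmul_add]; rfl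

lemma add_tmul (m m' : M) (n : N) : tmul B (m + m') n = tmul B m n + tmul B m' n := by
  simp only [tmul, TensorProduct.add_tmul]; rfl

/-- The universal biadditive map `M × N → M ⊗_B N`. -/
def mk : M →+ N →+ BTensor B M N :=
  AddMonoidHom.mk' (fun m => AddMonoidHom.mk' (fun n => tmul B m n) (tmul_add B m))
    (fun m m' => by ext n; exact add_tmul B m m' n)

@[simp] lemma mk_apply (m : M) (n : N) : mk B m n = tmul B m n := rfl

lemma tmul_zero (m : M) : tmul B m (0 : N) = 0 := map_zero (mk B m)

lemma zero_tmul (n : N) : tmul B (0 : M) n = 0 := by rw [← mk_apply, map_zero]; rfl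

lemma sum_tmul {κ : Type*} (s : Finset κ) (f : κ → M) (n : N) :
    tmul B (∑ i ∈ s, f i) n = ∑ i ∈ s, tmul B (f i) n := by
  rw [← mk_apply, map_sum, AddMonoidHom.finsetSum_apply]; rfl

lemma tmul_sum {κ : Type*} (s : Finset κ) (m : M) (f : κ → N) :
    tmul B m (∑ i ∈ s, f i) = ∑ i ∈ s, tmul B m (f i) := map_sum (mk B m) f s

variable {B}

lemma smul_tmul (m : M) (b : B) (n : N) : tmul B (op b • m) n = tmul B m (b • n) := by
  refine (QuotientAddGroup.eq_iff_sub_mem).2 ?_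
  exact AddSubgroup.subset_closure ⟨m, b, n, rfl⟩

@[elab_as_elim]
lemma BTensor.induction {p : BTensor B M N → Prop} (z : BTensor B M N)
    (zero : p 0) (tmul : ∀ m n, p (tmul B m n)) (add : ∀ x y, p x → p y → p (x + y)) : p z := by
  obtain ⟨t, rfl⟩ := QuotientAddGroup.mk_surjective z
  induction t using TensorProduct.induction_on with
  | zero => exact zero
  | tmul m n => exact tmul m n
  | add x y hx hy => exact add _ _ hx hy

/-- The universal property of `M ⊗_B N`. -/
def lift {G : Type*} [AddCommGroup G] (f : M →+ N →+ G)
    (hf : ∀ m (b : B) n, f (op b • m) n = f m (b • n)) : BTensor B M N →+ G :=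
  QuotientAddGroup.lift _ (TensorProduct.liftAddHom f (fun r m n => by simp)) (by
    intro z hz
    refine (AddSubgroup.closure_le (AddMonoidHom.ker _)).2 ?_ hz
    rintro _ ⟨m, b, n, rfl⟩
    simp [AddMonoidHom.mem_ker, hf])

@[simp] lemma lift_tmul {G : Type*} [AddCommGroup G] (f : M →+ N →+ G)
    (hf : ∀ m (b : B) n, f (op b • m) n = f m (b • n)) (m : M) (n : N) :
    lift f hf (tmul B m n) = f m n := rfl

lemma hom_ext {G : Type*} [AddCommGroup G] {f g : BTensor B M N →+ G}
    (h : ∀ m n, f (tmul B m n) = g (tmul B m n)) : f = g := by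
  ext z
  induction z using BTensor.induction with
  | zero => simp
  | tmul m n => exact h m n
  | add x y hx hy => rw [map_add, map_add, hx, hy]

section Map

variable {M' N' : Type*} [AddCommGroup M'] [AddCommGroup N'] [SMul Bᵐᵒᵖ M'] [SMul B N']

variable (N) in
/-- The additive map `f ⊗_B N`, for a right `B`-linear map `f`. -/
def rmap (f : M →+ M') (hf : ∀ (b : B) m, f (op b • m) = op b • f m) :
    BTensor B M N →+ BTensor B M' N :=
  lift ((mk B).comp f) (fun m b n => by simp [hf, smul_tmul])

variable (M) in
/-- The additive map `M ⊗_B g`, for a left `B`-linear map `g`. -/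
def lmap (g : N →+ N') (hg : ∀ (b : B) n, g (b • n) = b • g n) :
    BTensor B M N →+ BTensor B M N' :=
  lift ((AddMonoidHom.compHom' g).comp (mk B)) (fun m b n => by
    simp [AddMonoidHom.compHom', hg, smul_tmul])

@[simp] lemma rmap_tmul (f : M →+ M') (hf : ∀ (b : B) m, f (op b • m) = op b • f m)
    (m : M) (n : N) : rmap N f hf (tmul B m n) = tmul B (f m) n := rfl

@[simp] lemma lmap_tmul (g : N →+ N') (hg : ∀ (b : B) n, g (b • n) = b • g n)
    (m : M) (n : N) : lmap M g hg (tmul B m n) = tmul B m (g n) := rfl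

end Map

/-- A left `E`-action on `M` commuting with the right `B`-action acts on `M ⊗_B N` by
`a (m ⊗ n) = a m ⊗ n`. -/
def leftEnd {E : Type*} [Ring E] [Module E M] [SMulCommClass E Bᵐᵒᵖ M] :
    E →+* AddMonoid.End (BTensor B M N) where
  toFun a := rmap N (DistribSMul.toAddMonoidHom M a) (fun b => toAddMonoidHom_smul_comm a (op b))
  map_one' := hom_ext fun m n => by rw [rmap_tmul]; simp; rfl
  map_mul' a b := hom_ext fun m n => by rw [rmap_tmul]; simp [mul_smul]; rfl
  map_zero' := hom_ext fun m n => by rw [rmap_tmul]; simp [zero_tmul]; rfl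
  map_add' a b := hom_ext fun m n => by rw [rmap_tmul]; simp [add_smul, add_tmul]; rfl

/-- A right `E`-action on `N` commuting with the left `B`-action acts on `M ⊗_B N` by
`(m ⊗ n) a = m ⊗ n a`. -/
def rightEnd {E : Type*} [Ring E] [Module Eᵐᵒᵖ N] [SMulCommClass Eᵐᵒᵖ B N] :
    Eᵐᵒᵖ →+* AddMonoid.End (BTensor B M N) where
  toFun a := lmap M (DistribSMul.toAddMonoidHom N a) (toAddMonoidHom_smul_comm a)
  map_one' := hom_ext fun m n => by rw [lmap_tmul]; simp; rfl
  map_mul' a b := hom_ext fun m n => by rw [lmap_tmul]; simp [mul_smul]; rfl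
  map_zero' := hom_ext fun m n => by rw [lmap_tmul]; simp [tmul_zero]; rfl
  map_add' a b := hom_ext fun m n => by rw [lmap_tmul]; simp [add_smul, tmul_add]; rfl

instance leftModule {E : Type*} [Ring E] [Module E M] [SMulCommClass E Bᵐᵒᵖ M] :
    Module E (BTensor B M N) :=
  Module.compHom _ (leftEnd (B := B) (M := M) (N := N) (E := E))

instance (priority := high) rightModule {E : Type*} [Ring E] [Module Eᵐᵒᵖ N]
    [SMulCommClass Eᵐᵒᵖ B N] : Module Eᵐᵒᵖ (BTensor B M N) :=
  Module.compHom _ (rightEnd (B := B) (M := M) (N := N) (E := E))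

lemma left_smul_tmul {E : Type*} [Ring E] [Module E M] [SMulCommClass E Bᵐᵒᵖ M] (a : E)
    (m : M) (n : N) : a • tmul B m n = tmul B (a • m) n := rfl

lemma right_smul_tmul {E : Type*} [Ring E] [Module Eᵐᵒᵖ N] [SMulCommClass Eᵐᵒᵖ B N] (a : E)
    (m : M) (n : N) : op a • tmul B m n = tmul B m (op a • n) := rfl

instance bimodule {E : Type*} [Ring E] [Module E M] [SMulCommClass E Bᵐᵒᵖ M]
    {E' : Type*} [Ring E'] [Module E'ᵐᵒᵖ N] [SMulCommClass E'ᵐᵒᵖ B N] :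
    SMulCommClass E E'ᵐᵒᵖ (BTensor B M N) where
  smul_comm a a' z := by
    induction z using BTensor.induction with
    | zero => simp
    | tmul m n => rfl
    | add x y hx hy => simp only [smul_add, hx, hy]

instance bimodule' {E : Type*} [Ring E] [Module E M] [SMulCommClass E Bᵐᵒᵖ M]
    {E' : Type*} [Ring E'] [Module E'ᵐᵒᵖ N] [SMulCommClass E'ᵐᵒᵖ B N] :
    SMulCommClass E'ᵐᵒᵖ E (BTensor B M N) :=
  SMulCommClass.symm _ _ _

end Tensor

/-! ### Corings and comodules over a unital ring `A` -/

section Coring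

variable (A : Type u) [Ring A]

/-- The left `A`-module `N` is flat: `- ⊗_A N` preserves injectivity of maps of
right `A`-modules. -/
def IsFlat (N : Type u) [AddCommGroup N] [Module A N] : Prop :=
  ∀ (X Y : Type u) [AddCommGroup X] [AddCommGroup Y] [Module Aᵐᵒᵖ X] [Module Aᵐᵒᵖ Y]
    (f : X →ₗ[Aᵐᵒᵖ] Y), Function.Injective f →
      Function.Injective (rmap (B := A) N f.toAddMonoidHom
        (fun b x => f.map_smul (op b) x))

/-- The map `c ↦ (l ↦ m ⊗ (c ⊗ l))`. -/
def assocAux₁ (M C L : Type*) [AddCommGroup M] [AddCommGroup C] [AddCommGroup L]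
    [Module Aᵐᵒᵖ M] [Module A C] [Module Aᵐᵒᵖ C] [SMulCommClass A Aᵐᵒᵖ C] [Module A L] (m : M) :
    C →+ L →+ BTensor A M (BTensor A C L) :=
  AddMonoidHom.mk' (fun c => (mk A m).comp (mk A c))
    (fun c c' => by ext l; simp [tmul_add])

/-- The map `m ⊗ c ↦ (l ↦ m ⊗ (c ⊗ l))`. -/
def assocAux₂ (M C L : Type*) [AddCommGroup M] [AddCommGroup C] [AddCommGroup L]
    [Module Aᵐᵒᵖ M] [Module A C] [Module Aᵐᵒᵖ C] [SMulCommClass A Aᵐᵒᵖ C] [Module A L] :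
    BTensor A M C →+ L →+ BTensor A M (BTensor A C L) :=
  lift (B := A) (AddMonoidHom.mk' (assocAux₁ A M C L)
      (fun m m' => by ext c l; simp [assocAux₁]))
    (fun m b n => by ext l; simp [assocAux₁, smul_tmul, left_smul_tmul])

/-- The canonical map `(M ⊗_A C) ⊗_A L → M ⊗_A (C ⊗_A L)`, `(m ⊗ c) ⊗ l ↦ m ⊗ (c ⊗ l)`. -/
def assoc (M C L : Type*) [AddCommGroup M] [AddCommGroup C] [AddCommGroup L]
    [Module Aᵐᵒᵖ M] [Module A C] [Module Aᵐᵒᵖ C] [SMulCommClass A Aᵐᵒᵖ C]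
    [SMulCommClass Aᵐᵒᵖ A C] [Module A L] :
    BTensor A (BTensor A M C) L →+ BTensor A M (BTensor A C L) :=
  lift (B := A) (assocAux₂ A M C L) (fun z b l => by
    induction z using BTensor.induction with
    | zero => rw [smul_zero, map_zero]; rfl
    | tmul m c =>
      rw [right_smul_tmul]
      change tmul A m (tmul A (op b • c) l) = tmul A m (tmul A c (b • l))
      rw [smul_tmul]
    | add x y hx hy =>
      rw [smul_add, map_add, map_add, AddMonoidHom.add_apply, AddMonoidHom.add_apply, hx, hy])

@[simp] lemma assoc_tmul (M C L : Type*) [AddCommGroup M] [AddCommGroup C] [AddCommGroup L]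
    [Module Aᵐᵒᵖ M] [Module A C] [Module Aᵐᵒᵖ C] [SMulCommClass A Aᵐᵒᵖ C]
    [SMulCommClass Aᵐᵒᵖ A C] [Module A L] (m : M) (c : C) (l : L) :
    assoc A M C L (tmul A (tmul A m c) l) = tmul A m (tmul A c l) := rfl

/-- The canonical map `M ⊗_A A → M`. -/
def runit (M : Type*) [AddCommGroup M] [Module Aᵐᵒᵖ M] : BTensor A M A →+ M :=
  lift (AddMonoidHom.mk' (fun m => AddMonoidHom.mk' (fun a => op a • m)
      (fun a b => by simp [add_smul]))
    (fun m m' => by ext a; simp)) (fun m b n => by simp [mul_smul])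

@[simp] lemma runit_tmul (M : Type*) [AddCommGroup M] [Module Aᵐᵒᵖ M] (m : M) (a : A) :
    runit A M (tmul A m a) = op a • m := rfl

/-- The canonical map `A ⊗_A N → N`. -/
def lunit (N : Type*) [AddCommGroup N] [Module A N] : BTensor A A N →+ N :=
  lift (AddMonoidHom.mk' (fun a => DistribSMul.toAddMonoidHom N a)
    (fun a b => by ext n; simp [add_smul])) (fun a b n => by simp [mul_smul])

@[simp] lemma lunit_tmul (N : Type*) [AddCommGroup N] [Module A N] (a : A) (n : N) :
    lunit A N (tmul A a n) = a • n := rfl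

/-- The structure of an `A`-coring on an `A`-bimodule `C`. -/
structure Coring (C : Type u) [AddCommGroup C] [Module A C] [Module Aᵐᵒᵖ C]
    [SMulCommClass A Aᵐᵒᵖ C] [SMulCommClass Aᵐᵒᵖ A C] where
  /-- the comultiplication -/
  comul : C →+ BTensor A C C
  comul_smul : ∀ (a : A) (c : C), comul (a • c) = a • comul c
  comul_op_smul : ∀ (a : A) (c : C), comul (op a • c) = op a • comul c
  /-- the counit -/
  counit : C →+ A
  counit_smul : ∀ (a : A) (c : C), counit (a • c) = a • counit c
  counit_op_smul : ∀ (a : A) (c : C), counit (op a • c) = op a • counit c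
  coassoc : ∀ c : C,
    assoc A C C C (rmap C comul comul_op_smul (comul c)) =
      lmap C comul comul_smul (comul c)
  counit_left : ∀ c : C,
    lunit A C (rmap C counit counit_op_smul (comul c)) = c
  counit_right : ∀ c : C,
    runit A C (lmap C counit counit_smul (comul c)) = c

variable {A}
variable {C : Type u} [AddCommGroup C] [Module A C]

variable (C) in
/-- For a right `A`-linear map `f`, the map `f ⊗_A C`. -/
def mapC {M N : Type*} [AddCommGroup M]
    [AddCommGroup N] [Module Aᵐᵒᵖ M] [Module Aᵐᵒᵖ N]
    (f : M →ₗ[Aᵐᵒᵖ] N) : BTensor A M C →+ BTensor A N C :=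
  rmap C f.toAddMonoidHom (fun b x => f.map_smul (op b) x)

@[simp] lemma mapC_tmul {M N : Type*} [AddCommGroup M]
    [AddCommGroup N] [Module Aᵐᵒᵖ M] [Module Aᵐᵒᵖ N]
    (f : M →ₗ[Aᵐᵒᵖ] N) (m : M) (c : C) : mapC C f (tmul A m c) = tmul A (f m) c := rfl

lemma mapC_id (M : Type*) [AddCommGroup M] [Module Aᵐᵒᵖ M] :
    mapC (A := A) C (LinearMap.id : M →ₗ[Aᵐᵒᵖ] M) = AddMonoidHom.id _ :=
  hom_ext fun _ _ => rfl

lemma mapC_comp {L M N : Type*} [AddCommGroup L] [AddCommGroup M] [AddCommGroup N]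
    [Module Aᵐᵒᵖ L] [Module Aᵐᵒᵖ M] [Module Aᵐᵒᵖ N] (g : M →ₗ[Aᵐᵒᵖ] N) (f : L →ₗ[Aᵐᵒᵖ] M) :
    mapC C (g ∘ₗ f) = (mapC C g).comp (mapC C f) :=
  hom_ext fun _ _ => rfl

lemma mapC_add {M N : Type*} [AddCommGroup M] [AddCommGroup N]
    [Module Aᵐᵒᵖ M] [Module Aᵐᵒᵖ N] (f g : M →ₗ[Aᵐᵒᵖ] N) :
    mapC C (f + g) = mapC C f + mapC C g :=
  hom_ext fun m c => by simp [add_tmul]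

lemma mapC_op_smul [Module Aᵐᵒᵖ C] [SMulCommClass Aᵐᵒᵖ A C] {M N : Type*} [AddCommGroup M] [AddCommGroup N]
    [Module Aᵐᵒᵖ M] [Module Aᵐᵒᵖ N] (f : M →ₗ[Aᵐᵒᵖ] N) (a : A) (z : BTensor A M C) :
    mapC C f (op a • z) = op a • mapC C f z := by
  induction z using BTensor.induction with
  | zero => simp
  | tmul m n => rfl
  | add x y hx hy => simp only [smul_add, map_add, hx, hy]

variable [Module Aᵐᵒᵖ C] [SMulCommClass A Aᵐᵒᵖ C] [SMulCommClass Aᵐᵒᵖ A C]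

/-- A right comodule over an `A`-coring. -/
structure Comod (D : Coring A C) where
  /-- the underlying right `A`-module -/
  carrier : Type u
  [addCommGroup : AddCommGroup carrier]
  [module : Module Aᵐᵒᵖ carrier]
  /-- the coaction -/
  coact : carrier →ₗ[Aᵐᵒᵖ] BTensor A carrier C
  coassoc : ∀ m : carrier,
    assoc A carrier C C (mapC C coact (coact m)) = lmap carrier D.comul D.comul_smul (coact m)
  counit : ∀ m : carrier,
    runit A carrier (lmap carrier D.counit D.counit_smul (coact m)) = m

attribute [instance] Comod.addCommGroup Comod.module

/-- The group of comodule morphisms `M → N`: right `A`-linear maps `f` with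
`(f ⊗_A C) ∘ ρ_M = ρ_N ∘ f`. -/
def Comod.homs {D : Coring A C} (M N : Comod D) : AddSubgroup (M.carrier →ₗ[Aᵐᵒᵖ] N.carrier) where
  carrier := {f | ∀ m, mapC C f (M.coact m) = N.coact (f m)}
  zero_mem' m := by
    have : mapC C (0 : M.carrier →ₗ[Aᵐᵒᵖ] N.carrier) = 0 := hom_ext fun m c => by simp [zero_tmul]
    simp [this]
  add_mem' {f g} hf hg m := by
    rw [mapC_add, AddMonoidHom.add_apply, hf m, hg m]; simp
  neg_mem' {f} hf m := by
    have : mapC C (-f) = - mapC C f := by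
      rw [eq_neg_iff_add_eq_zero, ← mapC_add, neg_add_cancel]
      exact hom_ext fun m c => by simp [zero_tmul]
    rw [this, AddMonoidHom.neg_apply, hf m]; simp

instance Comod.category (D : Coring A C) : Category (Comod D) where
  Hom M N := Comod.homs M N
  id M := ⟨LinearMap.id, fun m => by rw [mapC_id]; rfl⟩
  comp f g := ⟨g.1 ∘ₗ f.1, fun m => by
    rw [mapC_comp, AddMonoidHom.comp_apply, f.2 m, g.2 (f.1 m)]; rfl⟩

instance Comod.preadditive (D : Coring A C) : Preadditive (Comod D) where
  homGroup M N := inferInstanceAs (AddCommGroup (Comod.homs M N))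
  add_comp _ _ _ f f' g := Subtype.ext (LinearMap.comp_add f.1 f'.1 g.1)
  comp_add _ _ _ f g g' := Subtype.ext (LinearMap.add_comp f.1 g'.1 g.1)

end Coring

/-! ### The ring of a family of objects -/

section MatRing

variable {ι : Type u} {𝒞 : Type w} [Category.{u} 𝒞] [Preadditive 𝒞]

/-- For a family `F` of objects in a preadditive category, the abelian group
`⨁ P, ⨁ Q, Hom (F P) (F Q)`. It is a ring, in general without unit, with `f g = f ∘ g` if this
composition is defined and `f g = 0` otherwise, for `f : F P ⟶ F Q` and `g : F P' ⟶ F Q'`. -/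
def MatRing (F : ι → 𝒞) : Type u := ⨁ (P : ι) (Q : ι), (F P ⟶ F Q)

variable {F : ι → 𝒞}

instance : AddCommGroup (MatRing F) :=
  inferInstanceAs (AddCommGroup (⨁ (P : ι) (Q : ι), (F P ⟶ F Q)))

/-- The element of `MatRing F` with the single entry `f`. -/
def single (P Q : ι) : (F P ⟶ F Q) →+ MatRing F :=
  (DirectSum.of (fun P => ⨁ (Q : ι), (F P ⟶ F Q)) P).comp
    (DirectSum.of (fun Q => (F P ⟶ F Q)) Q)

/-- The entries of an element of `MatRing F` with a given source. -/
def row (P : ι) : MatRing F →+ ⨁ (Q : ι), (F P ⟶ F Q) where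
  toFun := fun (t : ⨁ (P : ι) (Q : ι), (F P ⟶ F Q)) => t P
  map_zero' := rfl
  map_add' _ _ := rfl

@[elab_as_elim]
lemma MatRing.induction {p : MatRing F → Prop} (t : MatRing F) (zero : p 0)
    (single : ∀ P Q f, p (single P Q f)) (add : ∀ x y, p x → p y → p (x + y)) : p t := by
  induction t using DirectSum.induction_on with
  | zero => exact zero
  | of P x =>
    induction x using DirectSum.induction_on with
    | zero => rw [map_zero]; exact zero
    | of Q f => exact single P Q f
    | add x y hx hy => rw [map_add]; exact add _ _ hx hy
  | add x y hx hy => exact add x y hx hy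

lemma row_single_same (P Q : ι) (f : F P ⟶ F Q) :
    row P (single P Q f) = DirectSum.of (fun Q => (F P ⟶ F Q)) Q f :=
  DirectSum.of_eq_same P _

lemma row_single_ne {P P' : ι} (h : P ≠ P') (Q : ι) (f : F P ⟶ F Q) :
    row P' (single P Q f) = 0 :=
  DirectSum.of_eq_of_ne P P' _ h.symm

variable {X : ι → Type v} [∀ P, AddCommGroup (X P)]

/-- Given a family of groups `X P` and biadditive maps `a P Q : Hom (F P) (F Q) × X P → X Q`, the
resulting action of `MatRing F` on `⨁ P, X P`. -/
def leftAct (a : ∀ P Q, (F P ⟶ F Q) →+ X P →+ X Q) (t : MatRing F) :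
    (⨁ P, X P) →+ ⨁ P, X P :=
  DirectSum.toAddMonoid (fun P => AddMonoidHom.mk'
    (fun x => DirectSum.map (fun Q => (a P Q).flip x) (row P t))
    (fun x y => by ext Q; simp))

lemma leftAct_of (a : ∀ P Q, (F P ⟶ F Q) →+ X P →+ X Q) (t : MatRing F) (P : ι) (x : X P) :
    leftAct a t (DirectSum.of X P x) = DirectSum.map (fun Q => (a P Q).flip x) (row P t) := by
  simp [leftAct]

lemma leftAct_add (a : ∀ P Q, (F P ⟶ F Q) →+ X P →+ X Q) (s t : MatRing F) :
    leftAct a (s + t) = leftAct a s + leftAct a t := by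
  refine DirectSum.addHom_ext fun P x => ?_
  rw [AddMonoidHom.add_apply, leftAct_of, leftAct_of, leftAct_of, map_add, map_add]

lemma leftAct_single (a : ∀ P Q, (F P ⟶ F Q) →+ X P →+ X Q) {P Q : ι} (f : F P ⟶ F Q) (x : X P) :
    leftAct a (single P Q f) (DirectSum.of X P x) = DirectSum.of X Q (a P Q f x) := by
  rw [leftAct_of, row_single_same, DirectSum.map_of]; rfl

lemma leftAct_single_ne (a : ∀ P Q, (F P ⟶ F Q) →+ X P →+ X Q) {P P' Q : ι} (h : P ≠ P')
    (f : F P ⟶ F Q) (x : X P') :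
    leftAct a (single P Q f) (DirectSum.of X P' x) = 0 := by
  rw [leftAct_of, row_single_ne h, map_zero]

/-- Composition `(f, g) ↦ f ∘ g`, as a biadditive map. -/
def compAct (P₀ P Q : ι) : (F P ⟶ F Q) →+ (F P₀ ⟶ F P) →+ (F P₀ ⟶ F Q) :=
  AddMonoidHom.mk' (fun f => AddMonoidHom.mk' (fun g => g ≫ f) (by simp)) (fun f f' => by ext; simp)

instance : Mul (MatRing F) where
  mul s t := DirectSum.map (fun P => leftAct (compAct P) s) t

lemma row_mul (s t : MatRing F) (P : ι) : row P (s * t) = leftAct (compAct P) s (row P t) :=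
  DirectSum.map_apply (fun P => leftAct (compAct P) s) P t

lemma single_mul_single {P Q Q' : ι} (f : F Q ⟶ F Q') (g : F P ⟶ F Q) :
    single Q Q' f * single P Q g = single P Q' (g ≫ f) :=
  (DirectSum.map_of _ _ _).trans (congrArg _ (leftAct_single _ _ _))

lemma single_mul_single_ne {P Q P' Q' : ι} (h : P ≠ Q') (f : F P ⟶ F Q) (g : F P' ⟶ F Q') :
    single P Q f * single P' Q' g = 0 :=
  (DirectSum.map_of _ _ _).trans ((congrArg _ (leftAct_single_ne _ h _ _)).trans (map_zero _))

lemma leftAct_mul (a : ∀ P Q, (F P ⟶ F Q) →+ X P →+ X Q)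
    (ha : ∀ P Q Q' (f : F P ⟶ F Q) (g : F Q ⟶ F Q') (x : X P),
      a P Q' (f ≫ g) x = a Q Q' g (a P Q f x)) (s t : MatRing F) :
    leftAct a (s * t) = (leftAct a s).comp (leftAct a t) := by
  refine DirectSum.addHom_ext fun P x => ?_
  rw [AddMonoidHom.comp_apply, leftAct_of, leftAct_of, row_mul]
  induction (row P t) using DirectSum.induction_on with
  | zero => simp
  | of Q f =>
    rw [leftAct_of, DirectSum.map_of, leftAct_of]
    refine DirectSum.ext fun Q' => ?_
    simp only [DirectSum.map_apply]
    exact ha P Q Q' f _ x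
  | add y z hy hz => rw [map_add, map_add, map_add, map_add, hy, hz]

lemma MatRing.ext_row {s t : MatRing F} (h : ∀ P, row P s = row P t) : s = t :=
  DirectSum.ext h

instance : NonUnitalRing (MatRing F) where
  left_distrib s t t' := MatRing.ext_row fun P => by
    rw [map_add, row_mul, row_mul, row_mul, map_add, map_add]
  right_distrib s s' t := MatRing.ext_row fun P => by
    rw [map_add, row_mul, row_mul, row_mul, leftAct_add, AddMonoidHom.add_apply]
  zero_mul t := MatRing.ext_row fun P => by
    have : leftAct (compAct P) (0 : MatRing F) = 0 := by
      refine DirectSum.addHom_ext fun Q x => ?_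
      rw [leftAct_of, map_zero, map_zero]; rfl
    rw [row_mul, this, map_zero]; rfl
  mul_zero s := MatRing.ext_row fun P => by rw [row_mul, map_zero, map_zero]
  mul_assoc s t r := MatRing.ext_row fun P => by
    rw [row_mul, row_mul, row_mul, leftAct_mul, AddMonoidHom.comp_apply]
    intro Q Q' Q'' f g x
    exact (Category.assoc x f g).symm

variable {Y : ι → Type v} [∀ P, AddCommGroup (Y P)]

/-- The entry with a given target. -/
def entry (P Q : ι) : (⨁ (Q : ι), (F P ⟶ F Q)) →+ (F P ⟶ F Q) where
  toFun x := x Q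
  map_zero' := rfl
  map_add' _ _ := rfl

lemma entry_of_same (P Q : ι) (f : F P ⟶ F Q) :
    entry P Q (DirectSum.of (fun Q => (F P ⟶ F Q)) Q f) = f :=
  DirectSum.of_eq_same (β := fun Q => (F P ⟶ F Q)) Q f

lemma entry_of_ne (P : ι) {Q Q' : ι} (h : Q ≠ Q') (f : F P ⟶ F Q) :
    entry P Q' (DirectSum.of (fun Q => (F P ⟶ F Q)) Q f) = 0 :=
  DirectSum.of_eq_of_ne (β := fun Q => (F P ⟶ F Q)) Q Q' f h.symm

/-- For a family of additive maps `φ P` from the rows of elements of `MatRing F` to groups `Y P`,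
the induced map to `⨁ P, Y P`. -/
def mapRows (φ : ∀ P, (⨁ (Q : ι), (F P ⟶ F Q)) →+ Y P) : MatRing F →+ ⨁ P, Y P :=
  DirectSum.map φ

lemma mapRows_apply (φ : ∀ P, (⨁ (Q : ι), (F P ⟶ F Q)) →+ Y P) (t : MatRing F) (P : ι) :
    mapRows φ t P = φ P (row P t) := DirectSum.map_apply φ P t

lemma mapRows_single (φ : ∀ P, (⨁ (Q : ι), (F P ⟶ F Q)) →+ Y P) (P Q : ι) (f : F P ⟶ F Q) :
    mapRows φ (single P Q f) = DirectSum.of Y P (φ P (DirectSum.of (fun Q => (F P ⟶ F Q)) Q f)) :=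
  DirectSum.map_of _ _ _

/-- Given a family of groups `Y P` and biadditive maps `b P Q : Hom (F P) (F Q) × Y Q → Y P`, the
resulting right action of `MatRing F` on `⨁ P, Y P`. -/
def rightAct (b : ∀ P Q, (F P ⟶ F Q) →+ Y Q →+ Y P) (t : MatRing F) :
    (⨁ P, Y P) →+ ⨁ P, Y P :=
  DirectSum.toAddMonoid (fun Q => AddMonoidHom.mk'
    (fun y => mapRows (fun P => ((b P Q).flip y).comp (entry P Q)) t)
    (fun x y => DirectSum.ext fun P => by
      rw [DirectSum.add_apply, mapRows_apply, mapRows_apply, mapRows_apply]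
      simp))

lemma rightAct_of (b : ∀ P Q, (F P ⟶ F Q) →+ Y Q →+ Y P) (t : MatRing F) (Q : ι) (y : Y Q) :
    rightAct b t (DirectSum.of Y Q y) =
      mapRows (fun P => ((b P Q).flip y).comp (entry P Q)) t := by
  simp [rightAct]

lemma rightAct_add (b : ∀ P Q, (F P ⟶ F Q) →+ Y Q →+ Y P) (s t : MatRing F) :
    rightAct b (s + t) = rightAct b s + rightAct b t := by
  refine DirectSum.addHom_ext fun P x => ?_
  rw [AddMonoidHom.add_apply, rightAct_of, rightAct_of, rightAct_of]
  exact map_add _ _ _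

lemma rightAct_zero (b : ∀ P Q, (F P ⟶ F Q) →+ Y Q →+ Y P) : rightAct b (0 : MatRing F) = 0 := by
  have h := rightAct_add b (0 : MatRing F) 0
  rwa [add_zero, left_eq_add] at h

lemma rightAct_single (b : ∀ P Q, (F P ⟶ F Q) →+ Y Q →+ Y P) {P Q : ι} (f : F P ⟶ F Q) (y : Y Q) :
    rightAct b (single P Q f) (DirectSum.of Y Q y) = DirectSum.of Y P (b P Q f y) := by
  rw [rightAct_of, mapRows_single, AddMonoidHom.comp_apply, entry_of_same]; rfl

lemma rightAct_single_ne (b : ∀ P Q, (F P ⟶ F Q) →+ Y Q →+ Y P) {P Q Q' : ι} (h : Q ≠ Q')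
    (f : F P ⟶ F Q) (y : Y Q') :
    rightAct b (single P Q f) (DirectSum.of Y Q' y) = 0 := by
  rw [rightAct_of, mapRows_single, AddMonoidHom.comp_apply, entry_of_ne _ h, map_zero, map_zero]

lemma rightAct_mul (b : ∀ P Q, (F P ⟶ F Q) →+ Y Q →+ Y P)
    (hb : ∀ P Q Q' (f : F P ⟶ F Q) (g : F Q ⟶ F Q') (y : Y Q'),
      b P Q' (f ≫ g) y = b P Q f (b Q Q' g y)) (s t : MatRing F) :
    rightAct b (s * t) = (rightAct b t).comp (rightAct b s) := by
  induction s using MatRing.induction with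
  | zero => rw [zero_mul, rightAct_zero, AddMonoidHom.comp_zero]
  | add x y hx hy => rw [add_mul, rightAct_add, rightAct_add, hx, hy, AddMonoidHom.comp_add]
  | single P Q f =>
    induction t using MatRing.induction with
    | zero => rw [mul_zero, rightAct_zero, AddMonoidHom.zero_comp]
    | add x y hx hy => rw [mul_add, rightAct_add, rightAct_add, hx, hy, AddMonoidHom.add_comp]
    | single P' Q' g =>
      refine DirectSum.addHom_ext fun Q₀ y => ?_
      rw [AddMonoidHom.comp_apply]
      by_cases h : P = Q'
      · subst h
        rw [single_mul_single]
        by_cases h' : Q = Q₀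
        · subst h'
          rw [rightAct_single, rightAct_single, rightAct_single, hb]
        · rw [rightAct_single_ne _ h', rightAct_single_ne _ h', map_zero]
      · rw [single_mul_single_ne h, rightAct_zero]
        by_cases h' : Q = Q₀
        · subst h'
          rw [rightAct_single, rightAct_single_ne _ (Ne.symm h)]; rfl
        · rw [rightAct_single_ne _ h', map_zero]; rfl

/-- An additive functor `G` induces a ring homomorphism from the ring of the family `F P` to the
ring of the family `G (F P)`. -/
def MatRing.map {𝒟 : Type*} [Category.{u} 𝒟] [Preadditive 𝒟] (F : ι → 𝒞) (G : 𝒞 ⥤ 𝒟)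
    [G.Additive] : MatRing F →ₙ+* MatRing (fun P => G.obj (F P)) :=
  let φ : MatRing F →+ MatRing (fun P => G.obj (F P)) :=
    DirectSum.map (fun _ => DirectSum.map (fun _ => G.mapAddHom))
  have hφ : ∀ P Q (f : F P ⟶ F Q), φ (single P Q f) = single P Q (G.map f) := fun P Q f =>
    (DirectSum.map_of _ _ _).trans (congrArg _ (DirectSum.map_of _ _ _))
  { φ with
    map_mul' := fun s t => by
      change φ (s * t) = φ s * φ t
      induction s using MatRing.induction with
      | zero => rw [zero_mul, map_zero, zero_mul]
      | add x y hx hy => rw [add_mul, map_add, map_add, add_mul, hx, hy]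
      | single P Q f =>
        induction t using MatRing.induction with
        | zero => rw [mul_zero, map_zero, mul_zero]
        | add x y hx hy => rw [mul_add, map_add, map_add, mul_add, hx, hy]
        | single P' Q' g =>
          by_cases h : P = Q'
          · subst h
            rw [single_mul_single, hφ, hφ, hφ, G.map_comp, single_mul_single]
          · rw [single_mul_single_ne h, hφ, hφ, map_zero, single_mul_single_ne h] }

lemma MatRing.map_single {𝒟 : Type*} [Category.{u} 𝒟] [Preadditive 𝒟] (F : ι → 𝒞) (G : 𝒞 ⥤ 𝒟)
    [G.Additive] (P Q : ι) (f : F P ⟶ F Q) :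
    MatRing.map F G (single P Q f) = single P Q (G.map f) :=
  (DirectSum.map_of _ _ _).trans (congrArg _ (DirectSum.map_of _ _ _))

end MatRing

/-! ### Unital right modules and faithful flatness over rings without unit -/

section UMod

variable (R : Type u) [NonUnitalRing R]

/-- A right `R`-module `M` which is unital in the sense that `M = M R`. -/
structure UMod where
  /-- the underlying abelian group -/
  carrier : Type u
  [addCommGroup : AddCommGroup carrier]
  [module : NUModule Rᵐᵒᵖ carrier]
  unital : AddSubgroup.closure {x : carrier | ∃ (r : R) (m : carrier), x = op r • m} = ⊤

attribute [instance] UMod.addCommGroup UMod.module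

variable {R}

/-- A homomorphism of right `R`-modules. -/
@[ext]
structure UMod.Hom (X Y : UMod R) where
  /-- the underlying additive map -/
  hom : X.carrier →+ Y.carrier
  map_smul : ∀ (r : R) (x : X.carrier), hom (op r • x) = op r • hom x

/-- The category of unital right `R`-modules. -/
instance UMod.category : Category (UMod R) where
  Hom := UMod.Hom
  id X := ⟨AddMonoidHom.id _, fun _ _ => rfl⟩
  comp f g := ⟨g.hom.comp f.hom, fun r x => by simp [f.map_smul, g.map_smul]⟩

/-- The additive map `f ⊗_R N` for a morphism `f` of unital right `R`-modules and a left
`R`-module `N`. -/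
def UMod.tensorMap (N : Type u) [AddCommGroup N] [NUModule R N] {X Y : UMod R} (f : X ⟶ Y) :
    BTensor R X.carrier N →+ BTensor R Y.carrier N :=
  rmap N (UMod.Hom.hom f) (UMod.Hom.map_smul f)

variable (R)

/-- The left `R`-module `N` is flat: the functor `- ⊗_R N` on unital right `R`-modules
preserves injectivity. -/
def NUFlat (N : Type u) [AddCommGroup N] [NUModule R N] : Prop :=
  ∀ (X Y : UMod R) (f : X ⟶ Y), Function.Injective (UMod.Hom.hom f) →
    Function.Injective (UMod.tensorMap N f)

/-- The left `R`-module `N` is faithfully flat: the functor `- ⊗_R N` on unital right `R`-modules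
is exact and faithful. -/
def NUFaithfullyFlat (N : Type u) [AddCommGroup N] [NUModule R N] : Prop :=
  NUFlat R N ∧ ∀ (X Y : UMod R) (f g : X ⟶ Y), UMod.tensorMap N f = UMod.tensorMap N g → f = g

end UMod

/-! ### Generating sets of small projectives -/

/-- The family `F` of objects is a generating set of small projectives: each `F i` is small, i.e.
`Hom (F i) -` preserves coproducts, and `⨁ i, F i` exists and is a projective generator. -/
def IsGeneratingSetOfSmallProjectives {ι : Type u} {𝒞 : Type w} [Category.{u} 𝒞] [Preadditive 𝒞]
    (F : ι → 𝒞) : Prop :=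
  (∀ i, ∀ J : Type u, Limits.PreservesColimitsOfShape (Discrete J)
      (preadditiveCoyoneda.obj (Opposite.op (F i)))) ∧
    ∃ c : Limits.Cofan F, Nonempty (Limits.IsColimit c) ∧ Projective c.pt ∧ IsSeparator c.pt

/-! ### The comatrix coring of a functor to finitely generated projective modules -/

section Comatrix

variable {A : Type u} [Ring A]

/-- A finite dual basis `e i`, `e* i` of a right `A`-module. -/
structure DualBasis (A : Type u) [Ring A] (M : Type u) [AddCommGroup M] [Module Aᵐᵒᵖ M] where
  /-- the number of elements -/
  n : ℕ
  /-- the generators -/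
  e : Fin n → M
  /-- the coordinate functionals -/
  e' : Fin n → (M →ₗ[Aᵐᵒᵖ] A)
  sum_eq : ∀ p : M, ∑ i, op (e' i p) • e i = p

/-- Finitely generated projective modules have finite dual bases. -/
theorem DualBasis.nonempty (M : Type u) [AddCommGroup M] [Module Aᵐᵒᵖ M]
    [Module.Finite Aᵐᵒᵖ M] [Module.Projective Aᵐᵒᵖ M] : Nonempty (DualBasis A M) := by
  obtain ⟨n, f, g, -, -, hfg⟩ := Module.Finite.exists_comp_eq_id_of_projective Aᵐᵒᵖ M
  refine ⟨⟨n, fun i => f (Pi.single i 1), fun i =>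
    { toFun := fun p => unop (g p i), map_add' := fun p q => by simp,
      map_smul' := fun a p => by simp }, fun p => ?_⟩⟩
  have h : f (g p) = p := LinearMap.congr_fun hfg p
  conv_rhs => rw [← h, pi_eq_sum_univ' (g p)]
  rw [map_sum]
  refine Finset.sum_congr rfl fun i _ => ?_
  rw [← map_smul]
  congr 1

lemma DualBasis.sum_dual {M : Type u} [AddCommGroup M] [Module Aᵐᵒᵖ M] (d : DualBasis A M)
    (φ : M →ₗ[Aᵐᵒᵖ] A) : ∑ i, φ (d.e i) • d.e' i = φ := by
  ext p
  conv_rhs => rw [← d.sum_eq p, map_sum]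
  rw [LinearMap.sum_apply]
  exact Finset.sum_congr rfl fun i _ => by simp

variable {𝒜 : Type u} [SmallCategory 𝒜]

variable (ω : 𝒜 ⥤ ModuleCat.{u} Aᵐᵒᵖ)

/-- The right `A`-module `Σ = ⨁ P, ω P`. -/
def Sig : Type u := ⨁ P : 𝒜, ω.obj P

instance : AddCommGroup (Sig ω) := inferInstanceAs (AddCommGroup (⨁ P : 𝒜, ω.obj P))

instance : Module Aᵐᵒᵖ (Sig ω) := inferInstanceAs (Module Aᵐᵒᵖ (⨁ P : 𝒜, ω.obj P))

/-- The left `A`-module `Σ† = ⨁ P, (ω P)*`, with `(a φ)(p) = a φ(p)`. -/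
def Sdag : Type u := ⨁ P : 𝒜, (ω.obj P →ₗ[Aᵐᵒᵖ] A)

instance : AddCommGroup (Sdag ω) := inferInstanceAs (AddCommGroup (⨁ P : 𝒜, (ω.obj P →ₗ[Aᵐᵒᵖ] A)))

instance : Module A (Sdag ω) := inferInstanceAs (Module A (⨁ P : 𝒜, (ω.obj P →ₗ[Aᵐᵒᵖ] A)))

/-- The inclusion of `ω P` in `Σ`. -/
def Sig.ι (P : 𝒜) : ω.obj P →ₗ[Aᵐᵒᵖ] Sig ω := DirectSum.lof Aᵐᵒᵖ 𝒜 (fun P => ω.obj P) P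

/-- The inclusion of `(ω P)*` in `Σ†`. -/
def Sdag.ι (P : 𝒜) : (ω.obj P →ₗ[Aᵐᵒᵖ] A) →ₗ[A] Sdag ω :=
  DirectSum.lof A 𝒜 (fun P => (ω.obj P →ₗ[Aᵐᵒᵖ] A)) P

variable {ω}

@[elab_as_elim]
lemma Sig.induction {p : Sig ω → Prop} (x : Sig ω) (zero : p 0)
    (ι : ∀ P y, p (Sig.ι ω P y)) (add : ∀ x y, p x → p y → p (x + y)) : p x :=
  DirectSum.induction_on x zero ι add

@[elab_as_elim]
lemma Sdag.induction {p : Sdag ω → Prop} (x : Sdag ω) (zero : p 0)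
    (ι : ∀ P y, p (Sdag.ι ω P y)) (add : ∀ x y, p x → p y → p (x + y)) : p x :=
  DirectSum.induction_on x zero ι add

variable (ω) in
/-- The projection of `Σ` to `ω P`. -/
def Sig.π (P : 𝒜) : Sig ω →ₗ[Aᵐᵒᵖ] ω.obj P := DirectSum.component Aᵐᵒᵖ 𝒜 (fun P => ω.obj P) P

lemma Sig.π_ι (P : 𝒜) (p : ω.obj P) : Sig.π ω P (Sig.ι ω P p) = p :=
  DirectSum.component.lof_self Aᵐᵒᵖ (M := fun P => ω.obj P) P p

lemma Sig.π_ι_ne {P Q : 𝒜} (h : P ≠ Q) (p : ω.obj P) : Sig.π ω Q (Sig.ι ω P p) = 0 :=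
  DirectSum.of_eq_of_ne (β := fun P => ω.obj P) P Q p h.symm

variable (ω) in
/-- The biadditive map `Σ† × Σ → A`, `(φ, x) ↦ ∑ P, φ_P (x_P)`. -/
def evalAux : Sdag ω →+ Sig ω →+ A :=
  DirectSum.toAddMonoid (fun P => AddMonoidHom.mk'
    (fun φ : ω.obj P →ₗ[Aᵐᵒᵖ] A => (φ ∘ₗ Sig.π ω P).toAddMonoidHom) (fun _ _ => rfl))

lemma evalAux_ι (P : 𝒜) (φ : ω.obj P →ₗ[Aᵐᵒᵖ] A) (x : Sig ω) :
    evalAux ω (Sdag.ι ω P φ) x = φ (Sig.π ω P x) :=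
  DFunLike.congr_fun (DirectSum.toAddMonoid_of (β := fun P => (ω.obj P →ₗ[Aᵐᵒᵖ] A)) _ P φ) x

variable [Preadditive 𝒜]

variable (𝒜) in
/-- The ring `R = ⨁ P Q, Hom (P, Q)` of the small category `𝒜`. -/
abbrev CatRing : Type u := MatRing (fun P : 𝒜 => P)

variable [ω.Additive]

variable (ω) in
/-- The additive map `(t, p) ↦ ω(t)(p)`. -/
def sigAct (P Q : 𝒜) : (P ⟶ Q) →+ ω.obj P →+ ω.obj Q :=
  AddMonoidHom.mk' (fun t => (ω.map t).hom.toAddMonoidHom) (fun s t => by ext p; simp)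

variable (ω) in
/-- The additive map `(t, φ) ↦ φ ∘ ω(t)`. -/
def sdagAct (P Q : 𝒜) : (P ⟶ Q) →+ (ω.obj Q →ₗ[Aᵐᵒᵖ] A) →+ (ω.obj P →ₗ[Aᵐᵒᵖ] A) :=
  AddMonoidHom.mk' (fun t => AddMonoidHom.mk' (fun φ => φ ∘ₗ (ω.map t).hom)
    (fun φ ψ => LinearMap.add_comp _ _ _)) (fun s t => by ext φ p; simp)

/-- The left `R`-module `Σ`: an element `t : P ⟶ Q` of `R` sends `p` in `ω P` to `ω(t)(p)`
in `ω Q`, and kills the summands other than `ω P`. -/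
instance : NUModule (CatRing 𝒜) (Sig ω) where
  smul t x := leftAct (F := fun P : 𝒜 => P) (sigAct ω) t x
  smul_add _ := map_add _
  add_smul s t x := DFunLike.congr_fun (leftAct_add (sigAct ω) s t) x
  mul_smul s t x := DFunLike.congr_fun (leftAct_mul (F := fun P : 𝒜 => P) (sigAct ω)
    (fun P Q Q' f g x => by simp [sigAct]) s t) x

/-- The right `R`-module `Σ†`: an element `t : P ⟶ Q` of `R` sends `φ` in `(ω Q)*` to `φ ∘ ω(t)`
in `(ω P)*`, and kills the summands other than `(ω Q)*`. -/
instance : NUModule (CatRing 𝒜)ᵐᵒᵖ (Sdag ω) where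
  smul t x := rightAct (F := fun P : 𝒜 => P) (sdagAct ω) (unop t) x
  smul_add _ := map_add _
  add_smul s t x := DFunLike.congr_fun (rightAct_add (sdagAct ω) (unop s) (unop t)) x
  mul_smul s t x := DFunLike.congr_fun (rightAct_mul (F := fun P : 𝒜 => P) (sdagAct ω)
    (fun P Q Q' f g x => by ext p; simp [sdagAct]) (unop t) (unop s)) x

lemma single_smul_ι {P Q : 𝒜} (t : P ⟶ Q) (p : ω.obj P) :
    (single P Q t : CatRing 𝒜) • Sig.ι ω P p = Sig.ι ω Q ((ω.map t).hom p) :=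
  leftAct_single (F := fun P : 𝒜 => P) (sigAct ω) t p

lemma single_smul_ι_ne {P P' Q : 𝒜} (h : P ≠ P') (t : P ⟶ Q) (p : ω.obj P') :
    (single P Q t : CatRing 𝒜) • Sig.ι ω P' p = 0 :=
  leftAct_single_ne (F := fun P : 𝒜 => P) (sigAct ω) h t p

lemma ι_smul_single {P Q : 𝒜} (t : P ⟶ Q) (φ : ω.obj Q →ₗ[Aᵐᵒᵖ] A) :
    op (single P Q t : CatRing 𝒜) • Sdag.ι ω Q φ = Sdag.ι ω P (φ ∘ₗ (ω.map t).hom) :=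
  rightAct_single (F := fun P : 𝒜 => P) (sdagAct ω) t φ

lemma ι_smul_single_ne {P Q Q' : 𝒜} (h : Q ≠ Q') (t : P ⟶ Q) (φ : ω.obj Q' →ₗ[Aᵐᵒᵖ] A) :
    op (single P Q t : CatRing 𝒜) • Sdag.ι ω Q' φ = 0 :=
  rightAct_single_ne (F := fun P : 𝒜 => P) (sdagAct ω) h t φ

instance : SMulCommClass Aᵐᵒᵖ (CatRing 𝒜) (Sig ω) where
  smul_comm a t x := by
    induction t using MatRing.induction with
    | zero => rw [NUModule.zero_smul', NUModule.zero_smul', smul_zero]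
    | add s t hs ht => rw [NUModule.add_smul, NUModule.add_smul, smul_add, hs, ht]
    | single P Q t =>
      induction x using Sig.induction with
      | zero => rw [NUModule.smul_zero', smul_zero, NUModule.smul_zero']
      | add x y hx hy =>
        rw [NUModule.smul_add, smul_add, smul_add, NUModule.smul_add, hx, hy]
      | ι P' p =>
        rw [← map_smul (Sig.ι ω P') a]
        by_cases h : P = P'
        · subst h
          rw [single_smul_ι, single_smul_ι, ← map_smul, ← map_smul]
        · rw [single_smul_ι_ne h, single_smul_ι_ne h, smul_zero]

instance : SMulCommClass A (CatRing 𝒜)ᵐᵒᵖ (Sdag ω) where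
  smul_comm a t x := by
    induction t using MulOpposite.rec' with | _ t
    induction t using MatRing.induction with
    | zero => rw [MulOpposite.op_zero, NUModule.zero_smul', NUModule.zero_smul', smul_zero]
    | add s t hs ht => rw [MulOpposite.op_add, NUModule.add_smul, NUModule.add_smul, smul_add, hs, ht]
    | single P Q t =>
      induction x using Sdag.induction with
      | zero => rw [NUModule.smul_zero', smul_zero, NUModule.smul_zero']
      | add x y hx hy =>
        rw [NUModule.smul_add, smul_add, smul_add, NUModule.smul_add, hx, hy]
      | ι Q' p =>
        rw [← map_smul (Sdag.ι ω Q') a]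
        by_cases h : Q = Q'
        · subst h
          rw [ι_smul_single, ι_smul_single, ← map_smul]; rfl
        · rw [ι_smul_single_ne h, ι_smul_single_ne h, smul_zero]

variable (ω) in
/-- The `A`-bimodule `Σ† ⊗_R Σ`. -/
abbrev Comatrix : Type u := BTensor (CatRing 𝒜) (Sdag ω) (Sig ω)

variable (ω) in
/-- The element `φ ⊗_R p` of `Σ† ⊗_R Σ`, for `φ` in `(ω P)*` and `p` in `ω P`. -/
def cmk (P : 𝒜) (φ : ω.obj P →ₗ[Aᵐᵒᵖ] A) (p : ω.obj P) : Comatrix ω :=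
  tmul (CatRing 𝒜) (Sdag.ι ω P φ) (Sig.ι ω P p)

lemma cmk_comp {P Q : 𝒜} (t : P ⟶ Q) (φ : ω.obj Q →ₗ[Aᵐᵒᵖ] A) (p : ω.obj P) :
    cmk ω P (φ ∘ₗ (ω.map t).hom) p = cmk ω Q φ ((ω.map t).hom p) := by
  rw [cmk, cmk, ← ι_smul_single, ← single_smul_ι, smul_tmul]

lemma cmk_add (P : 𝒜) (φ : ω.obj P →ₗ[Aᵐᵒᵖ] A) (p q : ω.obj P) :
    cmk ω P φ (p + q) = cmk ω P φ p + cmk ω P φ q := by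
  rw [cmk, map_add, tmul_add]; rfl

lemma smul_cmk (P : 𝒜) (a : A) (φ : ω.obj P →ₗ[Aᵐᵒᵖ] A) (p : ω.obj P) :
    a • cmk ω P φ p = cmk ω P (a • φ) p := by
  rw [cmk, cmk, left_smul_tmul, map_smul]

lemma op_smul_cmk (P : 𝒜) (a : A) (φ : ω.obj P →ₗ[Aᵐᵒᵖ] A) (p : ω.obj P) :
    op a • cmk ω P φ p = cmk ω P φ (op a • p) := by
  rw [cmk, cmk, right_smul_tmul, map_smul]

lemma sum_cmk (P : 𝒜) {κ : Type*} (s : Finset κ) (φ : κ → (ω.obj P →ₗ[Aᵐᵒᵖ] A)) (p : ω.obj P) :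
    cmk ω P (∑ i ∈ s, φ i) p = ∑ i ∈ s, cmk ω P (φ i) p := by
  rw [cmk, map_sum, sum_tmul]; rfl

section Incl

variable {X : Type u} [AddCommGroup X] [NUModule (CatRing 𝒜)ᵐᵒᵖ X]

variable (ω) in
/-- The right `A`-linear map `ω P → X ⊗_R Σ`, `p ↦ x ⊗ p`. -/
def incl (x : X) (P : 𝒜) : ω.obj P →ₗ[Aᵐᵒᵖ] BTensor (CatRing 𝒜) X (Sig ω) where
  toFun p := tmul (CatRing 𝒜) x (Sig.ι ω P p)
  map_add' p q := by rw [map_add, tmul_add]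
  map_smul' a p := by
    rw [map_smul, RingHom.id_apply, ← MulOpposite.op_unop a, right_smul_tmul]

lemma incl_apply (x : X) (P : 𝒜) (p : ω.obj P) :
    incl ω x P p = tmul (CatRing 𝒜) x (Sig.ι ω P p) := rfl

lemma incl_add (x y : X) (P : 𝒜) : incl ω (x + y) P = incl ω x P + incl ω y P := by
  ext p; exact add_tmul _ _ _ _

@[elab_as_elim]
lemma tensor_induction {p : BTensor (CatRing 𝒜) X (Sig ω) → Prop}
    (z : BTensor (CatRing 𝒜) X (Sig ω)) (zero : p 0) (incl : ∀ x P y, p (incl ω x P y))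
    (add : ∀ x y, p x → p y → p (x + y)) : p z := by
  induction z using BTensor.induction with
  | zero => exact zero
  | add x y hx hy => exact add x y hx hy
  | tmul x s =>
    induction s using Sig.induction with
    | zero => rw [tmul_zero]; exact zero
    | add s s' h h' => rw [tmul_add]; exact add _ _ h h'
    | ι P y => exact incl x P y

end Incl

/-! #### The counit and the coring -/

lemma evalAux_balanced (φ : Sdag ω) (t : CatRing 𝒜) (x : Sig ω) :
    evalAux ω (op t • φ) x = evalAux ω φ (t • x) := by
  induction t using MatRing.induction with
  | zero =>
    rw [MulOpposite.op_zero, NUModule.zero_smul', NUModule.zero_smul', map_zero, map_zero]; rfl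
  | add t t' h h' =>
    rw [MulOpposite.op_add, NUModule.add_smul, NUModule.add_smul, map_add, map_add,
      AddMonoidHom.add_apply, h, h']
  | single P Q t =>
    induction φ using Sdag.induction with
    | zero => rw [NUModule.smul_zero', map_zero]; rfl
    | add φ ψ h h' =>
      rw [NUModule.smul_add, map_add, map_add, AddMonoidHom.add_apply, AddMonoidHom.add_apply,
        h, h']
    | ι Q' φ =>
      induction x using Sig.induction with
      | zero => rw [NUModule.smul_zero', map_zero, map_zero]
      | add x y h h' => rw [NUModule.smul_add, map_add, map_add, h, h']
      | ι P' p =>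
        rw [evalAux_ι]
        by_cases hQ : Q = Q'
        · subst hQ
          rw [ι_smul_single, evalAux_ι]
          by_cases hP : P = P'
          · subst hP
            rw [single_smul_ι, Sig.π_ι, Sig.π_ι]; rfl
          · rw [single_smul_ι_ne hP, Sig.π_ι_ne (Ne.symm hP), map_zero, map_zero, map_zero]
        · rw [ι_smul_single_ne hQ, map_zero]
          by_cases hP : P = P'
          · subst hP
            rw [single_smul_ι, Sig.π_ι_ne hQ, map_zero]; rfl
          · rw [single_smul_ι_ne hP, map_zero, map_zero]; rfl

variable (ω) in
/-- The counit `φ ⊗ x ↦ φ(x)` of `Σ† ⊗_R Σ`. -/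
def comatrixCounit : Comatrix ω →+ A := lift (B := CatRing 𝒜) (evalAux ω) evalAux_balanced

lemma comatrixCounit_cmk (P : 𝒜) (φ : ω.obj P →ₗ[Aᵐᵒᵖ] A) (p : ω.obj P) :
    comatrixCounit ω (cmk ω P φ p) = φ p :=
  (evalAux_ι P φ _).trans (by rw [Sig.π_ι])

lemma cmk_ne {P Q : 𝒜} (h : P ≠ Q) (φ : ω.obj P →ₗ[Aᵐᵒᵖ] A) (p : ω.obj Q) :
    tmul (CatRing 𝒜) (Sdag.ι ω P φ) (Sig.ι ω Q p) = 0 := by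
  have e : op (single P P (𝟙 P) : CatRing 𝒜) • Sdag.ι ω P φ = Sdag.ι ω P φ := by
    rw [ι_smul_single, ω.map_id]; rfl
  rw [← e, smul_tmul, single_smul_ι_ne h, tmul_zero]

@[elab_as_elim]
lemma Comatrix.induction {p : Comatrix ω → Prop} (z : Comatrix ω) (zero : p 0)
    (cmk : ∀ P φ y, p (cmk ω P φ y)) (add : ∀ x y, p x → p y → p (x + y)) : p z := by
  induction z using tensor_induction with
  | zero => exact zero
  | add x y hx hy => exact add x y hx hy
  | incl φ P y =>
    rw [incl_apply]
    induction φ using Sdag.induction with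
    | zero => rw [zero_tmul]; exact zero
    | add x y hx hy => rw [add_tmul]; exact add _ _ hx hy
    | ι Q φ =>
      by_cases h : Q = P
      · subst h; exact cmk Q φ y
      · rw [cmk_ne h]; exact zero

lemma comatrixCounit_smul (a : A) (z : Comatrix ω) :
    comatrixCounit ω (a • z) = a • comatrixCounit ω z := by
  induction z using Comatrix.induction with
  | zero => rw [smul_zero, map_zero, smul_zero]
  | add x y hx hy => rw [smul_add, map_add, map_add, smul_add, hx, hy]
  | cmk P φ p => rw [smul_cmk, comatrixCounit_cmk, comatrixCounit_cmk]; rfl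

lemma comatrixCounit_op_smul (a : A) (z : Comatrix ω) :
    comatrixCounit ω (op a • z) = op a • comatrixCounit ω z := by
  induction z using Comatrix.induction with
  | zero => rw [smul_zero, map_zero, smul_zero]
  | add x y hx hy => rw [smul_add, map_add, map_add, smul_add, hx, hy]
  | cmk P φ p => rw [op_smul_cmk, comatrixCounit_cmk, comatrixCounit_cmk, map_smul]

variable [∀ P, Module.Finite Aᵐᵒᵖ (ω.obj P)] [∀ P, Module.Projective Aᵐᵒᵖ (ω.obj P)]

variable (ω) in
/-- A chosen finite dual basis of `ω P`; the coactions below do not depend on the choice. -/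
def dualBasis (P : 𝒜) : DualBasis A (ω.obj P) := Classical.choice (DualBasis.nonempty _)

variable (ω) in
/-- The right `Σ† ⊗_R Σ`-coaction `p ↦ ∑ i, e i ⊗_A (e* i ⊗_R p)` on `ω P`. -/
def coactObj (P : 𝒜) : ω.obj P →ₗ[Aᵐᵒᵖ] BTensor A (ω.obj P) (Comatrix ω) where
  toFun p := ∑ i, tmul A ((dualBasis ω P).e i) (cmk ω P ((dualBasis ω P).e' i) p)
  map_add' p q := by simp only [cmk_add, tmul_add, Finset.sum_add_distrib]
  map_smul' a p := by
    rw [RingHom.id_apply, Finset.smul_sum]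
    refine Finset.sum_congr rfl fun i _ => ?_
    rw [← MulOpposite.op_unop a, right_smul_tmul, op_smul_cmk]

lemma coactObj_apply (P : 𝒜) (p : ω.obj P) : coactObj ω P p =
    ∑ i, tmul A ((dualBasis ω P).e i) (cmk ω P ((dualBasis ω P).e' i) p) := rfl

lemma coactObj_natural {P Q : 𝒜} (t : P ⟶ Q) (p : ω.obj P) :
    mapC (Comatrix ω) (ω.map t).hom (coactObj ω P p) = coactObj ω Q ((ω.map t).hom p) := by
  rw [coactObj_apply, coactObj_apply, map_sum]
  simp only [mapC_tmul, ← cmk_comp]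
  have h : ∀ j, cmk ω P ((dualBasis ω Q).e' j ∘ₗ (ω.map t).hom) p =
      ∑ i, (dualBasis ω Q).e' j ((ω.map t).hom ((dualBasis ω P).e i)) •
        cmk ω P ((dualBasis ω P).e' i) p := fun j => by
    conv_lhs => rw [← (dualBasis ω P).sum_dual ((dualBasis ω Q).e' j ∘ₗ (ω.map t).hom)]
    rw [sum_cmk]
    exact Finset.sum_congr rfl fun i _ => (smul_cmk _ _ _ _).symm
  simp only [h, tmul_sum, ← smul_tmul]
  rw [Finset.sum_comm]
  refine Finset.sum_congr rfl fun i _ => ?_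
  rw [← sum_tmul, (dualBasis ω Q).sum_eq]

section Tensor

variable (X : Type u) [AddCommGroup X] [NUModule (CatRing 𝒜)ᵐᵒᵖ X]

variable (ω) {X} in
/-- The map `s ↦ ((p ↦ x ⊗ p) ⊗_A (Σ† ⊗_R Σ)) (ρ s)`, where `ρ` is the coaction of `Σ`. -/
def coactTensorAux (x : X) :
    Sig ω →+ BTensor A (BTensor (CatRing 𝒜) X (Sig ω)) (Comatrix ω) :=
  DirectSum.toAddMonoid (fun P => (mapC (Comatrix ω) (incl ω x P)).comp
    (coactObj ω P).toAddMonoidHom)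

variable {X} in
lemma coactTensorAux_ι (x : X) (P : 𝒜) (p : ω.obj P) :
    coactTensorAux ω x (Sig.ι ω P p) = mapC (Comatrix ω) (incl ω x P) (coactObj ω P p) :=
  DirectSum.toAddMonoid_of _ _ _

variable {X} in
lemma coactTensorAux_add (x y : X) :
    coactTensorAux ω (x + y) = coactTensorAux ω x + coactTensorAux ω y := by
  refine DirectSum.addHom_ext fun P p => ?_
  change coactTensorAux ω (x + y) (Sig.ι ω P p) = coactTensorAux ω x (Sig.ι ω P p) +
    coactTensorAux ω y (Sig.ι ω P p)
  rw [coactTensorAux_ι, coactTensorAux_ι, coactTensorAux_ι, incl_add, mapC_add]; rfl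

variable {X} in
lemma coactTensorAux_balanced (x : X) (t : CatRing 𝒜) (s : Sig ω) :
    coactTensorAux ω (op t • x) s = coactTensorAux ω x (t • s) := by
  induction s using Sig.induction with
  | zero => rw [NUModule.smul_zero', map_zero, map_zero]
  | add s s' h h' => rw [map_add, NUModule.smul_add, map_add, h, h']
  | ι P' p =>
    have key : coactTensorAux ω (0 : X) = 0 := by
      have h := coactTensorAux_add (ω := ω) (0 : X) 0
      rwa [add_zero, left_eq_add] at h
    induction t using MatRing.induction with
    | zero =>
      rw [MulOpposite.op_zero, NUModule.zero_smul', NUModule.zero_smul', map_zero, key]; rfl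
    | add t t' h h' =>
      rw [MulOpposite.op_add, NUModule.add_smul, NUModule.add_smul, map_add, coactTensorAux_add,
        AddMonoidHom.add_apply, h, h']
    | single P Q t =>
      rw [coactTensorAux_ι]
      by_cases h : P = P'
      · subst h
        have e : incl ω (op (single P Q t : CatRing 𝒜) • x) P =
            incl ω x Q ∘ₗ (ω.map t).hom := by
          ext p
          rw [incl_apply, smul_tmul, single_smul_ι]; rfl
        rw [single_smul_ι, coactTensorAux_ι, ← coactObj_natural, e, mapC_comp]; rfl
      · have e : incl ω (op (single P Q t : CatRing 𝒜) • x) P' = 0 := by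
          ext p
          rw [incl_apply, smul_tmul, single_smul_ι_ne h, tmul_zero]; rfl
        rw [single_smul_ι_ne h, map_zero, e, coactObj_apply, map_sum]
        refine Finset.sum_eq_zero fun i _ => ?_
        rw [mapC_tmul, LinearMap.zero_apply, zero_tmul]

variable (ω) in
/-- The right `Σ† ⊗_R Σ`-coaction on `X ⊗_R Σ`:
`x ⊗ p ↦ ∑ i, (x ⊗ e i) ⊗_A (e* i ⊗_R p)` for `p` in `ω P`. -/
def coactTensor : BTensor (CatRing 𝒜) X (Sig ω) →+
    BTensor A (BTensor (CatRing 𝒜) X (Sig ω)) (Comatrix ω) :=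
  lift (B := CatRing 𝒜) (AddMonoidHom.mk' (coactTensorAux ω) coactTensorAux_add)
    coactTensorAux_balanced

variable {X}

lemma coactTensor_incl (x : X) (P : 𝒜) (p : ω.obj P) :
    coactTensor ω X (incl ω x P p) = mapC (Comatrix ω) (incl ω x P) (coactObj ω P p) :=
  coactTensorAux_ι x P p

lemma coactTensor_incl' (x : X) (P : 𝒜) (p : ω.obj P) :
    coactTensor ω X (incl ω x P p) = ∑ i, tmul A (incl ω x P ((dualBasis ω P).e i))
      (cmk ω P ((dualBasis ω P).e' i) p) := by
  rw [coactTensor_incl, coactObj_apply, map_sum]; rfl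

lemma coactTensor_op_smul (a : A) (z : BTensor (CatRing 𝒜) X (Sig ω)) :
    coactTensor ω X (op a • z) = op a • coactTensor ω X z := by
  induction z using tensor_induction with
  | zero => rw [smul_zero, map_zero, smul_zero]
  | add x y hx hy => rw [smul_add, map_add, map_add, smul_add, hx, hy]
  | incl x P p =>
    rw [← map_smul, coactTensor_incl, coactTensor_incl, map_smul, mapC_op_smul]

end Tensor

variable (ω) in
/-- The comultiplication of `Σ† ⊗_R Σ`: `φ ⊗ p ↦ ∑ i, (φ ⊗ e i) ⊗_A (e* i ⊗ p)` for
`p` in `ω P`. -/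
def comatrixComul : Comatrix ω →+ BTensor A (Comatrix ω) (Comatrix ω) := coactTensor ω (Sdag ω)

lemma comatrixComul_smul (a : A) (z : Comatrix ω) :
    comatrixComul ω (a • z) = a • comatrixComul ω z := by
  induction z using tensor_induction with
  | zero => rw [smul_zero, map_zero, smul_zero]
  | add x y hx hy => rw [smul_add, map_add, map_add, smul_add, hx, hy]
  | incl x P p =>
    have h : ∀ q, a • incl ω x P q = incl ω (a • x) P q := fun q => left_smul_tmul _ _ _
    rw [h, comatrixComul, coactTensor_incl', coactTensor_incl', Finset.smul_sum]
    exact Finset.sum_congr rfl fun i _ => by rw [left_smul_tmul, h]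

lemma comatrixComul_cmk (P : 𝒜) (φ : ω.obj P →ₗ[Aᵐᵒᵖ] A) (p : ω.obj P) :
    comatrixComul ω (cmk ω P φ p) = ∑ i, tmul A (cmk ω P φ ((dualBasis ω P).e i))
      (cmk ω P ((dualBasis ω P).e' i) p) :=
  coactTensor_incl' (Sdag.ι ω P φ) P p

lemma coactObj_coassoc (P : 𝒜) (p : ω.obj P) :
    assoc A (ω.obj P) (Comatrix ω) (Comatrix ω)
      (mapC (M := ω.obj P) (Comatrix ω) (coactObj ω P) (coactObj ω P p)) =
      lmap (ω.obj P) (comatrixComul ω) comatrixComul_smul (coactObj ω P p) := by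
  rw [coactObj_apply, map_sum, map_sum, map_sum]
  simp only [mapC_tmul, lmap_tmul, comatrixComul_cmk, coactObj_apply, sum_tmul, map_sum, tmul_sum,
    assoc_tmul]
  exact Finset.sum_comm

lemma coactTensor_coassoc (X : Type u) [AddCommGroup X] [NUModule (CatRing 𝒜)ᵐᵒᵖ X]
    (z : BTensor (CatRing 𝒜) X (Sig ω)) :
    assoc A (BTensor (CatRing 𝒜) X (Sig ω)) (Comatrix ω) (Comatrix ω)
      (rmap (Comatrix ω) (coactTensor ω X) coactTensor_op_smul (coactTensor ω X z)) =
      lmap (BTensor (CatRing 𝒜) X (Sig ω)) (comatrixComul ω) comatrixComul_smul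
        (coactTensor ω X z) := by
  induction z using tensor_induction with
  | zero => simp only [map_zero]
  | add x y hx hy => simp only [map_add, hx, hy]
  | incl x P p =>
    rw [coactTensor_incl', map_sum, map_sum, map_sum]
    simp only [rmap_tmul, lmap_tmul, comatrixComul_cmk, coactTensor_incl', sum_tmul, map_sum,
      tmul_sum, assoc_tmul]
    exact Finset.sum_comm

lemma coactTensor_counit (X : Type u) [AddCommGroup X] [NUModule (CatRing 𝒜)ᵐᵒᵖ X]
    (z : BTensor (CatRing 𝒜) X (Sig ω)) :
    runit A (BTensor (CatRing 𝒜) X (Sig ω)) (lmap (BTensor (CatRing 𝒜) X (Sig ω))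
      (comatrixCounit ω) comatrixCounit_smul (coactTensor ω X z)) = z := by
  induction z using tensor_induction with
  | zero => simp only [map_zero]
  | add x y hx hy => simp only [map_add, hx, hy]
  | incl x P p =>
    rw [coactTensor_incl', map_sum, map_sum]
    simp only [lmap_tmul, comatrixCounit_cmk, runit_tmul, ← map_smul]
    rw [← map_sum, (dualBasis ω P).sum_eq]

lemma comatrix_counit_left (z : Comatrix ω) :
    lunit A (Comatrix ω) (rmap (Comatrix ω) (comatrixCounit ω) comatrixCounit_op_smul
      (comatrixComul ω z)) = z := by
  induction z using Comatrix.induction with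
  | zero => simp only [map_zero]
  | add x y hx hy => simp only [map_add, hx, hy]
  | cmk P φ p =>
    rw [comatrixComul_cmk, map_sum, map_sum]
    simp only [rmap_tmul, comatrixCounit_cmk, lunit_tmul, smul_cmk]
    rw [← sum_cmk, (dualBasis ω P).sum_dual]

variable (ω) in
/-- The `A`-coring `Σ† ⊗_R Σ`. -/
def comatrixCoring : Coring A (Comatrix ω) where
  comul := comatrixComul ω
  comul_smul := comatrixComul_smul
  comul_op_smul := coactTensor_op_smul
  counit := comatrixCounit ω
  counit_smul := comatrixCounit_smul
  counit_op_smul := comatrixCounit_op_smul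
  coassoc := coactTensor_coassoc (Sdag ω)
  counit_left := comatrix_counit_left
  counit_right := coactTensor_counit (Sdag ω)

/-! #### The functors to comodules, and the rings `R̄` and `S` -/

variable (ω) in
/-- The right `Σ† ⊗_R Σ`-comodule `ω P`. -/
def comodObj (P : 𝒜) : Comod (comatrixCoring ω) where
  carrier := ω.obj P
  coact := coactObj ω P
  coassoc := coactObj_coassoc P
  counit p := by
    change runit A (ω.obj P) (lmap (ω.obj P) (comatrixCounit ω) comatrixCounit_smul
      (coactObj ω P p)) = p
    rw [coactObj_apply, map_sum, map_sum]
    simp only [lmap_tmul, comatrixCounit_cmk, runit_tmul]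
    exact (dualBasis ω P).sum_eq p

variable (ω) in
/-- The lift of `ω` to a functor from `𝒜` to right `Σ† ⊗_R Σ`-comodules. -/
def comodFunctor : 𝒜 ⥤ Comod (comatrixCoring ω) where
  obj P := comodObj ω P
  map {P Q} t := (⟨(ω.map t).hom, fun p => coactObj_natural t p⟩ :
    Comod.homs (comodObj ω P) (comodObj ω Q))
  map_id P := Subtype.ext (congrArg ModuleCat.Hom.hom (ω.map_id P))
  map_comp s t := Subtype.ext (congrArg ModuleCat.Hom.hom (ω.map_comp s t))

instance : (comodFunctor ω).Additive where
  map_add {P Q s t} := Subtype.ext (by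
    change (ω.map (s + t)).hom = (ω.map s).hom + (ω.map t).hom
    rw [ω.map_add]; rfl)

variable (ω) in
/-- The ring `R̄ = ⨁ P Q, Hom (P, Q)`, with homomorphisms of right `Σ† ⊗_R Σ`-comodules. -/
abbrev ComodRing : Type u := MatRing (fun P : 𝒜 => (comodFunctor ω).obj P)

variable (ω) in
/-- The ring homomorphism `λ : R → R̄` induced by `ω`. -/
def lam : CatRing 𝒜 →ₙ+* ComodRing ω := MatRing.map (fun P : 𝒜 => P) (comodFunctor ω)

variable (ω) in
/-- The right comodule `X ⊗_R Σ`, for a unital right `R`-module `X`. -/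
def tensorObj (X : UMod (CatRing 𝒜)) : Comod (comatrixCoring ω) where
  carrier := BTensor (CatRing 𝒜) X.carrier (Sig ω)
  coact := { coactTensor ω X.carrier with map_smul' := fun a z => coactTensor_op_smul (unop a) z }
  coassoc := coactTensor_coassoc X.carrier
  counit := coactTensor_counit X.carrier

/-- For a morphism `f` of unital right `R`-modules, `f ⊗_R Σ` is right `A`-linear. -/
def tensorLin {X Y : UMod (CatRing 𝒜)} (f : X ⟶ Y) :
    BTensor (CatRing 𝒜) X.carrier (Sig ω) →ₗ[Aᵐᵒᵖ] BTensor (CatRing 𝒜) Y.carrier (Sig ω) :=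
  { UMod.tensorMap (Sig ω) f with
    map_smul' := fun a z => by
      change UMod.tensorMap (Sig ω) f (a • z) = a • UMod.tensorMap (Sig ω) f z
      induction z using BTensor.induction with
      | zero => rw [smul_zero, map_zero, smul_zero]
      | tmul x s => rfl
      | add x y hx hy => rw [smul_add, map_add, map_add, smul_add, hx, hy] }

lemma tensorLin_colinear {X Y : UMod (CatRing 𝒜)} (f : X ⟶ Y)
    (z : BTensor (CatRing 𝒜) X.carrier (Sig ω)) :
    mapC (Comatrix ω) (tensorLin f) (coactTensor ω X.carrier z) =
      coactTensor ω Y.carrier (tensorLin f z) := by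
  induction z using tensor_induction with
  | zero => simp only [map_zero]
  | add x y hx hy => simp only [map_add, hx, hy]
  | incl x P p =>
    have h : ∀ q, tensorLin f (incl ω x P q) = incl ω (UMod.Hom.hom f x) P q := fun q => rfl
    rw [h, coactTensor_incl', coactTensor_incl', map_sum]
    exact Finset.sum_congr rfl fun i _ => by rw [mapC_tmul, h]

variable (ω) in
/-- The functor `- ⊗_R Σ` from unital right `R`-modules to right `Σ† ⊗_R Σ`-comodules. -/
def tensorFunctor : UMod (CatRing 𝒜) ⥤ Comod (comatrixCoring ω) where
  obj X := tensorObj ω X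
  map {X Y} f := (⟨tensorLin f, tensorLin_colinear f⟩ :
    Comod.homs (tensorObj ω X) (tensorObj ω Y))
  map_id _ := Subtype.ext (LinearMap.toAddMonoidHom_injective (hom_ext fun _ _ => rfl))
  map_comp _ _ := Subtype.ext (LinearMap.toAddMonoidHom_injective (hom_ext fun _ _ => rfl))
end Comatrix

section LinRing

variable {A : Type u} [Ring A] {𝒜 : Type u} [SmallCategory 𝒜] [Preadditive 𝒜]
variable (ω : 𝒜 ⥤ ModuleCat.{u} Aᵐᵒᵖ) [ω.Additive]

/-- The ring `S = ⨁ P Q, Hom (ω P, ω Q)`, with right `A`-linear maps. -/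
def LinRing {A : Type u} [Ring A] {𝒜 : Type u} [SmallCategory 𝒜]
    (ω : 𝒜 ⥤ ModuleCat.{u} Aᵐᵒᵖ) : Type u := MatRing (fun P : 𝒜 => ω.obj P)

instance : NonUnitalRing (LinRing ω) :=
  inferInstanceAs (NonUnitalRing (MatRing (fun P : 𝒜 => ω.obj P)))

/-- The ring homomorphism `R → S` induced by `ω`. -/
def toLinRing : CatRing 𝒜 →ₙ+* LinRing ω := MatRing.map (fun P : 𝒜 => P) ω

/-- `S` as a left `R`-module through `R → S`. -/
instance : NUModule (CatRing 𝒜) (LinRing ω) where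
  smul r s := toLinRing ω r * s
  smul_add r s t := mul_add (toLinRing ω r) s t
  add_smul r r' s := (congrArg (· * s) (map_add (toLinRing ω) r r')).trans (add_mul _ _ s)
  mul_smul r r' s := (congrArg (· * s) (map_mul (toLinRing ω) r r')).trans (mul_assoc _ _ s)

end LinRing

end

end InfComatrix

/-! Write C for the coring Σ† ⊗_R Σ and, for a right A-module M, H(M) = ⨁ Hom_A(P, M), a unital
right R-module. Everything rests on the natural isomorphism H(M) ⊗_R Σ ≅ M ⊗_A C given by dual bases
(`homTensor`, `homTensorInv`). Since H preserves injections, flatness of Σ over R forces flatness of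
C over A (`isFlat_comatrix`).

From 3 to 2 is descent. For a comodule M, the module H_C(M) = ⨁ Hom_C(P, M) is the kernel of H(M) →
H(M ⊗ C), h ↦ ρ_M h - (h ⊗ C) ρ_P. Tensored with Σ, this map becomes ρ_M ⊗ C - M ⊗ Δ on M ⊗ C, which
vanishes on the image of ρ_M by coassociativity, while the inclusion of H_C(M) in H(M) becomes
evaluation followed by ρ_M. So evaluation H_C(M) ⊗_R Σ → M is bijective when Σ is flat
(`counitHom_injective`, `counitHom_surjective`). Faithfulness then shows that morphisms P → X ⊗_R Σ
are given by elements of X (`unitInjective_of_faithfullyFlat`, `unitSurjective_of_faithfullyFlat`),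
and the functor is an equivalence. Back from 2 to 3: over a flat coring, monomorphisms of comodules
are injective, so the equivalence yields exactness.

From 1 to 3, X ⊗_R Σ is presented as the cokernel of a map between direct sums of comodules P. As
each P is finitely generated and λ is surjective, comodule maps from Q to such a sum are finite
families of morphisms of 𝒜; projectivity lifts maps along the presentation, which again identifies
morphisms P → X ⊗_R Σ with elements of X (`unitInjective_of_projective`,
`unitSurjective_of_projective`). Generation then gives flatness. From 3 to 1, projectivity and
generation are transported from Mod-R, smallness comes from finite generation, and λ is bijective by
the case X = R.

For S: a linear map f from P is ∑ f(e_i) e_i*, so the identity of S is locally a finite sum of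
R-linear maps S → Σ → S. Hence flatness passes from Σ to S, and faithfulness passes both ways. If C
is flat, flatness of S passes back (`nuFlat_sig_of_linRing`): the kernel K of X ⊗ Σ → Y ⊗ Σ is
annihilated by all φ(p), so K ⊗_A C = 0, while the injective coaction sends K into the image of K
⊗_A C. -/

namespace InfComatrix

open scoped DirectSum TensorProduct Classical

noncomputable section

/-! ### Exactness of tensor products -/

section RightExact

variable {B : Type*} {M N M' : Type*} [AddCommGroup M] [AddCommGroup N] [AddCommGroup M']
  [SMul Bᵐᵒᵖ M] [SMul B N]

/-- The subgroup of `M ⊗_B N` generated by the elements `k ⊗ n` with `f k = 0`. -/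
def kerTensor (B N : Type*) [AddCommGroup N] [SMul Bᵐᵒᵖ M] [SMul B N] (f : M →+ M') :
    AddSubgroup (BTensor B M N) :=
  AddSubgroup.closure {z | ∃ k n, f k = 0 ∧ z = tmul B k n}

lemma tmul_sub_tmul_mem_kerTensor (f : M →+ M') {m m' : M} (h : f m = f m') (n : N) :
    tmul B m n - tmul B m' n ∈ kerTensor B N f := by
  refine AddSubgroup.subset_closure ⟨m - m', n, by rw [map_sub, h, sub_self], ?_⟩
  rw [← mk_apply, ← mk_apply, ← mk_apply, map_sub]; rfl

/-- Right exactness of `- ⊗_B N`. -/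
theorem mem_kerTensor_of_surjective [SMul Bᵐᵒᵖ M'] (f : M →+ M')
    (hf : ∀ (b : B) m, f (op b • m) = op b • f m) (hs : Function.Surjective f)
    {z : BTensor B M N} (hz : rmap N f hf z = 0) :
    z ∈ kerTensor B N f := by
  let L := kerTensor B N f
  have key : ∀ (m m' : M), f m = f m' → ∀ n : N,
      (QuotientAddGroup.mk (tmul B m n) : BTensor B M N ⧸ L) = QuotientAddGroup.mk (tmul B m' n) :=
    fun m m' h n => (QuotientAddGroup.eq_iff_sub_mem).2 (tmul_sub_tmul_mem_kerTensor f h n)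
  let s := Function.surjInv hs
  have hs' : ∀ y, f (s y) = y := Function.surjInv_eq hs
  let g : BTensor B M' N →+ BTensor B M N ⧸ L := lift
    (AddMonoidHom.mk' (fun y => (QuotientAddGroup.mk' L).comp (mk B (s y))) (fun y y' => by
      ext n
      change (QuotientAddGroup.mk (tmul B (s (y + y')) n) : BTensor B M N ⧸ L) =
        QuotientAddGroup.mk (tmul B (s y) n) + QuotientAddGroup.mk (tmul B (s y') n)
      rw [key _ (s y + s y') (by simp only [map_add, hs']), add_tmul]; rfl))
    (fun y b n => by
      change (QuotientAddGroup.mk (tmul B (s (op b • y)) n) : BTensor B M N ⧸ L) =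
        QuotientAddGroup.mk (tmul B (s y) (b • n))
      rw [← smul_tmul]
      exact key _ _ (by rw [hf, hs', hs']) n)
  have hg : g.comp (rmap N f hf) = QuotientAddGroup.mk' L := hom_ext fun m n =>
    key _ _ (by rw [hs']) n
  refine (QuotientAddGroup.eq_zero_iff z).1 ?_
  have := DFunLike.congr_fun hg z
  rw [AddMonoidHom.comp_apply, hz, map_zero] at this
  exact this.symm

end RightExact

/-! ### Associativity of the tensor product over `A` -/

section Assoc

variable (A : Type u) [Ring A]
variable (M C L : Type*) [AddCommGroup M] [AddCommGroup C] [AddCommGroup L]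
    [Module Aᵐᵒᵖ M] [Module A C] [Module Aᵐᵒᵖ C] [SMulCommClass A Aᵐᵒᵖ C]
    [SMulCommClass Aᵐᵒᵖ A C] [Module A L]

/-- The inverse of `assoc`. -/
def assocInv : BTensor A M (BTensor A C L) →+ BTensor A (BTensor A M C) L :=
  lift (AddMonoidHom.mk' (fun m => rmap L (mk A m) (fun _ _ => rfl))
    (fun m m' => hom_ext fun c l => (congrArg (fun z => tmul A z l) (add_tmul A m m' c)).trans
      (add_tmul A _ _ l)))
    (fun m b z => by
      change rmap L (mk A (op b • m)) (fun _ _ => rfl) z =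
        rmap L (mk A m) (fun _ _ => rfl) (b • z)
      induction z using BTensor.induction with
      | zero => rw [smul_zero, map_zero, map_zero]
      | tmul c l =>
        change tmul A (tmul A (op b • m) c) l = tmul A (tmul A m (b • c)) l
        rw [smul_tmul]
      | add x y hx hy => rw [smul_add, map_add, map_add, hx, hy])

lemma assocInv_assoc (z : BTensor A (BTensor A M C) L) :
    assocInv A M C L (assoc A M C L z) = z := by
  induction z using BTensor.induction with
  | zero => rw [map_zero, map_zero]
  | tmul z l =>
    induction z using BTensor.induction with
    | zero => rw [zero_tmul, map_zero, map_zero]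
    | tmul m c => rfl
    | add x y hx hy => rw [add_tmul, map_add, map_add, hx, hy]
  | add x y hx hy => rw [map_add, map_add, hx, hy]

lemma assoc_assocInv (z : BTensor A M (BTensor A C L)) :
    assoc A M C L (assocInv A M C L z) = z := by
  induction z using BTensor.induction with
  | zero => rw [map_zero, map_zero]
  | tmul m z =>
    induction z using BTensor.induction with
    | zero => rw [tmul_zero, map_zero, map_zero]
    | tmul c l => rfl
    | add x y hx hy => rw [tmul_add, map_add, map_add, hx, hy]
  | add x y hx hy => rw [map_add, map_add, hx, hy]

lemma assoc_injective : Function.Injective (assoc A M C L) :=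
  Function.LeftInverse.injective (assocInv_assoc A M C L)

end Assoc

/-! ### Comodules over a coring: functoriality, kernels and direct sums -/

section Coring

variable {A : Type u} [Ring A]
variable {C : Type u} [AddCommGroup C] [Module A C]

/-- Over a flat left module `C`, the kernel of `f ⊗_A C` is generated by the elements `k ⊗ c`
with `f k = 0`. -/
theorem IsFlat.mem_kerTensor (hC : IsFlat A C) {M N : Type u} [AddCommGroup M] [AddCommGroup N]
    [Module Aᵐᵒᵖ M] [Module Aᵐᵒᵖ N] (f : M →ₗ[Aᵐᵒᵖ] N) {z : BTensor A M C}
    (hz : mapC C f z = 0) : z ∈ kerTensor A C f.toAddMonoidHom := by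
  -- Factor `f` through its range: flatness cancels the inclusion of the range, and right exactness
  -- treats the surjection onto it.
  have h : (LinearMap.range f).subtype ∘ₗ f.rangeRestrict = f := by ext; rfl
  have h0 : mapC C f.rangeRestrict z = 0 := by
    refine hC _ _ (LinearMap.range f).subtype Subtype.val_injective ?_
    rw [map_zero, ← hz]
    conv_rhs => rw [← h, mapC_comp]
    rfl
  have h1 := mem_kerTensor_of_surjective (B := A) f.rangeRestrict.toAddMonoidHom
    (fun b x => f.rangeRestrict.map_smul (op b) x) f.surjective_rangeRestrict h0
  refine AddSubgroup.closure_mono ?_ h1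
  rintro _ ⟨k, n, hk, rfl⟩
  exact ⟨k, n, congrArg Subtype.val hk, rfl⟩

lemma mapC_zero {M N : Type*} [AddCommGroup M] [AddCommGroup N] [Module Aᵐᵒᵖ M] [Module Aᵐᵒᵖ N] :
    mapC C (0 : M →ₗ[Aᵐᵒᵖ] N) = 0 :=
  InfComatrix.hom_ext fun m c => by rw [mapC_tmul, LinearMap.zero_apply, zero_tmul]; rfl

lemma mapC_sub {M N : Type*} [AddCommGroup M] [AddCommGroup N] [Module Aᵐᵒᵖ M] [Module Aᵐᵒᵖ N]
    (f g : M →ₗ[Aᵐᵒᵖ] N) : mapC C (f - g) = mapC C f - mapC C g := by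
  rw [eq_sub_iff_add_eq, ← mapC_add, sub_add_cancel]

lemma mapC_mapC {L M N : Type*} [AddCommGroup L] [AddCommGroup M] [AddCommGroup N]
    [Module Aᵐᵒᵖ L] [Module Aᵐᵒᵖ M] [Module Aᵐᵒᵖ N] (g : M →ₗ[Aᵐᵒᵖ] N) (f : L →ₗ[Aᵐᵒᵖ] M)
    (z : BTensor A L C) : mapC C g (mapC C f z) = mapC C (g ∘ₗ f) z := by
  rw [mapC_comp]; rfl

lemma lmap_mapC {C' : Type u} [AddCommGroup C'] [Module A C'] {M N : Type*} [AddCommGroup M]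
    [AddCommGroup N] [Module Aᵐᵒᵖ M] [Module Aᵐᵒᵖ N] (f : M →ₗ[Aᵐᵒᵖ] N) (g : C →+ C')
    (hg : ∀ (a : A) c, g (a • c) = a • g c) (z : BTensor A M C) :
    lmap N g hg (mapC C f z) = mapC C' f (lmap M g hg z) := by
  induction z using BTensor.induction with
  | zero => simp only [map_zero]
  | tmul m c => rfl
  | add x y hx hy => simp only [map_add, hx, hy]

variable [Module Aᵐᵒᵖ C] [SMulCommClass Aᵐᵒᵖ A C]

variable (C) in
/-- The map `f ⊗_A C` as a right `A`-linear map. -/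
def mapCLin {M N : Type*} [AddCommGroup M] [AddCommGroup N] [Module Aᵐᵒᵖ M] [Module Aᵐᵒᵖ N]
    (f : M →ₗ[Aᵐᵒᵖ] N) : BTensor A M C →ₗ[Aᵐᵒᵖ] BTensor A N C :=
  { mapC C f with map_smul' := fun a z => mapC_op_smul f (unop a) z }

@[simp] lemma mapCLin_apply {M N : Type*} [AddCommGroup M] [AddCommGroup N] [Module Aᵐᵒᵖ M]
    [Module Aᵐᵒᵖ N] (f : M →ₗ[Aᵐᵒᵖ] N) (z : BTensor A M C) : mapCLin C f z = mapC C f z := rfl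

variable [SMulCommClass A Aᵐᵒᵖ C]

lemma assoc_mapC {L : Type u} {M N : Type*} [AddCommGroup L] [AddCommGroup M] [AddCommGroup N]
    [Module A L] [Module Aᵐᵒᵖ M] [Module Aᵐᵒᵖ N] (f : M →ₗ[Aᵐᵒᵖ] N)
    (z : BTensor A (BTensor A M C) L) :
    assoc A N C L (mapC L (mapCLin C f) z) = mapC (BTensor A C L) f (assoc A M C L z) := by
  induction z using BTensor.induction with
  | zero =>
    rw [map_zero, map_zero]
    exact ((congrArg _ (map_zero (assoc A M C L))).trans (map_zero _)).symm
  | tmul z l =>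
    induction z using BTensor.induction with
    | zero => rw [zero_tmul, map_zero, map_zero, map_zero, map_zero]
    | tmul m c => rfl
    | add x y hx hy => simp only [add_tmul, map_add, hx, hy]
  | add x y hx hy => simp only [map_add, hx, hy]

lemma runit_mapC {M N : Type*} [AddCommGroup M] [AddCommGroup N] [Module Aᵐᵒᵖ M] [Module Aᵐᵒᵖ N]
    (f : M →ₗ[Aᵐᵒᵖ] N) (z : BTensor A M A) : runit A N (mapC A f z) = f (runit A M z) := by
  induction z using BTensor.induction with
  | zero => simp only [map_zero]
  | tmul m c => simp
  | add x y hx hy => simp only [map_add, hx, hy]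

/-- The map `σ ∘ h - (h ⊗ C) ∘ ρ` measures how far `h` is from being colinear. Coassociativity of
`ρ` at `z` turns its second term into a comultiplication, so the result depends only on `(h ⊗ C) z`
and is the differential `σ ⊗ C - N ⊗ Δ` applied to it. -/
lemma assoc_mapC_defect {M N : Type*} [AddCommGroup M] [AddCommGroup N] [Module Aᵐᵒᵖ M]
    [Module Aᵐᵒᵖ N] (h : M →ₗ[Aᵐᵒᵖ] N) (ρ : M →ₗ[Aᵐᵒᵖ] BTensor A M C)
    (σ : N →ₗ[Aᵐᵒᵖ] BTensor A N C) (Δ : C →+ BTensor A C C)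
    (hΔ : ∀ (a : A) c, Δ (a • c) = a • Δ c) (z : BTensor A M C)
    (hz : assoc A M C C (mapC C ρ z) = lmap M Δ hΔ z) :
    assoc A N C C (mapC C (σ ∘ₗ h - mapCLin C h ∘ₗ ρ) z) =
      assoc A N C C (mapC C σ (mapC C h z)) - lmap N Δ hΔ (mapC C h z) := by
  rw [mapC_sub, AddMonoidHom.sub_apply, map_sub, mapC_mapC, ← mapC_mapC (mapCLin C h), assoc_mapC,
    hz, lmap_mapC]

/-- Through `assoc`, tensoring with `C ⊗ C` is tensoring with `C` twice, and each time injectivity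
survives. This lets coassociativity be checked after embedding into a larger comodule. -/
lemma mapC_injective_assoc (hC : IsFlat A C) {M N : Type u} [AddCommGroup M] [AddCommGroup N]
    [Module Aᵐᵒᵖ M] [Module Aᵐᵒᵖ N] (f : M →ₗ[Aᵐᵒᵖ] N) (hf : Function.Injective f) :
    Function.Injective (mapC (BTensor A C C) f) := by
  intro x y h
  rw [← assoc_assocInv A M C C x, ← assoc_assocInv A M C C y, ← assoc_mapC, ← assoc_mapC] at h
  have h1 : Function.Injective (mapCLin C f) := hC _ _ f hf
  have h2 := hC _ _ (mapCLin C f) h1 (assoc_injective _ _ _ _ h)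
  rw [← assoc_assocInv A M C C x, h2, assoc_assocInv]

variable {D : Coring A C}

lemma Comod.hom_ext {M N : Comod D} {f g : M ⟶ N} (h : ∀ m, f.1 m = g.1 m) : f = g :=
  Subtype.ext (LinearMap.ext h)

lemma Comod.zero_apply {M N : Comod D} (m : M.carrier) : (0 : M ⟶ N).1 m = 0 := rfl

lemma Comod.add_apply {M N : Comod D} (f g : M ⟶ N) (m : M.carrier) :
    (f + g).1 m = f.1 m + g.1 m := rfl

lemma Comod.sum_apply {M N : Comod D} {κ : Type*} (s : Finset κ) (f : κ → (M ⟶ N))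
    (m : M.carrier) : (∑ i ∈ s, f i : M ⟶ N).1 m = ∑ i ∈ s, (f i).1 m := by
  induction s using Finset.induction_on with
  | empty => rfl
  | insert a s ha ih => rw [Finset.sum_insert ha, Finset.sum_insert ha, Comod.add_apply, ih]

lemma Comod.epi_of_surjective {M N : Comod D} (f : M ⟶ N) (hf : Function.Surjective f.1) :
    Epi f where
  left_cancellation g h e := Comod.hom_ext fun n => by
    obtain ⟨m, rfl⟩ := hf n
    exact congrArg (fun k : M ⟶ _ => k.1 m) e

/-- A bijective comodule morphism is an isomorphism. -/
def Comod.isoOfBijective {M N : Comod D} (f : M ⟶ N) (hf : Function.Bijective f.1) : M ≅ N :=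
  let e := LinearEquiv.ofBijective f.1 hf
  have he : ∀ m, e m = f.1 m := fun _ => rfl
  { hom := f
    inv := ⟨e.symm.toLinearMap, fun n => by
      obtain ⟨m, rfl⟩ := e.surjective n
      have h : e.symm.toLinearMap ∘ₗ f.1 = LinearMap.id :=
        LinearMap.ext fun m => e.symm_apply_apply m
      rw [he, ← f.2 m, ← he]
      change ((mapC C e.symm.toLinearMap).comp (mapC C f.1)) (M.coact m) = _
      rw [← mapC_comp, h, mapC_id]
      change M.coact m = M.coact (e.symm (e m))
      rw [e.symm_apply_apply]⟩
    hom_inv_id := Comod.hom_ext fun m => e.symm_apply_apply m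
    inv_hom_id := Comod.hom_ext fun m => e.apply_symm_apply m }

/-- The counit gives a left inverse of the coaction. -/
lemma Comod.coact_injective (M : Comod D) : Function.Injective M.coact := fun x y h => by
  rw [← M.counit x, h, M.counit]

/-! #### Kernels of comodule morphisms -/

section Kernel

/-- A submodule to which the coaction restricts, as a comodule over a flat coring. -/
def Comod.ofInjective (hC : IsFlat A C) (M : Comod D) {K : Type u} [AddCommGroup K]
    [Module Aᵐᵒᵖ K] (j : K →ₗ[Aᵐᵒᵖ] M.carrier) (hj : Function.Injective j)
    (ρ : K →ₗ[Aᵐᵒᵖ] BTensor A K C) (h : ∀ k, mapC C j (ρ k) = M.coact (j k)) : Comod D where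
  carrier := K
  coact := ρ
  coassoc k := by
    have hρ : mapCLin C j ∘ₗ ρ = M.coact ∘ₗ j := LinearMap.ext h
    refine mapC_injective_assoc hC j hj ?_
    rw [← assoc_mapC, mapC_mapC, hρ, ← mapC_mapC, h, M.coassoc, ← h, lmap_mapC]
  counit k := by
    refine hj ?_
    rw [← runit_mapC, ← lmap_mapC, h, M.counit]

variable (hC : IsFlat A C) {M N : Comod D} (f : M ⟶ N)

/-- Colinearity of `f` puts the coaction of `k` in the kernel of `f ⊗ C`, which by flatness is the
image of `ker f ⊗ C`. By flatness again the preimage is unique, so choosing it gives a linear map.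
-/
lemma exists_coact_ker (hC : IsFlat A C) {M N : Comod D} (f : M ⟶ N) (k : LinearMap.ker f.1) :
    ∃ z, mapC C (LinearMap.ker f.1).subtype z = M.coact k.1 := by
  have h : mapC C f.1 (M.coact k.1) = 0 := by
    rw [f.2 k.1, show f.1 k.1 = 0 from k.2, map_zero]
  have h' := hC.mem_kerTensor f.1 h
  change _ ∈ (mapC C (LinearMap.ker f.1).subtype).range
  refine (AddSubgroup.closure_le _).2 ?_ h'
  rintro _ ⟨m, c, hm, rfl⟩
  exact ⟨tmul A ⟨m, hm⟩ c, rfl⟩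

/-- The coaction on the kernel of a comodule morphism. -/
def coactKer : LinearMap.ker f.1 →ₗ[Aᵐᵒᵖ] BTensor A (LinearMap.ker f.1) C where
  toFun k := (exists_coact_ker hC f k).choose
  map_add' k k' := by
    refine hC _ _ (LinearMap.ker f.1).subtype Subtype.val_injective ?_
    change mapC C _ _ = mapC C _ _
    rw [map_add, (exists_coact_ker hC f _).choose_spec, (exists_coact_ker hC f _).choose_spec,
      (exists_coact_ker hC f _).choose_spec]
    exact map_add M.coact k.1 k'.1
  map_smul' a k := by
    refine hC _ _ (LinearMap.ker f.1).subtype Subtype.val_injective ?_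
    change mapC C _ _ = mapCLin C _ _
    rw [map_smul, mapCLin_apply, (exists_coact_ker hC f _).choose_spec,
      (exists_coact_ker hC f _).choose_spec]
    exact map_smul M.coact a k.1

lemma mapC_coactKer (k : LinearMap.ker f.1) :
    mapC C (LinearMap.ker f.1).subtype (coactKer hC f k) = M.coact k.1 :=
  (exists_coact_ker hC f k).choose_spec

/-- The kernel of a comodule morphism, over a flat coring. -/
def kerComod : Comod D :=
  M.ofInjective hC (LinearMap.ker f.1).subtype Subtype.val_injective (coactKer hC f)
    (mapC_coactKer hC f)

/-- The inclusion of the kernel of a comodule morphism. -/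
def kerComodι : kerComod hC f ⟶ M :=
  ⟨(LinearMap.ker f.1).subtype, fun k => mapC_coactKer hC f k⟩

lemma kerComodι_injective : Function.Injective (kerComodι hC f).1 := Subtype.val_injective

lemma kerComodι_comp : kerComodι hC f ≫ f = 0 := Comod.hom_ext fun k => k.2

lemma injective_of_kerComodι_eq_zero (h : kerComodι hC f = 0) : Function.Injective f.1 :=
  (injective_iff_map_eq_zero f.1).2 fun m hm =>
    congrArg (fun g : kerComod hC f ⟶ M => g.1 (show (kerComod hC f).carrier from ⟨m, hm⟩)) h

/-- Over a flat coring the linear kernel is itself a comodule, so a monomorphism can be cancelled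
against its inclusion. -/
lemma Comod.injective_of_mono (hC : IsFlat A C) {M N : Comod D} (f : M ⟶ N) [Mono f] :
    Function.Injective f.1 := by
  refine injective_of_kerComodι_eq_zero hC f ?_
  rw [← cancel_mono f, kerComodι_comp, Limits.zero_comp]

/-- The universal property of the kernel. -/
def kerComodLift {L : Comod D} (g : L ⟶ M) (hg : g ≫ f = 0) : L ⟶ kerComod hC f :=
  have hk : ∀ l, g.1 l ∈ LinearMap.ker f.1 := fun l => congrArg (fun h : L ⟶ N => h.1 l) hg
  ⟨g.1.codRestrict (LinearMap.ker f.1) hk, fun l => by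
    refine hC _ _ (LinearMap.ker f.1).subtype Subtype.val_injective ?_
    exact (mapC_mapC _ _ _).trans <| (g.2 l).trans
      (mapC_coactKer hC f (g.1.codRestrict (LinearMap.ker f.1) hk l)).symm⟩

lemma kerComodLift_ι {L : Comod D} (g : L ⟶ M) (hg : g ≫ f = 0) :
    kerComodLift hC f g hg ≫ kerComodι hC f = g := rfl

end Kernel

/-! #### Direct sums of comodules -/

section DirectSum

variable {J : Type u} (M : J → Comod D)

/-- The coaction on a direct sum of comodules. -/
def dsumCoact : (⨁ j, (M j).carrier) →ₗ[Aᵐᵒᵖ] BTensor A (⨁ j, (M j).carrier) C :=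
  DirectSum.toModule Aᵐᵒᵖ J _
    (fun j => mapCLin C (DirectSum.lof Aᵐᵒᵖ J (fun j => (M j).carrier) j) ∘ₗ (M j).coact)

lemma dsumCoact_lof (j : J) (m : (M j).carrier) :
    dsumCoact M (DirectSum.lof Aᵐᵒᵖ J (fun j => (M j).carrier) j m) =
      mapC C (DirectSum.lof Aᵐᵒᵖ J (fun j => (M j).carrier) j) ((M j).coact m) :=
  DirectSum.toModule_lof _ _ _

/-- The direct sum of a family of comodules. -/
def dsum : Comod D where
  carrier := ⨁ j, (M j).carrier
  coact := dsumCoact M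
  coassoc x := by
    induction x using DirectSum.induction_on with
    | zero => simp only [map_zero]
    | add x y hx hy => simp only [map_add, hx, hy]
    | of j m =>
      have h : dsumCoact M ∘ₗ DirectSum.lof Aᵐᵒᵖ J (fun j => (M j).carrier) j =
          mapCLin C (DirectSum.lof Aᵐᵒᵖ J (fun j => (M j).carrier) j) ∘ₗ (M j).coact :=
        LinearMap.ext fun m => dsumCoact_lof M j m
      change assoc A _ C C (mapC C (dsumCoact M) (dsumCoact M
        (DirectSum.lof Aᵐᵒᵖ J (fun j => (M j).carrier) j m))) = lmap _ _ _ (dsumCoact M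
        (DirectSum.lof Aᵐᵒᵖ J (fun j => (M j).carrier) j m))
      rw [dsumCoact_lof, lmap_mapC, ← (M j).coassoc, ← assoc_mapC, mapC_mapC, mapC_mapC, h]
  counit x := by
    induction x using DirectSum.induction_on with
    | zero => simp only [map_zero]
    | add x y hx hy => simp only [map_add, hx, hy]
    | of j m =>
      change runit A _ (lmap _ _ _ (dsumCoact M
        (DirectSum.lof Aᵐᵒᵖ J (fun j => (M j).carrier) j m))) =
          DirectSum.lof Aᵐᵒᵖ J (fun j => (M j).carrier) j m
      rw [dsumCoact_lof, lmap_mapC, runit_mapC, (M j).counit]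

/-- The inclusion of a summand. -/
def dsumι (j : J) : M j ⟶ dsum M :=
  ⟨DirectSum.lof Aᵐᵒᵖ J (fun j => (M j).carrier) j, fun m =>
    (dsumCoact_lof M j m).symm⟩

variable {M}

@[elab_as_elim]
lemma dsum_induction {p : (dsum M).carrier → Prop} (x : (dsum M).carrier) (zero : p 0)
    (ι : ∀ j m, p ((dsumι M j).1 m)) (add : ∀ x y, p x → p y → p (x + y)) : p x :=
  DirectSum.induction_on (β := fun j => (M j).carrier) x zero ι add

lemma dsum_hom_ext {N : Comod D} {f g : dsum M ⟶ N} (h : ∀ j, dsumι M j ≫ f = dsumι M j ≫ g) :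
    f = g :=
  Comod.hom_ext fun x => by
    induction x using dsum_induction with
    | zero => simp only [map_zero]
    | add x y hx hy => simp only [map_add, hx, hy]
    | ι j m => exact congrArg (fun k : M j ⟶ N => k.1 m) (h j)

/-- The linear map from a direct sum induced by morphisms from the summands. -/
def dsumDescLin {N : Comod D} (f : ∀ j, M j ⟶ N) : (dsum M).carrier →ₗ[Aᵐᵒᵖ] N.carrier :=
  DirectSum.toModule Aᵐᵒᵖ J _ (fun j => (f j).1)

lemma dsumDescLin_ι {N : Comod D} (f : ∀ j, M j ⟶ N) (j : J) :
    dsumDescLin f ∘ₗ (dsumι M j).1 = (f j).1 :=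
  LinearMap.ext fun m => DirectSum.toModule_lof (M := fun j => (M j).carrier)
    (φ := fun j => (f j).1) Aᵐᵒᵖ j m

/-- The universal property of the direct sum. -/
def dsumDesc {N : Comod D} (f : ∀ j, M j ⟶ N) : dsum M ⟶ N :=
  ⟨dsumDescLin f, fun x => by
    induction x using dsum_induction with
    | zero => simp only [map_zero]
    | add x y hx hy => simp only [map_add, hx, hy]
    | ι j m =>
      rw [← (dsumι M j).2 m, mapC_mapC, dsumDescLin_ι, (f j).2 m,
        ← dsumDescLin_ι f]
      rfl⟩

lemma dsumι_desc {N : Comod D} (f : ∀ j, M j ⟶ N) (j : J) : dsumι M j ≫ dsumDesc f = f j :=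
  Subtype.ext (dsumDescLin_ι f j)

lemma dsumDesc_ι_apply {N : Comod D} (f : ∀ j, M j ⟶ N) (j : J) (m : (M j).carrier) :
    (dsumDesc f).1 ((dsumι M j).1 m) = (f j).1 m :=
  congrArg (fun k : M j ⟶ N => k.1 m) (dsumι_desc f j)

variable (M) in
/-- The projection to a summand. -/
def dsumπ (j : J) : dsum M ⟶ M j :=
  dsumDesc (fun i => if h : i = j then eqToHom (congrArg M h) else 0)

lemma dsumι_π (j : J) : dsumι M j ≫ dsumπ M j = 𝟙 (M j) := by
  rw [dsumπ, dsumι_desc, dif_pos rfl]; rfl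

lemma dsumι_π_ne {i j : J} (h : i ≠ j) : dsumι M i ≫ dsumπ M j = 0 := by
  rw [dsumπ, dsumι_desc, dif_neg h]

/-- Allowing every larger `t` makes the statement stable under sums and lets finitely many elements
share one finite set. -/
lemma exists_finset_dsum (x : (dsum M).carrier) :
    ∃ s : Finset J, ∀ t, s ⊆ t → ∑ j ∈ t, (dsumπ M j ≫ dsumι M j).1 x = x := by
  induction x using dsum_induction with
  | zero => exact ⟨∅, fun t _ => by simp only [map_zero, Finset.sum_const_zero]⟩
  | add x y hx hy =>
    obtain ⟨s, hs⟩ := hx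
    obtain ⟨s', hs'⟩ := hy
    refine ⟨s ∪ s', fun t ht => ?_⟩
    simp only [map_add, Finset.sum_add_distrib, hs t (Finset.union_subset_left ht),
      hs' t (Finset.union_subset_right ht)]
  | ι j m =>
    refine ⟨{j}, fun t ht => ?_⟩
    rw [Finset.sum_eq_single_of_mem j (ht (Finset.mem_singleton_self j))]
    · change (dsumι M j ≫ dsumπ M j ≫ dsumι M j).1 m = _
      rw [← Category.assoc, dsumι_π, Category.id_comp]
    · intro i _ hi
      change (dsumι M j ≫ dsumπ M i ≫ dsumι M i).1 m = _
      rw [← Category.assoc, dsumι_π_ne hi.symm, Limits.zero_comp, Comod.zero_apply]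

/-- A morphism from a finitely generated comodule to a direct sum factors through a finite
partial sum. -/
theorem exists_finset_hom_dsum {P : Comod D} [Module.Finite Aᵐᵒᵖ P.carrier] (f : P ⟶ dsum M) :
    ∃ s : Finset J, f = ∑ j ∈ s, (f ≫ dsumπ M j) ≫ dsumι M j := by
  obtain ⟨G, hG⟩ := (Module.Finite.fg_top : (⊤ : Submodule Aᵐᵒᵖ P.carrier).FG)
  choose s hs using fun p => exists_finset_dsum (f.1 p)
  -- The union serves all generators at once; both sides are linear, so agreement on generators is
  -- enough.
  refine ⟨G.biUnion s, Comod.hom_ext fun p => ?_⟩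
  have hp : p ∈ Submodule.span Aᵐᵒᵖ (G : Set P.carrier) := hG ▸ Submodule.mem_top
  induction hp using Submodule.span_induction with
  | mem p hp =>
    rw [Comod.sum_apply]
    exact (hs p _ (Finset.subset_biUnion_of_mem s hp)).symm
  | zero => simp only [map_zero]
  | add p q _ _ hp hq => rw [map_add, map_add, ← hp, ← hq]
  | smul a p _ hp => rw [map_smul, map_smul, ← hp]

end DirectSum

end Coring

/-! ### Unital modules -/

section UMod

variable {R : Type u} [NonUnitalRing R]

/-- A module with local units is unital. -/
def UMod.ofLocalUnits (M : Type u) [AddCommGroup M] [NUModule Rᵐᵒᵖ M]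
    (h : ∀ m : M, ∃ r : R, op r • m = m) : UMod R where
  carrier := M
  unital := by
    refine eq_top_iff.2 fun m _ => AddSubgroup.subset_closure ?_
    obtain ⟨r, hr⟩ := h m
    exact ⟨r, m, hr.symm⟩

lemma UMod.hom_ext {X Y : UMod R} {f g : X ⟶ Y}
    (h : ∀ x, UMod.Hom.hom f x = UMod.Hom.hom g x) : f = g :=
  UMod.Hom.ext (AddMonoidHom.ext h)

/-- The action of an element of `R`. -/
def NUModule.smulHom {M : Type*} [AddCommGroup M] [NUModule R M] (r : R) : M →+ M where
  toFun m := r • m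
  map_zero' := NUModule.smul_zero' r
  map_add' := NUModule.smul_add r

lemma NUModule.smul_neg' {M : Type*} [AddCommGroup M] [NUModule R M] (r : R) (m : M) :
    r • -m = -(r • m) := map_neg (NUModule.smulHom r) m

lemma NUModule.sum_smul' {M : Type*} [AddCommGroup M] [NUModule R M] {κ : Type*}
    (s : Finset κ) (f : κ → R) (m : M) : (∑ i ∈ s, f i) • m = ∑ i ∈ s, f i • m :=
  map_sum (AddMonoidHom.mk' (fun r : R => r • m) (fun r r' => NUModule.add_smul r r' m)) f s

/-- The action on a subgroup that is closed under the action. -/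
abbrev NUModule.ofSub {S M : Type*} [NonUnitalRing S] [AddCommGroup M] [NUModule S M]
    (K : AddSubgroup M) (h : ∀ (r : S) m, m ∈ K → r • m ∈ K) : NUModule S K where
  smul r m := ⟨r • m.1, h r m.1 m.2⟩
  smul_add r m n := Subtype.ext (NUModule.smul_add r m.1 n.1)
  add_smul r s m := Subtype.ext (NUModule.add_smul r s m.1)
  mul_smul r s m := Subtype.ext (NUModule.mul_smul r s m.1)

/-- The action on the quotient by a subgroup that is closed under the action. -/
abbrev NUModule.ofQuot {S M : Type*} [NonUnitalRing S] [AddCommGroup M] [NUModule S M]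
    (K : AddSubgroup M) (h : ∀ (r : S) m, m ∈ K → r • m ∈ K) : NUModule S (M ⧸ K) where
  smul r := QuotientAddGroup.map K K (NUModule.smulHom r) (h r)
  smul_add r := map_add (QuotientAddGroup.map K K (NUModule.smulHom r) (h r))
  add_smul r s m := by
    obtain ⟨m, rfl⟩ := QuotientAddGroup.mk_surjective m
    exact congrArg QuotientAddGroup.mk (NUModule.add_smul r s m)
  mul_smul r s m := by
    obtain ⟨m, rfl⟩ := QuotientAddGroup.mk_surjective m
    exact congrArg QuotientAddGroup.mk (NUModule.mul_smul r s m)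

/-- The quotient of a unital module. -/
def UMod.quot (X : UMod R) (K : AddSubgroup X.carrier)
    (h : ∀ (r : Rᵐᵒᵖ) m, m ∈ K → r • m ∈ K) : UMod R :=
  letI := NUModule.ofQuot K h
  { carrier := X.carrier ⧸ K
    unital := by
      have e := congrArg (AddSubgroup.map (QuotientAddGroup.mk' K)) X.unital
      rw [AddMonoidHom.map_closure,
        AddSubgroup.map_top_of_surjective _ (QuotientAddGroup.mk'_surjective K)] at e
      refine eq_top_iff.2 (e ▸ AddSubgroup.closure_mono ?_)
      rintro _ ⟨_, ⟨r, m, rfl⟩, rfl⟩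
      exact ⟨r, QuotientAddGroup.mk m, rfl⟩ }

/-- The projection to the quotient. -/
def UMod.quotMk (X : UMod R) (K : AddSubgroup X.carrier)
    (h : ∀ (r : Rᵐᵒᵖ) m, m ∈ K → r • m ∈ K) : X ⟶ X.quot K h :=
  (⟨QuotientAddGroup.mk' K, fun _ _ => rfl⟩ : UMod.Hom X (X.quot K h))

lemma UMod.quotMk_eq_zero {X : UMod R} {K : AddSubgroup X.carrier}
    {h : ∀ (r : Rᵐᵒᵖ) m, m ∈ K → r • m ∈ K} {x : X.carrier} :
    UMod.Hom.hom (X.quotMk K h) x = 0 ↔ x ∈ K := QuotientAddGroup.eq_zero_iff x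

/-- The zero morphism. -/
def UMod.zeroHom (X Y : UMod R) : X ⟶ Y :=
  (⟨0, fun _ _ => (NUModule.smul_zero' _).symm⟩ : UMod.Hom X Y)

lemma UMod.tensorMap_tmul (N : Type u) [AddCommGroup N] [NUModule R N] {X Y : UMod R} (f : X ⟶ Y)
    (x : X.carrier) (n : N) :
    UMod.tensorMap N f (tmul R x n) = tmul R (UMod.Hom.hom f x) n := rfl

/-- Over a flat module `N`, the kernel of `f ⊗_R N` is generated by the elements `k ⊗ n`
with `f k = 0`. -/
theorem NUFlat.mem_kerTensor {N : Type u} [AddCommGroup N] [NUModule R N] (hN : NUFlat R N)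
    {X Y : UMod R} (f : X ⟶ Y) {z : BTensor R X.carrier N} (hz : UMod.tensorMap N f z = 0) :
    z ∈ kerTensor R N (UMod.Hom.hom f) := by
  -- The image of `f` is taken as the quotient by `K`: quotients of unital modules are unital over
  -- any `R`, whereas submodules need not be.
  let K := (UMod.Hom.hom f).ker
  have hK : ∀ (r : Rᵐᵒᵖ) m, m ∈ K → r • m ∈ K := fun r m hm => by
    change UMod.Hom.hom f (op (unop r) • m) = 0
    rw [UMod.Hom.map_smul, show UMod.Hom.hom f m = 0 from hm, NUModule.smul_zero']
  let g : X.quot K hK ⟶ Y := (⟨QuotientAddGroup.kerLift (UMod.Hom.hom f), fun r x => by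
    obtain ⟨x, rfl⟩ := QuotientAddGroup.mk_surjective x
    exact UMod.Hom.map_smul f r x⟩ : UMod.Hom _ _)
  have h0 : UMod.tensorMap N (X.quotMk K hK) z = 0 := by
    refine hN _ _ g (QuotientAddGroup.kerLift_injective (UMod.Hom.hom f)) ?_
    rw [map_zero, ← hz, ← AddMonoidHom.comp_apply]
    congr 1
    exact InfComatrix.hom_ext fun _ _ => rfl
  refine AddSubgroup.closure_mono ?_ (mem_kerTensor_of_surjective (B := R)
    (UMod.Hom.hom (X.quotMk K hK)) (UMod.Hom.map_smul (X.quotMk K hK))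
    (QuotientAddGroup.mk'_surjective K) h0)
  rintro _ ⟨k, n, hk, rfl⟩
  exact ⟨k, n, UMod.quotMk_eq_zero.1 hk, rfl⟩

/-- Epimorphisms of unital modules are surjective. -/
theorem UMod.surjective_of_epi {X Y : UMod R} (f : X ⟶ Y) [Epi f] :
    Function.Surjective (UMod.Hom.hom f) := by
  let K := (UMod.Hom.hom f).range
  have hK : ∀ (r : Rᵐᵒᵖ) m, m ∈ K → r • m ∈ K := by
    rintro r _ ⟨x, rfl⟩
    exact ⟨r • x, UMod.Hom.map_smul f (unop r) x⟩
  have h : Y.quotMk K hK = UMod.zeroHom Y _ := by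
    rw [← cancel_epi f]
    exact UMod.hom_ext fun x => UMod.quotMk_eq_zero.2 ⟨x, rfl⟩
  intro y
  exact UMod.quotMk_eq_zero.1 (congrArg (fun g : Y ⟶ Y.quot K hK => UMod.Hom.hom g y) h)

lemma UMod.mono_of_injective {X Y : UMod R} (f : X ⟶ Y)
    (hf : Function.Injective (UMod.Hom.hom f)) : Mono f where
  right_cancellation _ _ e := UMod.hom_ext fun x =>
    hf (congrArg (fun k => UMod.Hom.hom k x) e)

end UMod

/-! ### Local units of `CatRing` -/

section LocalUnits

variable {𝒜 : Type u} [SmallCategory 𝒜] [Preadditive 𝒜]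

/-- The idempotent of an object. -/
def one (P : 𝒜) : CatRing 𝒜 := single P P (𝟙 P)

lemma single_mul_one {P Q : 𝒜} (t : P ⟶ Q) :
    (single P Q t : CatRing 𝒜) * one P = single P Q t := by
  rw [one]
  exact (single_mul_single (F := fun P : 𝒜 => P) t (𝟙 P)).trans (by rw [Category.id_comp])

lemma single_mul_one_ne {P P' Q : 𝒜} (h : P ≠ P') (t : P ⟶ Q) :
    (single P Q t : CatRing 𝒜) * one P' = 0 :=
  single_mul_single_ne (F := fun P : 𝒜 => P) h t _

section Module

variable {X : Type u} [AddCommGroup X] [NUModule (CatRing 𝒜)ᵐᵒᵖ X]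

lemma op_smul_op_smul (r s : CatRing 𝒜) (x : X) : op r • op s • x = op (s * r) • x :=
  (NUModule.mul_smul (op r) (op s) x).symm

lemma one_smul_single {P Q : 𝒜} (t : P ⟶ Q) (x : X) :
    op (one P) • op (single P Q t : CatRing 𝒜) • x = op (single P Q t : CatRing 𝒜) • x := by
  rw [op_smul_op_smul, single_mul_one]

lemma one_smul_single_ne {P P' Q : 𝒜} (h : P ≠ P') (t : P ⟶ Q) (x : X) :
    op (one P') • op (single P Q t : CatRing 𝒜) • x = 0 := by
  rw [op_smul_op_smul, single_mul_one_ne h, op_zero, NUModule.zero_smul']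

/-- The matrix `r` has finitely many nonzero entries, and the idempotents at their sources sum to a
right unit for `r`. -/
lemma exists_finset_smul (r : CatRing 𝒜) (x : X) : ∃ s : Finset 𝒜, ∀ t, s ⊆ t →
    ∑ P ∈ t, op (one P) • op r • x = op r • x := by
  induction r using MatRing.induction with
  | zero =>
    refine ⟨∅, fun t _ => ?_⟩
    rw [op_zero, NUModule.zero_smul']
    exact Finset.sum_eq_zero fun P _ => NUModule.smul_zero' _
  | single P Q f =>
    refine ⟨{P}, fun t ht => ?_⟩
    rw [Finset.sum_eq_single_of_mem P (ht (Finset.mem_singleton_self P)), one_smul_single]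
    exact fun P' _ h => one_smul_single_ne h.symm f x
  | add r r' hr hr' =>
    obtain ⟨s, hs⟩ := hr
    obtain ⟨s', hs'⟩ := hr'
    refine ⟨s ∪ s', fun t ht => ?_⟩
    simp only [MulOpposite.op_add, NUModule.add_smul, NUModule.smul_add, Finset.sum_add_distrib,
      hs t (Finset.union_subset_left ht), hs' t (Finset.union_subset_right ht)]

end Module

variable (X : UMod (CatRing 𝒜))

/-- Unitality writes `x` as a sum of elements `m r`, each fixed by the idempotents at the sources of
`r`. Finite sums of the idempotents `one P` are thus local units for every unital module. -/
lemma exists_finset_sum_one_smul (x : X.carrier) : ∃ s : Finset 𝒜, ∀ t, s ⊆ t →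
    ∑ P ∈ t, op (one P) • x = x := by
  have hx : x ∈ AddSubgroup.closure {x : X.carrier | ∃ (r : CatRing 𝒜) (m : X.carrier),
    x = op r • m} := X.unital ▸ AddSubgroup.mem_top x
  induction hx using AddSubgroup.closure_induction with
  | mem x hx => obtain ⟨r, m, rfl⟩ := hx; exact exists_finset_smul r m
  | zero => exact ⟨∅, fun t _ => Finset.sum_eq_zero fun P _ => NUModule.smul_zero' _⟩
  | add x y _ _ hx hy =>
    obtain ⟨s, hs⟩ := hx
    obtain ⟨s', hs'⟩ := hy
    refine ⟨s ∪ s', fun t ht => ?_⟩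
    simp only [NUModule.smul_add, Finset.sum_add_distrib,
      hs t (Finset.union_subset_left ht), hs' t (Finset.union_subset_right ht)]
  | neg x _ hx =>
    obtain ⟨s, hs⟩ := hx
    refine ⟨s, fun t ht => ?_⟩
    simp only [NUModule.smul_neg', Finset.sum_neg_distrib, hs t ht]

lemma exists_sum_one_smul (x : X.carrier) : ∃ s : Finset 𝒜, ∑ P ∈ s, op (one P) • x = x :=
  (exists_finset_sum_one_smul X x).imp fun s hs => hs s subset_rfl

lemma exists_local_unit (x : X.carrier) : ∃ r : CatRing 𝒜, op r • x = x := by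
  obtain ⟨s, hs⟩ := exists_sum_one_smul X x
  refine ⟨∑ P ∈ s, one P, ?_⟩
  rw [Finset.op_sum, NUModule.sum_smul', hs]

variable {X}

/-- An element killed by all idempotents is zero. -/
lemma eq_zero_of_one_smul {x : X.carrier} (h : ∀ P : 𝒜, op (one P) • x = 0) : x = 0 := by
  obtain ⟨s, hs⟩ := exists_sum_one_smul X x
  rw [← hs]
  exact Finset.sum_eq_zero fun P _ => h P

/-- The submodule of a unital module that is given by a subgroup closed under the action. -/
def UMod.sub (X : UMod (CatRing 𝒜)) (K : AddSubgroup X.carrier)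
    (h : ∀ (r : (CatRing 𝒜)ᵐᵒᵖ) m, m ∈ K → r • m ∈ K) : UMod (CatRing 𝒜) :=
  letI := NUModule.ofSub K h
  UMod.ofLocalUnits K fun m => by
    -- A local unit for `m` in the ambient module is one in the submodule, so over this ring
    -- submodules of unital modules are unital.
    obtain ⟨r, hr⟩ := exists_local_unit X m.1
    exact ⟨r, Subtype.ext hr⟩

/-- The inclusion of a submodule. -/
def UMod.subι (X : UMod (CatRing 𝒜)) (K : AddSubgroup X.carrier)
    (h : ∀ (r : (CatRing 𝒜)ᵐᵒᵖ) m, m ∈ K → r • m ∈ K) : X.sub K h ⟶ X :=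
  (⟨K.subtype, fun _ _ => rfl⟩ : UMod.Hom (X.sub K h) X)

variable (𝒜) in
/-- The ring `R` as a right module over itself. -/
def regular : UMod (CatRing 𝒜) :=
  letI : NUModule (CatRing 𝒜)ᵐᵒᵖ (CatRing 𝒜) :=
    { smul := fun r x => x * unop r
      smul_add := fun r x y => add_mul x y (unop r)
      add_smul := fun r s x => mul_add x (unop r) (unop s)
      mul_smul := fun r s x => (mul_assoc x (unop s) (unop r)).symm }
  { carrier := CatRing 𝒜
    unital := by
      refine (AddSubgroup.eq_top_iff' _).2 fun r => ?_
      induction r using MatRing.induction with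
      | zero => exact zero_mem _
      | single P Q t =>
        exact AddSubgroup.subset_closure ⟨one P, single P Q t, (single_mul_one t).symm⟩
      | add r s hr hs => exact add_mem hr hs }

/-- The morphism `r ↦ x r` from the ring to a module. -/
def regularHom (x : X.carrier) : regular 𝒜 ⟶ X :=
  let f : CatRing 𝒜 →+ X.carrier :=
    AddMonoidHom.mk' (fun r => op r • x) (fun r s => NUModule.add_smul (op r) (op s) x)
  (⟨f, fun r s => NUModule.mul_smul (M := X.carrier) (op r)
    (op (show CatRing 𝒜 from s)) x⟩ : UMod.Hom (regular 𝒜) X)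

end LocalUnits

/-! ### The right `R`-module `⨁ P, Hom (ω P, M)` -/

section HomSum

variable {A : Type u} [Ring A] {𝒜 : Type u} [SmallCategory 𝒜] (ω : 𝒜 ⥤ ModuleCat.{u} Aᵐᵒᵖ)
variable (M : Type u) [AddCommGroup M] [Module Aᵐᵒᵖ M]

/-- The group `⨁ P, Hom (ω P, M)`. -/
def HomSum : Type u := ⨁ P : 𝒜, (ω.obj P →ₗ[Aᵐᵒᵖ] M)

instance : AddCommGroup (HomSum ω M) :=
  inferInstanceAs (AddCommGroup (⨁ P : 𝒜, (ω.obj P →ₗ[Aᵐᵒᵖ] M)))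

variable {ω M}

/-- The inclusion of a summand. -/
def HomSum.ι (P : 𝒜) : (ω.obj P →ₗ[Aᵐᵒᵖ] M) →+ HomSum ω M :=
  DirectSum.of (fun P => (ω.obj P →ₗ[Aᵐᵒᵖ] M)) P

/-- The projection to a summand. -/
def HomSum.π (P : 𝒜) : HomSum ω M →+ (ω.obj P →ₗ[Aᵐᵒᵖ] M) where
  toFun x := (show ⨁ P : 𝒜, (ω.obj P →ₗ[Aᵐᵒᵖ] M) from x) P
  map_zero' := rfl
  map_add' _ _ := rfl

lemma HomSum.ext {x y : HomSum ω M} (h : ∀ P, HomSum.π P x = HomSum.π P y) : x = y :=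
  DirectSum.ext h

@[elab_as_elim]
lemma HomSum.induction {p : HomSum ω M → Prop} (x : HomSum ω M) (zero : p 0)
    (ι : ∀ P y, p (HomSum.ι P y)) (add : ∀ x y, p x → p y → p (x + y)) : p x :=
  DirectSum.induction_on x zero ι add

lemma HomSum.π_ι (P : 𝒜) (h : ω.obj P →ₗ[Aᵐᵒᵖ] M) : HomSum.π P (HomSum.ι P h) = h :=
  DirectSum.of_eq_same (β := fun P => (ω.obj P →ₗ[Aᵐᵒᵖ] M)) P h

lemma HomSum.π_ι_ne {P Q : 𝒜} (e : P ≠ Q) (h : ω.obj P →ₗ[Aᵐᵒᵖ] M) :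
    HomSum.π Q (HomSum.ι P h) = 0 :=
  DirectSum.of_eq_of_ne (β := fun P => (ω.obj P →ₗ[Aᵐᵒᵖ] M)) P Q h e.symm

/-- Additive maps between the summands induce a map on the sums. -/
def HomSum.mapSummands {N : Type u} [AddCommGroup N] [Module Aᵐᵒᵖ N]
    (g : ∀ P : 𝒜, (ω.obj P →ₗ[Aᵐᵒᵖ] M) →+ (ω.obj P →ₗ[Aᵐᵒᵖ] N)) : HomSum ω M →+ HomSum ω N :=
  DirectSum.map g

lemma HomSum.π_mapSummands {N : Type u} [AddCommGroup N] [Module Aᵐᵒᵖ N]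
    (g : ∀ P : 𝒜, (ω.obj P →ₗ[Aᵐᵒᵖ] M) →+ (ω.obj P →ₗ[Aᵐᵒᵖ] N)) (x : HomSum ω M) (P : 𝒜) :
    HomSum.π P (HomSum.mapSummands g x) = g P (HomSum.π P x) := DirectSum.map_apply g P x

/-- The maps `h ↦ f ∘ h`. -/
def postcomp {N : Type u} [AddCommGroup N] [Module Aᵐᵒᵖ N] (f : M →ₗ[Aᵐᵒᵖ] N) (P : 𝒜) :
    (ω.obj P →ₗ[Aᵐᵒᵖ] M) →+ (ω.obj P →ₗ[Aᵐᵒᵖ] N) :=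
  AddMonoidHom.mk' (fun h => f ∘ₗ h) (fun _ _ => LinearMap.comp_add _ _ _)

lemma HomSum.mapSummands_postcomp_injective {N : Type u} [AddCommGroup N] [Module Aᵐᵒᵖ N]
    (f : M →ₗ[Aᵐᵒᵖ] N) (hf : Function.Injective f) :
    Function.Injective (HomSum.mapSummands (ω := ω) (postcomp f)) := fun x y h => by
  refine HomSum.ext fun P => LinearMap.ext fun p => hf ?_
  have h1 := congrArg (HomSum.π P) h
  rw [HomSum.π_mapSummands, HomSum.π_mapSummands] at h1
  exact LinearMap.congr_fun h1 p

lemma Sig.hom_ext {G : Type*} [AddCommGroup G] {f g : Sig ω →+ G}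
    (h : ∀ P p, f (Sig.ι ω P p) = g (Sig.ι ω P p)) : f = g :=
  DirectSum.addHom_ext h

/-- The right linear map `a ↦ m a`. -/
def orbit (m : M) : A →ₗ[Aᵐᵒᵖ] M where
  toFun a := op a • m
  map_add' a b := by rw [MulOpposite.op_add, add_smul]
  map_smul' r a := by
    rw [RingHom.id_apply, ← MulOpposite.op_unop r, op_smul_eq_mul, op_mul, mul_smul]

lemma orbit_apply (m : M) (a : A) : orbit m a = op a • m := rfl

lemma orbit_add (m n : M) : orbit (A := A) (m + n) = orbit m + orbit n :=
  LinearMap.ext fun _ => smul_add _ _ _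

/-- The map `Σ† → ⨁ P, Hom (ω P, M)`, `φ ↦ (p ↦ m φ(p))`. -/
def sdagHom (m : M) : Sdag ω →+ HomSum ω M := HomSum.mapSummands (M := A) (postcomp (orbit m))

lemma sdagHom_ι (m : M) (P : 𝒜) (φ : ω.obj P →ₗ[Aᵐᵒᵖ] A) :
    sdagHom m (Sdag.ι ω P φ) = HomSum.ι P (orbit m ∘ₗ φ) :=
  DirectSum.map_of _ _ _

variable [Preadditive 𝒜] [ω.Additive]

variable (ω M) in
/-- The additive map `(t, h) ↦ h ∘ ω(t)`. -/
def homAct (P Q : 𝒜) : (P ⟶ Q) →+ (ω.obj Q →ₗ[Aᵐᵒᵖ] M) →+ (ω.obj P →ₗ[Aᵐᵒᵖ] M) :=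
  AddMonoidHom.mk' (fun t => AddMonoidHom.mk' (fun φ => φ ∘ₗ (ω.map t).hom)
    (fun φ ψ => LinearMap.add_comp _ _ _)) (fun s t => by ext φ p; simp)

instance : NUModule (CatRing 𝒜)ᵐᵒᵖ (HomSum ω M) where
  smul t x := rightAct (F := fun P : 𝒜 => P) (homAct ω M) (unop t) x
  smul_add _ := map_add _
  add_smul s t x := DFunLike.congr_fun (rightAct_add (homAct ω M) (unop s) (unop t)) x
  mul_smul s t x := DFunLike.congr_fun (rightAct_mul (F := fun P : 𝒜 => P) (homAct ω M)
    (fun P Q Q' f g x => by ext p; simp [homAct]) (unop t) (unop s)) x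

lemma HomSum.smul_ι {P Q : 𝒜} (t : P ⟶ Q) (h : ω.obj Q →ₗ[Aᵐᵒᵖ] M) :
    op (single P Q t : CatRing 𝒜) • HomSum.ι Q h = HomSum.ι P (h ∘ₗ (ω.map t).hom) :=
  rightAct_single (F := fun P : 𝒜 => P) (homAct ω M) t h

lemma HomSum.smul_ι_ne {P Q Q' : 𝒜} (e : Q ≠ Q') (t : P ⟶ Q) (h : ω.obj Q' →ₗ[Aᵐᵒᵖ] M) :
    op (single P Q t : CatRing 𝒜) • HomSum.ι Q' h = 0 :=
  rightAct_single_ne (F := fun P : 𝒜 => P) (homAct ω M) e t h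

lemma HomSum.π_smul {P Q : 𝒜} (t : P ⟶ Q) (x : HomSum ω M) :
    HomSum.π P (op (single P Q t : CatRing 𝒜) • x) = HomSum.π Q x ∘ₗ (ω.map t).hom := by
  induction x using HomSum.induction with
  | zero => rw [NUModule.smul_zero', map_zero, map_zero, LinearMap.zero_comp]
  | add x y hx hy => rw [NUModule.smul_add, map_add, map_add, hx, hy, LinearMap.add_comp]
  | ι Q' h =>
    by_cases e : Q = Q'
    · subst e
      rw [HomSum.smul_ι, HomSum.π_ι, HomSum.π_ι]
    · rw [HomSum.smul_ι_ne e, HomSum.π_ι_ne (Ne.symm e), map_zero, LinearMap.zero_comp]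

lemma HomSum.π_smul_ne {P P' Q : 𝒜} (e : P ≠ P') (t : P ⟶ Q) (x : HomSum ω M) :
    HomSum.π P' (op (single P Q t : CatRing 𝒜) • x) = 0 := by
  induction x using HomSum.induction with
  | zero => rw [NUModule.smul_zero', map_zero]
  | add x y hx hy => rw [NUModule.smul_add, map_add, hx, hy, add_zero]
  | ι Q' h =>
    by_cases e' : Q = Q'
    · subst e'
      rw [HomSum.smul_ι, HomSum.π_ι_ne e]
    · rw [HomSum.smul_ι_ne e', map_zero]

lemma HomSum.one_smul_ι (P : 𝒜) (h : ω.obj P →ₗ[Aᵐᵒᵖ] M) :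
    op (one P) • HomSum.ι P h = HomSum.ι P h := by
  rw [one, HomSum.smul_ι, ω.map_id]; rfl

lemma HomSum.one_smul (P : 𝒜) (x : HomSum ω M) :
    op (one P) • x = HomSum.ι P (HomSum.π P x) := by
  refine HomSum.ext fun Q => ?_
  by_cases h : P = Q
  · subst h
    rw [one, HomSum.π_smul, HomSum.π_ι, ω.map_id]; rfl
  · rw [one, HomSum.π_smul_ne h, HomSum.π_ι_ne h]

/-- Maps that are compatible with the summands and the restriction along `ω(t)` are linear. -/
lemma HomSum.mapSummands_smul {N : Type u} [AddCommGroup N] [Module Aᵐᵒᵖ N]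
    (g : ∀ P : 𝒜, (ω.obj P →ₗ[Aᵐᵒᵖ] M) →+ (ω.obj P →ₗ[Aᵐᵒᵖ] N))
    (hg : ∀ (P Q : 𝒜) (t : P ⟶ Q) h, g P (h ∘ₗ (ω.map t).hom) = g Q h ∘ₗ (ω.map t).hom)
    (r : CatRing 𝒜) (x : HomSum ω M) :
    HomSum.mapSummands g (op r • x) = op r • HomSum.mapSummands g x := by
  induction r using MatRing.induction with
  | zero => rw [op_zero, NUModule.zero_smul', NUModule.zero_smul', map_zero]
  | add r s hr hs =>
    rw [MulOpposite.op_add, NUModule.add_smul, NUModule.add_smul, map_add, hr, hs]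
  | single P Q t =>
    refine HomSum.ext fun P' => ?_
    rw [HomSum.π_mapSummands]
    by_cases h : P = P'
    · subst h
      rw [HomSum.π_smul, HomSum.π_smul, HomSum.π_mapSummands, hg]
    · rw [HomSum.π_smul_ne h, HomSum.π_smul_ne h, map_zero]

variable (ω M) in
/-- The unital right `R`-module `⨁ P, Hom (ω P, M)`. -/
def homUMod : UMod (CatRing 𝒜) where
  carrier := HomSum ω M
  unital := by
    refine (AddSubgroup.eq_top_iff' _).2 fun x => ?_
    induction x using HomSum.induction with
    | zero => exact zero_mem _
    | ι P h => exact AddSubgroup.subset_closure ⟨one P, HomSum.ι P h, (HomSum.one_smul_ι P h).symm⟩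
    | add x y hx hy => exact add_mem hx hy

/-- The morphism `⨁ P, Hom (ω P, M) ⟶ ⨁ P, Hom (ω P, N)` given by maps of the summands. -/
def homUModMap {N : Type u} [AddCommGroup N] [Module Aᵐᵒᵖ N]
    (g : ∀ P : 𝒜, (ω.obj P →ₗ[Aᵐᵒᵖ] M) →+ (ω.obj P →ₗ[Aᵐᵒᵖ] N))
    (hg : ∀ (P Q : 𝒜) (t : P ⟶ Q) h, g P (h ∘ₗ (ω.map t).hom) = g Q h ∘ₗ (ω.map t).hom) :
    homUMod ω M ⟶ homUMod ω N :=
  (⟨HomSum.mapSummands g, HomSum.mapSummands_smul g hg⟩ : UMod.Hom (homUMod ω M) (homUMod ω N))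

/-! #### Elementary tensors -/

lemma tmul_one_smul {X : Type u} [AddCommGroup X] [NUModule (CatRing 𝒜)ᵐᵒᵖ X] (x : X) (P : 𝒜)
    (p : ω.obj P) : incl ω (op (one P) • x) P p = incl ω x P p := by
  rw [incl_apply, smul_tmul, one, single_smul_ι, ω.map_id]; rfl

lemma incl_one_smul {X : Type u} [AddCommGroup X] [NUModule (CatRing 𝒜)ᵐᵒᵖ X] (x : X) (P : 𝒜) :
    incl ω (op (one P) • x) P = incl ω x P := LinearMap.ext (tmul_one_smul x P)

lemma incl_single_smul {X : Type u} [AddCommGroup X] [NUModule (CatRing 𝒜)ᵐᵒᵖ X] {P Q : 𝒜}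
    (t : P ⟶ Q) (x : X) :
    incl ω (op (single P Q t : CatRing 𝒜) • x) P = incl ω x Q ∘ₗ (ω.map t).hom := by
  ext p
  rw [incl_apply, smul_tmul, single_smul_ι]; rfl

lemma incl_single_smul_ne {X : Type u} [AddCommGroup X] [NUModule (CatRing 𝒜)ᵐᵒᵖ X] {P P' Q : 𝒜}
    (h : P ≠ P') (t : P ⟶ Q) (x : X) : incl ω (op (single P Q t : CatRing 𝒜) • x) P' = 0 := by
  ext p
  rw [incl_apply, smul_tmul, single_smul_ι_ne h, tmul_zero]; rfl

lemma sdagHom_smul (m : M) (t : CatRing 𝒜) (φ : Sdag ω) :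
    sdagHom m (op t • φ) = op t • sdagHom m φ :=
  HomSum.mapSummands_smul (M := A) (postcomp (orbit m)) (fun _ _ _ _ => rfl) t φ

lemma Comatrix.hom_ext {G : Type*} [AddCommGroup G] {f g : Comatrix ω →+ G}
    (h : ∀ P φ p, f (cmk ω P φ p) = g (cmk ω P φ p)) : f = g := by
  ext z
  induction z using Comatrix.induction with
  | zero => rw [map_zero, map_zero]
  | cmk P φ p => exact h P φ p
  | add x y hx hy => rw [map_add, map_add, hx, hy]

lemma tensor_hom_ext {X : Type u} [AddCommGroup X] [NUModule (CatRing 𝒜)ᵐᵒᵖ X] {G : Type*}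
    [AddCommGroup G] {f g : BTensor (CatRing 𝒜) X (Sig ω) →+ G}
    (h : ∀ x P p, f (incl ω x P p) = g (incl ω x P p)) : f = g := by
  ext z
  induction z using tensor_induction with
  | zero => rw [map_zero, map_zero]
  | incl x P p => exact h x P p
  | add x y hx hy => rw [map_add, map_add, hx, hy]

/-- For `m` in `M`, the map `sdagHom m ⊗_R Σ`. -/
def sdagHomTensor (m : M) : Comatrix ω →+ BTensor (CatRing 𝒜) (HomSum ω M) (Sig ω) :=
  rmap (Sig ω) (sdagHom m) (sdagHom_smul m)

lemma sdagHomTensor_cmk (m : M) (P : 𝒜) (φ : ω.obj P →ₗ[Aᵐᵒᵖ] A) (p : ω.obj P) :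
    sdagHomTensor m (cmk ω P φ p) = incl ω (HomSum.ι P (orbit m ∘ₗ φ)) P p := by
  rw [cmk, sdagHomTensor, rmap_tmul, sdagHom_ι]; rfl

variable (ω M) in
/-- The map `M ⊗_A (Σ† ⊗_R Σ) → (⨁ P, Hom (ω P, M)) ⊗_R Σ`, `m ⊗ (φ ⊗ p) ↦ (q ↦ m φ(q)) ⊗ p`. -/
def homTensorInv : BTensor A M (Comatrix ω) →+ BTensor (CatRing 𝒜) (HomSum ω M) (Sig ω) :=
  lift (AddMonoidHom.mk' sdagHomTensor (fun m n => Comatrix.hom_ext fun P φ p => by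
      rw [AddMonoidHom.add_apply, sdagHomTensor_cmk, sdagHomTensor_cmk, sdagHomTensor_cmk,
        orbit_add, LinearMap.add_comp, map_add, incl_add]; rfl))
    (fun m a c => by
      change sdagHomTensor (op a • m) c = sdagHomTensor m (a • c)
      induction c using Comatrix.induction with
      | zero => rw [smul_zero, map_zero, map_zero]
      | add x y hx hy => rw [smul_add, map_add, map_add, hx, hy]
      | cmk P φ p =>
        rw [smul_cmk, sdagHomTensor_cmk, sdagHomTensor_cmk]
        congr 3
        ext q
        simp [orbit_apply, mul_smul])

lemma homTensorInv_tmul (m : M) (P : 𝒜) (φ : ω.obj P →ₗ[Aᵐᵒᵖ] A) (p : ω.obj P) :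
    homTensorInv ω M (tmul A m (cmk ω P φ p)) = incl ω (HomSum.ι P (orbit m ∘ₗ φ)) P p :=
  sdagHomTensor_cmk m P φ p

variable [∀ P, Module.Finite Aᵐᵒᵖ (ω.obj P)] [∀ P, Module.Projective Aᵐᵒᵖ (ω.obj P)]

/-! #### The isomorphism `(⨁ P, Hom (ω P, M)) ⊗_R Σ ≅ M ⊗_A (Σ† ⊗_R Σ)` -/

/-- The map `s ↦ ∑ P, (x_P ⊗_A (Σ† ⊗_R Σ)) (ρ s_P)`. -/
def homTensorAux (x : HomSum ω M) : Sig ω →+ BTensor A M (Comatrix ω) :=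
  DirectSum.toAddMonoid (fun P => (mapC (Comatrix ω) (HomSum.π P x)).comp
    (coactObj ω P).toAddMonoidHom)

lemma homTensorAux_ι (x : HomSum ω M) (P : 𝒜) (p : ω.obj P) :
    homTensorAux x (Sig.ι ω P p) = mapC (Comatrix ω) (HomSum.π P x) (coactObj ω P p) :=
  DirectSum.toAddMonoid_of _ _ _

variable (ω M) in
/-- The map `(⨁ P, Hom (ω P, M)) ⊗_R Σ → M ⊗_A (Σ† ⊗_R Σ)`, which sends `h ⊗ p` to
`∑ i, h (e i) ⊗ (e* i ⊗ p)` for `p` in `ω P` and `h : ω P → M`. -/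
def homTensor : BTensor (CatRing 𝒜) (HomSum ω M) (Sig ω) →+ BTensor A M (Comatrix ω) :=
  lift (AddMonoidHom.mk' homTensorAux (fun x y => Sig.hom_ext fun P p => by
      rw [AddMonoidHom.add_apply, homTensorAux_ι, homTensorAux_ι, homTensorAux_ι, map_add,
        mapC_add]; rfl))
    (fun x t s => by
      change homTensorAux (op t • x) s = homTensorAux x (t • s)
      induction s using Sig.induction with
      | zero => rw [NUModule.smul_zero', map_zero, map_zero]
      | add s s' h h' => rw [map_add, NUModule.smul_add, map_add, h, h']
      | ι P' p =>
        rw [homTensorAux_ι]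
        induction t using MatRing.induction with
        | zero => rw [op_zero, NUModule.zero_smul', NUModule.zero_smul', map_zero, map_zero,
            mapC_zero]; rfl
        | add t t' h h' => rw [MulOpposite.op_add, NUModule.add_smul, NUModule.add_smul, map_add,
            map_add, mapC_add, AddMonoidHom.add_apply, h, h']
        | single P Q t =>
          by_cases h : P = P'
          · subst h
            rw [HomSum.π_smul, single_smul_ι, homTensorAux_ι, ← coactObj_natural, mapC_mapC]
          · rw [HomSum.π_smul_ne h, single_smul_ι_ne h, map_zero, mapC_zero]; rfl)

lemma homTensor_incl (x : HomSum ω M) (P : 𝒜) (p : ω.obj P) :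
    homTensor ω M (incl ω x P p) = mapC (Comatrix ω) (HomSum.π P x) (coactObj ω P p) :=
  homTensorAux_ι x P p

/-- The dual basis splits `h : ω P → M` as the sum of the rank-one maps `q ↦ h(e_i) e_i*(q)`. Only
the component of `x` at `P` is seen, which is harmless because `x ⊗ p = x (one P) ⊗ p`. -/
lemma homTensorInv_homTensor (z : BTensor (CatRing 𝒜) (HomSum ω M) (Sig ω)) :
    homTensorInv ω M (homTensor ω M z) = z := by
  induction z using tensor_induction with
  | zero => rw [map_zero, map_zero]
  | add x y hx hy => rw [map_add, map_add, hx, hy]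
  | incl x P p =>
    have h : ∑ i, orbit (HomSum.π P x ((dualBasis ω P).e i)) ∘ₗ (dualBasis ω P).e' i =
        HomSum.π P x := by
      ext q
      conv_rhs => rw [← (dualBasis ω P).sum_eq q, map_sum]
      rw [LinearMap.sum_apply]
      exact Finset.sum_congr rfl fun i _ => (map_smul _ _ _).symm
    rw [homTensor_incl, coactObj_apply, map_sum, map_sum]
    simp only [mapC_tmul, homTensorInv_tmul, incl_apply]
    rw [← sum_tmul, ← map_sum, h, ← HomSum.one_smul]
    exact tmul_one_smul x P p

/-- The scalars `φ(e_i)` move across the tensor sign over `A`, and `∑ φ(e_i) e_i* = φ`. -/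
lemma homTensor_homTensorInv (z : BTensor A M (Comatrix ω)) :
    homTensor ω M (homTensorInv ω M z) = z := by
  induction z using BTensor.induction with
  | zero => rw [map_zero, map_zero]
  | add x y hx hy => rw [map_add, map_add, hx, hy]
  | tmul m c =>
    induction c using Comatrix.induction with
    | zero => rw [tmul_zero, map_zero, map_zero]
    | add x y hx hy => rw [tmul_add, map_add, map_add, hx, hy]
    | cmk P φ p =>
      rw [homTensorInv_tmul, homTensor_incl, HomSum.π_ι, coactObj_apply, map_sum]
      simp only [mapC_tmul, LinearMap.comp_apply, orbit_apply, smul_tmul, smul_cmk]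
      rw [← tmul_sum, ← sum_cmk, (dualBasis ω P).sum_dual]

lemma homTensor_injective : Function.Injective (homTensor ω M) :=
  Function.LeftInverse.injective homTensorInv_homTensor

variable (ω M) in
/-- The evaluation `(⨁ P, Hom (ω P, M)) ⊗_R Σ → M`. -/
def evalHom : BTensor (CatRing 𝒜) (HomSum ω M) (Sig ω) →+ M :=
  (runit A M).comp ((lmap M (comatrixCounit ω) comatrixCounit_smul).comp (homTensor ω M))

/-- Defining evaluation through `homTensor` makes it balanced over `R` at no cost; that it evaluates
is the counit axiom of the comodule `ω P`. -/
lemma evalHom_incl (x : HomSum ω M) (P : 𝒜) (p : ω.obj P) :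
    evalHom ω M (incl ω x P p) = HomSum.π P x p := by
  rw [evalHom, AddMonoidHom.comp_apply, AddMonoidHom.comp_apply, homTensor_incl,
    lmap_mapC, runit_mapC]
  exact congrArg _ ((comodObj ω P).counit p)

/-! #### Flatness of `Σ† ⊗_R Σ` -/

/-- If `Σ` is flat over `R`, then `Σ† ⊗_R Σ` is flat over `A`. -/
theorem isFlat_comatrix (hS : NUFlat (CatRing 𝒜) (Sig ω)) : IsFlat A (Comatrix ω) := by
  intro X Y _ _ _ _ f hf
  -- `M ↦ ⨁ P, Hom (ω P, M)` preserves injections, `- ⊗_R Σ` does so by hypothesis, and `homTensor`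
  -- identifies the composite with tensoring by `Comatrix ω` over `A`.
  let g : homUMod ω X ⟶ homUMod ω Y := homUModMap (postcomp f) (fun _ _ _ _ => rfl)
  let G : BTensor (CatRing 𝒜) (HomSum ω X) (Sig ω) →+
    BTensor (CatRing 𝒜) (HomSum ω Y) (Sig ω) := UMod.tensorMap (Sig ω) g
  have hG : Function.Injective G :=
    hS _ _ g (HomSum.mapSummands_postcomp_injective f hf)
  have key : (homTensor ω Y).comp G = (mapC (Comatrix ω) f).comp (homTensor ω X) := by
    refine tensor_hom_ext fun x P p => ?_
    change homTensor ω Y (incl ω (HomSum.mapSummands (postcomp f) x) P p) = _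
    rw [homTensor_incl, AddMonoidHom.comp_apply, homTensor_incl, HomSum.π_mapSummands, mapC_mapC]
    rfl
  have key' : ∀ z, homTensor ω Y (G z) = mapC (Comatrix ω) f (homTensor ω X z) :=
    DFunLike.congr_fun key
  intro z w h
  change mapC _ f z = mapC _ f w at h
  rw [← homTensor_homTensorInv z, ← homTensor_homTensorInv w] at h ⊢
  rw [← key', ← key'] at h
  rw [hG (homTensor_injective h)]

end HomSum

/-! ### Descent -/

section Descent

variable {A : Type u} [Ring A] {𝒜 : Type u} [SmallCategory 𝒜] {ω : 𝒜 ⥤ ModuleCat.{u} Aᵐᵒᵖ}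
variable [Preadditive 𝒜] [ω.Additive]
lemma incl_zero {X : Type u} [AddCommGroup X] [NUModule (CatRing 𝒜)ᵐᵒᵖ X] (P : 𝒜) :
    incl ω (0 : X) P = 0 := LinearMap.ext fun _ => zero_tmul _ _

lemma incl_neg {X : Type u} [AddCommGroup X] [NUModule (CatRing 𝒜)ᵐᵒᵖ X] (x : X) (P : 𝒜) :
    incl ω (-x) P = -incl ω x P := by
  rw [eq_neg_iff_add_eq_zero, ← incl_add, neg_add_cancel, incl_zero]

lemma incl_sub {X : Type u} [AddCommGroup X] [NUModule (CatRing 𝒜)ᵐᵒᵖ X] (x y : X) (P : 𝒜) :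
    incl ω (x - y) P = incl ω x P - incl ω y P := by
  rw [sub_eq_add_neg, incl_add, incl_neg, sub_eq_add_neg]

/-- The family of maps `p ↦ x ⊗ p` depends `R`-linearly on `x`. It need not have finite support, so
it is compared with `y` in `HomSum` component by component. -/
lemma HomSum.π_smul_eq_incl {X : Type u} [AddCommGroup X] [NUModule (CatRing 𝒜)ᵐᵒᵖ X]
    {y : HomSum ω (BTensor (CatRing 𝒜) X (Sig ω))} {x : X} (h : ∀ P, HomSum.π P y = incl ω x P)
    (r : CatRing 𝒜) (P : 𝒜) : HomSum.π P (op r • y) = incl ω (op r • x) P := by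
  induction r using MatRing.induction with
  | zero => rw [op_zero, NUModule.zero_smul', NUModule.zero_smul', map_zero, incl_zero]
  | add r s hr hs =>
    rw [MulOpposite.op_add, NUModule.add_smul, NUModule.add_smul, map_add, hr, hs, incl_add]
  | single Q Q' t =>
    by_cases e : Q = P
    · subst e
      rw [HomSum.π_smul, incl_single_smul, h]
    · rw [HomSum.π_smul_ne e, incl_single_smul_ne e]

lemma HomSum.π_ι_incl {X : Type u} [AddCommGroup X] [NUModule (CatRing 𝒜)ᵐᵒᵖ X] (x : X)
    (P Q : 𝒜) : HomSum.π Q (HomSum.ι P (incl ω x P)) = incl ω (op (one P) • x) Q := by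
  by_cases e : P = Q
  · subst e
    rw [HomSum.π_ι, incl_one_smul]
  · rw [HomSum.π_ι_ne e, one, incl_single_smul_ne e]

lemma tmul_eq_zero_of_incl {X : Type u} [AddCommGroup X] [NUModule (CatRing 𝒜)ᵐᵒᵖ X] {x : X}
    (h : ∀ P : 𝒜, incl ω x P = 0) (s : Sig ω) : tmul (CatRing 𝒜) x s = 0 := by
  induction s using Sig.induction with
  | zero => exact tmul_zero _ _
  | add s s' hs hs' => rw [tmul_add, hs, hs', add_zero]
  | ι P p => exact LinearMap.congr_fun (h P) p

variable (ω) in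
/-- The unit of the adjunction at `X` is injective. -/
def UnitInjective (X : UMod (CatRing 𝒜)) : Prop :=
  ∀ x : X.carrier, (∀ P : 𝒜, incl ω x P = 0) → x = 0

/-- Since `x r ⊗ s = x ⊗ r s`, the morphism `r ↦ x r` out of `R` vanishes after tensoring with `Σ`
as soon as all `x ⊗ p` vanish. Faithfulness makes it zero, and a local unit recovers `x`. -/
theorem unitInjective_of_faithfullyFlat (hS : NUFaithfullyFlat (CatRing 𝒜) (Sig ω))
    (X : UMod (CatRing 𝒜)) : UnitInjective ω X := by
  intro x hx
  have h : regularHom x = UMod.zeroHom (regular 𝒜) X := by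
    refine hS.2 _ _ _ _ (InfComatrix.hom_ext fun r s => ?_)
    refine (smul_tmul x (show CatRing 𝒜 from r) s).trans ?_
    rw [tmul_eq_zero_of_incl hx]
    exact (zero_tmul _ _).symm
  obtain ⟨r, hr⟩ := exists_local_unit X x
  rw [← hr]
  exact congrArg (fun f : regular 𝒜 ⟶ X => UMod.Hom.hom f r) h

/-- This is the core of fullness. Injectivity of the unit at `Y` makes the element `y` attached to
`x` unique, once it works for all `P` together, so `x ↦ y` is automatically additive and `R`-linear.
-/
theorem exists_tensorLin_eq {X Y : UMod (CatRing 𝒜)} (hY : UnitInjective ω Y)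
    (h : BTensor (CatRing 𝒜) X.carrier (Sig ω) →ₗ[Aᵐᵒᵖ] BTensor (CatRing 𝒜) Y.carrier (Sig ω))
    (hh : ∀ (P : 𝒜) (x : X.carrier), ∃ y : Y.carrier, h ∘ₗ incl ω x P = incl ω y P) :
    ∃ f : X ⟶ Y, ∀ z, tensorLin f z = h z := by
  have hu : ∀ y y' : Y.carrier, (∀ P, incl ω y P = incl ω y' P) → y = y' := fun y y' e =>
    sub_eq_zero.1 (hY _ fun P => by rw [incl_sub, e, sub_self])
  have hex : ∀ x : X.carrier, ∃ y : Y.carrier, ∀ P, h ∘ₗ incl ω x P = incl ω y P := by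
    have aux : ∀ (P : 𝒜) (x : X.carrier), ∃ y : Y.carrier, ∀ Q,
        h ∘ₗ incl ω (op (one P) • x) Q = incl ω y Q := by
      intro P x
      obtain ⟨y, hy⟩ := hh P x
      -- The element `y` is only known to be right at `P`; multiplied by the idempotent it is right
      -- at every `Q`, as both sides vanish off `P`. Summing over a local unit of `x` then gives one
      -- element for all objects.
      refine ⟨op (one P) • y, fun Q => ?_⟩
      by_cases e : P = Q
      · subst e
        rw [incl_one_smul, incl_one_smul, hy]
      · rw [one, incl_single_smul_ne e, incl_single_smul_ne e, LinearMap.comp_zero]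
    intro x
    obtain ⟨s, hs⟩ := exists_sum_one_smul X x
    choose y hy using fun P => aux P x
    refine ⟨∑ P ∈ s, y P, fun Q => ?_⟩
    conv_lhs => rw [← hs]
    ext p
    simp only [LinearMap.comp_apply, incl_apply, sum_tmul, map_sum]
    exact Finset.sum_congr rfl fun P _ => LinearMap.congr_fun (hy P Q) p
  choose g hg using hex
  have key : ∀ x s, h (tmul (CatRing 𝒜) x s) = tmul (CatRing 𝒜) (g x) s := fun x s => by
    induction s using Sig.induction with
    | zero => rw [tmul_zero, tmul_zero, map_zero]
    | add s s' hs hs' => rw [tmul_add, tmul_add, ← hs, ← hs', map_add]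
    | ι P p => exact LinearMap.congr_fun (hg x P) p
  have hsmul : ∀ (r : CatRing 𝒜) x, g (op r • x) = op r • g x := fun r x => hu _ _ fun P => by
    ext p
    rw [incl_apply, incl_apply, ← key, smul_tmul, smul_tmul, key]
  let f : X ⟶ Y := (⟨AddMonoidHom.mk' g fun x x' => hu _ _ fun P => by
    rw [← hg, incl_add, incl_add, ← hg, ← hg, LinearMap.comp_add], hsmul⟩ : UMod.Hom X Y)
  refine ⟨f, fun z => ?_⟩
  induction z using tensor_induction with
  | zero => rw [map_zero, map_zero]
  | add z w hz hw => rw [map_add, map_add, hz, hw]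
  | incl x P p => exact (LinearMap.congr_fun (hg x P) p).symm

variable [∀ P, Module.Finite Aᵐᵒᵖ (ω.obj P)] [∀ P, Module.Projective Aᵐᵒᵖ (ω.obj P)]

variable (M : Comod (comatrixCoring ω))

/-- The map `h ↦ ρ_M ∘ h - (h ⊗ C) ∘ ρ_P` for `h : ω P → M`, where `C = Σ† ⊗_R Σ`. -/
def colinDefect (P : 𝒜) : (ω.obj P →ₗ[Aᵐᵒᵖ] M.carrier) →+
    (ω.obj P →ₗ[Aᵐᵒᵖ] BTensor A M.carrier (Comatrix ω)) :=
  AddMonoidHom.mk' (fun h => M.coact ∘ₗ h - mapCLin (Comatrix ω) h ∘ₗ coactObj ω P) (fun h k => by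
    ext p
    simp only [LinearMap.sub_apply, LinearMap.add_apply, LinearMap.comp_apply, mapCLin_apply,
      mapC_add, map_add, AddMonoidHom.add_apply]
    abel)

lemma colinDefect_apply (P : 𝒜) (h : ω.obj P →ₗ[Aᵐᵒᵖ] M.carrier) (p : ω.obj P) :
    colinDefect M P h p = M.coact (h p) - mapC (Comatrix ω) h (coactObj ω P p) := rfl

lemma colinDefect_comp (P Q : 𝒜) (t : P ⟶ Q) (h : ω.obj Q →ₗ[Aᵐᵒᵖ] M.carrier) :
    colinDefect M P (h ∘ₗ (ω.map t).hom) = colinDefect M Q h ∘ₗ (ω.map t).hom := by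
  ext p
  rw [LinearMap.comp_apply, colinDefect_apply, colinDefect_apply, ← coactObj_natural, mapC_mapC]
  rfl

/-- The morphism whose kernel is `⨁ P, Hom_C (ω P, M)`. -/
def colinDefectHom : homUMod ω M.carrier ⟶ homUMod ω (BTensor A M.carrier (Comatrix ω)) :=
  homUModMap (colinDefect M) (colinDefect_comp M)

/-- The subgroup `⨁ P, Hom_C (ω P, M)` of `⨁ P, Hom_A (ω P, M)`, where `C = Σ† ⊗_R Σ`. -/
def colinSub : AddSubgroup (HomSum ω M.carrier) := (HomSum.mapSummands (colinDefect M)).ker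

variable {M}

lemma mem_colinSub {x : HomSum ω M.carrier} : x ∈ colinSub M ↔ ∀ (P : 𝒜) (p : ω.obj P),
    mapC (Comatrix ω) (HomSum.π P x) (coactObj ω P p) = M.coact (HomSum.π P x p) := by
  constructor
  · intro h P p
    have h1 := congrArg (fun y => HomSum.π P y p)
      (show HomSum.mapSummands (colinDefect M) x = 0 from h)
    simp only [HomSum.π_mapSummands, colinDefect_apply, map_zero, LinearMap.zero_apply] at h1
    exact (sub_eq_zero.1 h1).symm
  · intro h
    refine HomSum.ext fun P => LinearMap.ext fun p => ?_
    rw [HomSum.π_mapSummands, colinDefect_apply, h, sub_self, map_zero]; rfl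

lemma ι_mem_colinSub {P : 𝒜} (h : ω.obj P →ₗ[Aᵐᵒᵖ] M.carrier)
    (hh : ∀ p, mapC (Comatrix ω) h (coactObj ω P p) = M.coact (h p)) :
    HomSum.ι P h ∈ colinSub M := by
  refine mem_colinSub.2 fun Q p => ?_
  by_cases e : P = Q
  · subst e
    rw [HomSum.π_ι]
    exact hh p
  · rw [HomSum.π_ι_ne e, mapC_zero, LinearMap.zero_apply, map_zero]; rfl

lemma smul_mem_colinSub (r : (CatRing 𝒜)ᵐᵒᵖ) (x : HomSum ω M.carrier) (hx : x ∈ colinSub M) :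
    r • x ∈ colinSub M := by
  change HomSum.mapSummands (colinDefect M) (op (unop r) • x) = 0
  rw [HomSum.mapSummands_smul _ (colinDefect_comp M),
    show HomSum.mapSummands (colinDefect M) x = 0 from hx, NUModule.smul_zero']

variable (M) in
/-- The right `R`-module `⨁ P, Hom_C (ω P, M)`, where `C = Σ† ⊗_R Σ`. -/
def colinUMod : UMod (CatRing 𝒜) := (homUMod ω M.carrier).sub (colinSub M) smul_mem_colinSub

variable (M) in
/-- The inclusion of `⨁ P, Hom_C (ω P, M)` in `⨁ P, Hom_A (ω P, M)`. -/
def colinι : colinUMod M ⟶ homUMod ω M.carrier :=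
  (homUMod ω M.carrier).subι (colinSub M) smul_mem_colinSub

variable (M) in
/-- The inclusion tensored with `Σ`. -/
def colinTensor : BTensor (CatRing 𝒜) (colinUMod M).carrier (Sig ω) →+
    BTensor (CatRing 𝒜) (HomSum ω M.carrier) (Sig ω) := UMod.tensorMap (Sig ω) (colinι M)

variable (M) in
/-- The component in `Hom_C (ω P, M)` of an element of `⨁ P, Hom_C (ω P, M)`. -/
def colinπ (P : 𝒜) (k : (colinUMod M).carrier) : ω.obj P →ₗ[Aᵐᵒᵖ] M.carrier :=
  HomSum.π P (UMod.Hom.hom (colinι M) k)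

lemma colinπ_colinear (P : 𝒜) (k : (colinUMod M).carrier) (p : ω.obj P) :
    mapC (Comatrix ω) (colinπ M P k) (coactObj ω P p) = M.coact (colinπ M P k p) :=
  mem_colinSub.1 (show UMod.Hom.hom (colinι M) k ∈ colinSub M from k.2) P p

lemma colinTensor_incl (k : (colinUMod M).carrier) (P : 𝒜) (p : ω.obj P) :
    colinTensor M (incl ω k P p) =
      incl ω (show HomSum ω M.carrier from UMod.Hom.hom (colinι M) k) P p := rfl

variable (M) in
/-- The evaluation map `(⨁ P, Hom_C (ω P, M)) ⊗_R Σ → M`. -/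
def counitHom : BTensor (CatRing 𝒜) (colinUMod M).carrier (Sig ω) →+ M.carrier :=
  (evalHom ω M.carrier).comp (colinTensor M)

lemma counitHom_incl (k : (colinUMod M).carrier) (P : 𝒜) (p : ω.obj P) :
    counitHom M (incl ω k P p) = colinπ M P k p := by
  rw [counitHom, AddMonoidHom.comp_apply, colinTensor_incl, evalHom_incl]; rfl

/-- For colinear `h`, `(h ⊗ C) (ρ p) = ρ_M (h p)`. Under `homTensor`, the inclusion of colinear into
linear maps therefore becomes evaluation followed by the coaction of `M`. -/
lemma homTensor_colinTensor (z : BTensor (CatRing 𝒜) (colinUMod M).carrier (Sig ω)) :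
    homTensor ω M.carrier (colinTensor M z) = M.coact (counitHom M z) := by
  induction z using tensor_induction with
  | zero => simp only [map_zero]
  | add x y hx hy => simp only [map_add, hx, hy]
  | incl k P p =>
    rw [colinTensor_incl, homTensor_incl, counitHom_incl]
    exact colinπ_colinear P k p

/-- Flatness keeps `colinTensor M` injective, and its composite with the injective `homTensor`
factors through `counitHom M`. -/
theorem counitHom_injective (hS : NUFlat (CatRing 𝒜) (Sig ω)) :
    Function.Injective (counitHom M) := by
  intro z w h
  have hi : Function.Injective (colinTensor M) := hS _ _ (colinι M) Subtype.val_injective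
  refine hi (homTensor_injective ?_)
  rw [homTensor_colinTensor, homTensor_colinTensor, h]

variable (M) in
/-- The map `colinDefect` tensored with `Σ`. -/
def defectTensor : BTensor (CatRing 𝒜) (HomSum ω M.carrier) (Sig ω) →+
    BTensor (CatRing 𝒜) (HomSum ω (BTensor A M.carrier (Comatrix ω))) (Sig ω) :=
  UMod.tensorMap (Sig ω) (colinDefectHom M)

lemma homTensor_defectTensor_incl (x : HomSum ω M.carrier) (P : 𝒜) (p : ω.obj P) :
    homTensor ω (BTensor A M.carrier (Comatrix ω)) (defectTensor M (incl ω x P p)) =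
      mapC (Comatrix ω) (colinDefect M P (HomSum.π P x)) (coactObj ω P p) :=
  (homTensor_incl (HomSum.mapSummands (colinDefect M) x) P p).trans
    (by rw [HomSum.π_mapSummands])

/-- Under `homTensor`, the colinearity defect tensored with `Σ` becomes the differential `ρ_M ⊗ C -
M ⊗ Δ` on `M ⊗_A C`. -/
lemma assoc_homTensor_defectTensor (z : BTensor (CatRing 𝒜) (HomSum ω M.carrier) (Sig ω)) :
    assoc A M.carrier (Comatrix ω) (Comatrix ω)
      (homTensor ω (BTensor A M.carrier (Comatrix ω)) (defectTensor M z)) =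
      assoc A M.carrier (Comatrix ω) (Comatrix ω)
        (mapC (Comatrix ω) M.coact (homTensor ω M.carrier z)) -
      lmap M.carrier (comatrixCoring ω).comul (comatrixCoring ω).comul_smul
        (homTensor ω M.carrier z) := by
  induction z using tensor_induction with
  | zero => simp only [map_zero, sub_zero]
  | add x y hx hy => simp only [map_add, hx, hy]; abel
  | incl x P p =>
    have h3 := assoc_mapC_defect (HomSum.π P x) (coactObj ω P) M.coact (comatrixCoring ω).comul
      (comatrixCoring ω).comul_smul (coactObj ω P p) (coactObj_coassoc P p)
    exact (congrArg _ (homTensor_defectTensor_incl x P p)).trans (h3.trans (congrArg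
      (fun w => assoc A M.carrier (Comatrix ω) (Comatrix ω) (mapC (Comatrix ω) M.coact w) -
        lmap M.carrier (comatrixCoring ω).comul (comatrixCoring ω).comul_smul w)
      (homTensor_incl x P p).symm))

/-- By coassociativity `ρ_M m` is killed by `ρ_M ⊗ C - M ⊗ Δ`, so its preimage `z` under `homTensor`
is killed by the tensored defect. Flatness lifts `z` to a tensor `w` of colinear maps; evaluation of
`w` has the same coaction as `m`, and the coaction is injective. -/
theorem counitHom_surjective (hS : NUFlat (CatRing 𝒜) (Sig ω)) :
    Function.Surjective (counitHom M) := by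
  intro m
  obtain ⟨z, hz⟩ : ∃ z, homTensor ω M.carrier z = M.coact m := ⟨_, homTensor_homTensorInv _⟩
  have h0 : assoc A M.carrier (Comatrix ω) (Comatrix ω)
      (homTensor ω (BTensor A M.carrier (Comatrix ω)) (defectTensor M z)) = 0 := by
    rw [assoc_homTensor_defectTensor, hz, M.coassoc, sub_self]
  have h0 : UMod.tensorMap (Sig ω) (colinDefectHom M) z = 0 :=
    (injective_iff_map_eq_zero _).1 homTensor_injective _
      ((injective_iff_map_eq_zero _).1 (assoc_injective _ _ _ _) _ h0)
  have h1 : z ∈ (colinTensor M).range := by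
    refine (AddSubgroup.closure_le _).2 ?_ (hS.mem_kerTensor (colinDefectHom M) h0)
    rintro _ ⟨k, s, hk, rfl⟩
    let k' : (colinUMod M).carrier := ⟨k, hk⟩
    exact ⟨tmul (CatRing 𝒜) k' s, rfl⟩
  obtain ⟨w, hw⟩ := h1
  refine ⟨w, M.coact_injective ?_⟩
  rw [← homTensor_colinTensor, hw, hz]

variable (M) in
/-- The evaluation map as a right `A`-linear map. -/
def counitLin : BTensor (CatRing 𝒜) (colinUMod M).carrier (Sig ω) →ₗ[Aᵐᵒᵖ] M.carrier :=
  { counitHom M with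
    map_smul' := fun a z => by
      change counitHom M (a • z) = a • counitHom M z
      induction z using tensor_induction with
      | zero => rw [smul_zero, map_zero, smul_zero]
      | add x y hx hy => rw [smul_add, map_add, map_add, smul_add, hx, hy]
      | incl k P p => rw [← map_smul, counitHom_incl, counitHom_incl, map_smul] }

lemma counitLin_comp_incl (k : (colinUMod M).carrier) (P : 𝒜) :
    counitLin M ∘ₗ incl ω k P = colinπ M P k := LinearMap.ext (counitHom_incl k P)

variable (M) in
/-- The evaluation morphism `(⨁ P, Hom_C (ω P, M)) ⊗_R Σ ⟶ M`. -/
def counitComod : tensorObj ω (colinUMod M) ⟶ M :=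
  ⟨counitLin M, fun z => by
    change mapC (Comatrix ω) (counitLin M) (coactTensor ω _ z) = M.coact (counitLin M z)
    induction z using tensor_induction with
    | zero => simp only [map_zero]
    | add x y hx hy => simp only [map_add, hx, hy]
    | incl k P p =>
      rw [coactTensor_incl, mapC_mapC, counitLin_comp_incl, colinπ_colinear,
        ← counitLin_comp_incl]
      rfl⟩

theorem counitComod_bijective (hS : NUFlat (CatRing 𝒜) (Sig ω)) :
    Function.Bijective (counitComod M).1 :=
  ⟨counitHom_injective hS, counitHom_surjective hS⟩

/-! #### Comodule morphisms from `ω P` to `X ⊗_R Σ` -/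

/-- The comodule morphism `p ↦ x ⊗ p`. -/
def inclComod (X : UMod (CatRing 𝒜)) (x : X.carrier) (P : 𝒜) : comodObj ω P ⟶ tensorObj ω X :=
  ⟨incl ω x P, fun p => (coactTensor_incl x P p).symm⟩

variable (ω) in
/-- The unit of the adjunction at `X` is surjective. -/
def UnitSurjective (X : UMod (CatRing 𝒜)) : Prop :=
  ∀ (P : 𝒜) (h : comodObj ω P ⟶ tensorObj ω X), ∃ x : X.carrier, h = inclComod X x P

variable (ω) in
/-- The elements of `⨁ P, Hom_C (ω P, X ⊗_R Σ)` in the image of `X`. -/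
def unitImage (X : UMod (CatRing 𝒜)) : AddSubgroup (colinUMod (tensorObj ω X)).carrier where
  carrier := {k | ∃ x : X.carrier, ∀ P, colinπ (tensorObj ω X) P k = incl ω x P}
  zero_mem' := ⟨0, fun P => (incl_zero P).symm⟩
  add_mem' := by
    rintro k k' ⟨x, hx⟩ ⟨x', hx'⟩
    exact ⟨x + x', fun P => by rw [incl_add, ← hx, ← hx']; rfl⟩
  neg_mem' := by
    rintro k ⟨x, hx⟩
    exact ⟨-x, fun P => by rw [incl_neg, ← hx]; rfl⟩

lemma smul_mem_unitImage (X : UMod (CatRing 𝒜)) (r : (CatRing 𝒜)ᵐᵒᵖ)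
    (k : (colinUMod (tensorObj ω X)).carrier) (hk : k ∈ unitImage ω X) :
    r • k ∈ unitImage ω X := by
  obtain ⟨x, hx⟩ := hk
  exact ⟨r • x, fun P => HomSum.π_smul_eq_incl hx (unop r) P⟩

/-- The tensor `x ⊗ p` is the evaluation of the map `q ↦ x ⊗ q` at `p`, and this map lies in the
image of `X`. So every `w` is reached by tensors that die in the quotient by that image. -/
lemma exists_unitImage_tensor (X : UMod (CatRing 𝒜)) (w : BTensor (CatRing 𝒜) X.carrier (Sig ω)) :
    ∃ z, UMod.tensorMap (Sig ω)
      ((colinUMod (tensorObj ω X)).quotMk (unitImage ω X) (smul_mem_unitImage X)) z = 0 ∧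
      counitHom (tensorObj ω X) z = w := by
  induction w using tensor_induction with
  | zero => exact ⟨0, map_zero _, map_zero _⟩
  | add w w' hw hw' =>
    obtain ⟨z, hz, h⟩ := hw
    obtain ⟨z', hz', h'⟩ := hw'
    exact ⟨z + z', by rw [map_add, hz, hz', add_zero],
      (map_add (counitHom (tensorObj ω X)) z z').trans (congrArg₂ (· + ·) h h')⟩
  | incl x P p =>
    let k : (colinUMod (tensorObj ω X)).carrier :=
      ⟨HomSum.ι P (incl ω x P), ι_mem_colinSub (M := tensorObj ω X) (incl ω x P)
        (fun p => (coactTensor_incl x P p).symm)⟩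
    have hk : k ∈ unitImage ω X := ⟨op (one P) • x, fun Q => HomSum.π_ι_incl x P Q⟩
    refine ⟨incl ω k P p, ?_, ?_⟩
    · refine (UMod.tensorMap_tmul (Sig ω) _ k _).trans ?_
      rw [UMod.quotMk_eq_zero.2 hk]
      exact zero_tmul _ _
    · refine (counitHom_incl k P p).trans ?_
      exact LinearMap.congr_fun (HomSum.π_ι P (incl ω x P)) p

/-- Evaluation is injective and tensors coming from `X` already reach all its values, so no other
tensors exist: projection to the quotient by the image of `X` vanishes after `- ⊗_R Σ`. By
faithfulness it is zero, so the image of `X` is everything. -/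
theorem unitSurjective_of_faithfullyFlat (hS : NUFaithfullyFlat (CatRing 𝒜) (Sig ω))
    (X : UMod (CatRing 𝒜)) : UnitSurjective ω X := by
  have hq : (colinUMod (tensorObj ω X)).quotMk (unitImage ω X) (smul_mem_unitImage X) =
      UMod.zeroHom _ _ := by
    refine hS.2 _ _ _ _ (AddMonoidHom.ext fun z => ?_)
    obtain ⟨z', hz', h⟩ := exists_unitImage_tensor X (counitHom (tensorObj ω X) z)
    rw [← counitHom_injective hS.1 h, hz']
    exact (DFunLike.congr_fun (hom_ext (g := 0) fun k s => zero_tmul _ s) z').symm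
  intro P h
  let k : (colinUMod (tensorObj ω X)).carrier := ⟨HomSum.ι P h.1, ι_mem_colinSub h.1 h.2⟩
  have hk : k ∈ unitImage ω X :=
    UMod.quotMk_eq_zero.1 (congrArg (fun f => UMod.Hom.hom f k) hq)
  obtain ⟨x, hx⟩ := hk
  exact ⟨x, Subtype.ext ((HomSum.π_ι P h.1).symm.trans (hx P))⟩

/-! #### The equivalence -/

theorem tensorFunctor_full (h₁ : ∀ X : UMod (CatRing 𝒜), UnitInjective ω X)
    (h₂ : ∀ X : UMod (CatRing 𝒜), UnitSurjective ω X) : (tensorFunctor ω).Full where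
  map_surjective {X Y} h := by
    obtain ⟨f, hf⟩ := exists_tensorLin_eq (h₁ Y) h.1 fun P x => by
      obtain ⟨y, hy⟩ := h₂ Y P (inclComod X x P ≫ h)
      exact ⟨y, congrArg Subtype.val hy⟩
    exact ⟨f, Comod.hom_ext hf⟩

theorem tensorFunctor_isEquivalence (hS : NUFaithfullyFlat (CatRing 𝒜) (Sig ω)) :
    (tensorFunctor ω).IsEquivalence where
  faithful := ⟨fun {X Y} f g h => hS.2 X Y f g
    (congrArg (fun k : tensorObj ω X ⟶ tensorObj ω Y => k.1.toAddMonoidHom) h)⟩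
  full := tensorFunctor_full (unitInjective_of_faithfullyFlat hS)
    (unitSurjective_of_faithfullyFlat hS)
  essSurj := ⟨fun M => ⟨colinUMod M,
    ⟨Comod.isoOfBijective (counitComod M) (counitComod_bijective hS.1)⟩⟩⟩

end Descent

/-! ### Flatness of `S` and of `Σ` -/

section Factor

variable {R : Type u} [NonUnitalRing R] {N N' : Type u} [AddCommGroup N] [NUModule R N]
  [AddCommGroup N'] [NUModule R N'] {κ : Type*} {ev : κ → N' →+ N} {τ : κ → N →+ N'}

lemma tensorMap_lmap {X Y : UMod R} (f : X ⟶ Y) (g : N →+ N')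
    (hg : ∀ (r : R) n, g (r • n) = r • g n) (z : BTensor R X.carrier N) :
    UMod.tensorMap N' f (lmap X.carrier g hg z) = lmap Y.carrier g hg (UMod.tensorMap N f z) := by
  induction z using BTensor.induction with
  | zero => simp only [map_zero]
  | add x y hx hy => simp only [map_add, hx, hy]
  | tmul x n => rfl

/-- A tensor involves only finitely many elements of `N'`, so a locally finite decomposition of the
identity of `N'` passes to `X ⊗ N'`. -/
lemma exists_finset_sum_lmap (hev : ∀ k (r : R) n, ev k (r • n) = r • ev k n)
    (hτ : ∀ k (r : R) n, τ k (r • n) = r • τ k n)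
    (h : ∀ n, ∃ s : Finset κ, ∀ s', s ⊆ s' → ∑ k ∈ s', τ k (ev k n) = n)
    {X : Type u} [AddCommGroup X] [NUModule Rᵐᵒᵖ X] (z : BTensor R X N') :
    ∃ s : Finset κ, ∀ s', s ⊆ s' →
      ∑ k ∈ s', lmap X (τ k) (hτ k) (lmap X (ev k) (hev k) z) = z := by
  induction z using BTensor.induction with
  | zero => exact ⟨∅, fun s' _ => by simp only [map_zero, Finset.sum_const_zero]⟩
  | add z w hz hw =>
    obtain ⟨s, hs⟩ := hz
    obtain ⟨s', hs'⟩ := hw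
    refine ⟨s ∪ s', fun t ht => ?_⟩
    simp only [map_add, Finset.sum_add_distrib, hs t (Finset.union_subset_left ht),
      hs' t (Finset.union_subset_right ht)]
  | tmul x n =>
    obtain ⟨s, hs⟩ := h n
    refine ⟨s, fun t ht => ?_⟩
    simp only [lmap_tmul]
    rw [← tmul_sum, hs t ht]

/-- If the identity of `N'` is locally a finite sum of maps that factor through `N`, then `N'` is
flat if `N` is. -/
theorem NUFlat.of_factor (hev : ∀ k (r : R) n, ev k (r • n) = r • ev k n)
    (hτ : ∀ k (r : R) n, τ k (r • n) = r • τ k n)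
    (h : ∀ n, ∃ s : Finset κ, ∀ s', s ⊆ s' → ∑ k ∈ s', τ k (ev k n) = n) (hN : NUFlat R N) :
    NUFlat R N' := by
  intro X Y f hf
  refine (injective_iff_map_eq_zero _).2 fun z hz => ?_
  obtain ⟨s, hs⟩ := exists_finset_sum_lmap hev hτ h z
  rw [← hs s subset_rfl]
  refine Finset.sum_eq_zero fun k _ => ?_
  have h0 : lmap X.carrier (ev k) (hev k) z = 0 := by
    refine (injective_iff_map_eq_zero _).1 (hN X Y f hf) _ ?_
    rw [tensorMap_lmap, hz, map_zero]
  rw [h0, map_zero]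

lemma tensorMap_eq_of_factor (hev : ∀ k (r : R) n, ev k (r • n) = r • ev k n)
    (hτ : ∀ k (r : R) n, τ k (r • n) = r • τ k n)
    (h : ∀ n, ∃ s : Finset κ, ∀ s', s ⊆ s' → ∑ k ∈ s', τ k (ev k n) = n) {X Y : UMod R}
    {f g : X ⟶ Y} (hfg : UMod.tensorMap N f = UMod.tensorMap N g) :
    UMod.tensorMap N' f = UMod.tensorMap N' g := by
  ext z
  obtain ⟨s, hs⟩ := exists_finset_sum_lmap hev hτ h z
  rw [← hs s subset_rfl, map_sum, map_sum]
  refine Finset.sum_congr rfl fun k _ => ?_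
  rw [tensorMap_lmap f (τ k), hfg, tensorMap_lmap g (τ k)]

end Factor

/-! ### Comparison of `S` and `Σ` by evaluations and rank-one maps -/

section LinRing

variable {A : Type u} [Ring A] {𝒜 : Type u} [SmallCategory 𝒜] {ω : 𝒜 ⥤ ModuleCat.{u} Aᵐᵒᵖ}

/-- The evaluation of linear maps, as a biadditive map. -/
def linAct (P Q : 𝒜) : (ω.obj P ⟶ ω.obj Q) →+ ω.obj P →+ ω.obj Q :=
  AddMonoidHom.mk' (fun t => t.hom.toAddMonoidHom) (fun _ _ => rfl)

/-- The element of `S` with the single entry `f`. -/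
def LinRing.single (P Q : 𝒜) : (ω.obj P ⟶ ω.obj Q) →+ LinRing ω :=
  InfComatrix.single (F := fun P : 𝒜 => ω.obj P) P Q

@[elab_as_elim]
lemma LinRing.induction {p : LinRing ω → Prop} (t : LinRing ω) (zero : p 0)
    (single : ∀ P Q f, p (LinRing.single P Q f)) (add : ∀ x y, p x → p y → p (x + y)) : p t :=
  MatRing.induction t zero single add

/-- The action of `S` on `Σ`. -/
def sigEnd (s : LinRing ω) : Sig ω →+ Sig ω := leftAct (F := fun P : 𝒜 => ω.obj P) linAct s

lemma sigEnd_add (s t : LinRing ω) : sigEnd (s + t) = sigEnd s + sigEnd t := leftAct_add _ _ _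

lemma sigEnd_zero : sigEnd (0 : LinRing ω) = 0 := by
  have h := sigEnd_add (0 : LinRing ω) 0
  rwa [add_zero, left_eq_add] at h

lemma sigEnd_mul (s t : LinRing ω) (x : Sig ω) : sigEnd (s * t) x = sigEnd s (sigEnd t x) :=
  DFunLike.congr_fun (leftAct_mul (F := fun P : 𝒜 => ω.obj P) linAct
    (fun _ _ _ _ _ _ => rfl) s t) x

/-- The map `S → Σ`, `s ↦ s p`, for `p` in `ω P`. -/
def evalLin (P : 𝒜) (p : ω.obj P) : LinRing ω →+ Sig ω :=
  AddMonoidHom.mk' (fun s => sigEnd s (Sig.ι ω P p))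
    (fun s t => DFunLike.congr_fun (sigEnd_add s t) _)

lemma evalLin_apply (P : 𝒜) (p : ω.obj P) (s : LinRing ω) :
    evalLin P p s = sigEnd s (Sig.ι ω P p) := rfl

lemma evalLin_single {P Q : 𝒜} (f : ω.obj P ⟶ ω.obj Q) (p : ω.obj P) :
    evalLin P p (LinRing.single P Q f) = Sig.ι ω Q (f.hom p) :=
  leftAct_single (F := fun P : 𝒜 => ω.obj P) linAct f p

lemma evalLin_single_ne {P P' Q : 𝒜} (h : P ≠ P') (f : ω.obj P ⟶ ω.obj Q) (p : ω.obj P') :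
    evalLin P' p (LinRing.single P Q f) = 0 :=
  leftAct_single_ne (F := fun P : 𝒜 => ω.obj P) linAct h f p

/-- The map `Σ → S`, which sends `q` in `ω Q` to `p ↦ q φ(p)`, for `φ` in `(ω P)*`. -/
def rankOne (P : 𝒜) (φ : ω.obj P →ₗ[Aᵐᵒᵖ] A) : Sig ω →+ LinRing ω :=
  DirectSum.toAddMonoid (fun Q => AddMonoidHom.mk'
    (fun q : ω.obj Q => LinRing.single P Q (ModuleCat.ofHom (orbit q ∘ₗ φ)))
    (fun q q' => by
      rw [← map_add, orbit_add, LinearMap.add_comp]; rfl))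

lemma rankOne_ι (P : 𝒜) (φ : ω.obj P →ₗ[Aᵐᵒᵖ] A) (Q : 𝒜) (q : ω.obj Q) :
    rankOne P φ (Sig.ι ω Q q) = LinRing.single P Q (ModuleCat.ofHom (orbit q ∘ₗ φ)) :=
  DirectSum.toAddMonoid_of _ _ _

/-- The composite `Σ → S → Σ` is right multiplication by the scalar `φ p`. Anything in `X ⊗_R Σ`
that dies in `X ⊗_R S` under a rank-one map is thus annihilated by such scalars. -/
lemma evalLin_rankOne (P : 𝒜) (φ : ω.obj P →ₗ[Aᵐᵒᵖ] A) (p : ω.obj P) (s : Sig ω) :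
    evalLin P p (rankOne P φ s) = op (φ p) • s := by
  induction s using Sig.induction with
  | zero => rw [map_zero, map_zero, smul_zero]
  | add s t hs ht => rw [map_add, map_add, smul_add, hs, ht]
  | ι Q q => rw [rankOne_ι, evalLin_single, ← map_smul]; rfl

/-- Each entry `f` with source `ω P` equals `∑ f(e_i) e_i*`, and an element of `S` has finitely many
entries. So the identity of `S` is locally a finite sum of maps through `Σ`. -/
lemma exists_finset_evalLin (d : ∀ P : 𝒜, DualBasis A (ω.obj P)) (t : LinRing ω) :
    ∃ s : Finset (Σ P, Fin (d P).n), ∀ s', s ⊆ s' →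
      ∑ k ∈ s', rankOne k.1 ((d k.1).e' k.2) (evalLin k.1 ((d k.1).e k.2) t) = t := by
  induction t using LinRing.induction with
  | zero => exact ⟨∅, fun s' _ => by simp only [map_zero, Finset.sum_const_zero]⟩
  | add z w hz hw =>
    obtain ⟨s, hs⟩ := hz
    obtain ⟨s', hs'⟩ := hw
    refine ⟨s ∪ s', fun t ht => ?_⟩
    simp only [map_add, Finset.sum_add_distrib, hs t (Finset.union_subset_left ht),
      hs' t (Finset.union_subset_right ht)]
  | single P Q f =>
    refine ⟨Finset.univ.map (Function.Embedding.sigmaMk P), fun s' hs' => ?_⟩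
    rw [← Finset.sum_subset hs', Finset.sum_map]
    · change ∑ i, rankOne P ((d P).e' i) (evalLin P ((d P).e i) (LinRing.single P Q f)) = _
      simp only [evalLin_single, rankOne_ι]
      rw [← map_sum]
      congr 1
      apply ModuleCat.hom_ext
      ext p
      rw [ModuleCat.hom_sum, LinearMap.sum_apply]
      conv_rhs => rw [← (d P).sum_eq p, map_sum]
      exact Finset.sum_congr rfl fun i _ => (map_smul _ _ _).symm
    · rintro ⟨P', i⟩ _ hk
      have h : P ≠ P' := by
        rintro rfl
        exact hk (Finset.mem_map.2 ⟨i, Finset.mem_univ i, rfl⟩)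
      rw [evalLin_single_ne h, map_zero]

variable [Preadditive 𝒜] [ω.Additive]

lemma toLinRing_single {P Q : 𝒜} (t : P ⟶ Q) :
    toLinRing ω (single P Q t) = LinRing.single P Q (ω.map t) :=
  MatRing.map_single (fun P : 𝒜 => P) ω P Q t

lemma evalLin_smul (P : 𝒜) (p : ω.obj P) (r : CatRing 𝒜) (s : LinRing ω) :
    evalLin P p (r • s) = r • evalLin P p s := by
  have h : ∀ x : Sig ω, sigEnd (toLinRing ω r) x = r • x := by
    intro x
    induction r using MatRing.induction with
    | zero => rw [NUModule.zero_smul', map_zero, sigEnd_zero]; rfl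
    | add r r' hr hr' =>
      rw [NUModule.add_smul, map_add, ← hr, ← hr', sigEnd_add, AddMonoidHom.add_apply]
    | single P Q t =>
      rw [toLinRing_single]
      induction x using Sig.induction with
      | zero => rw [map_zero, NUModule.smul_zero']
      | add x y hx hy => rw [NUModule.smul_add, ← hx, ← hy, map_add]
      | ι P' p =>
        by_cases e : P = P'
        · subst e
          rw [single_smul_ι, ← evalLin_apply, evalLin_single]
        · rw [single_smul_ι_ne e, ← evalLin_apply, evalLin_single_ne e]
  rw [← h]
  change sigEnd (toLinRing ω r * s) (Sig.ι ω P p) = sigEnd (toLinRing ω r) (sigEnd s (Sig.ι ω P p))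
  exact sigEnd_mul (toLinRing ω r) s (Sig.ι ω P p)

lemma rankOne_smul (P : 𝒜) (φ : ω.obj P →ₗ[Aᵐᵒᵖ] A) (r : CatRing 𝒜) (x : Sig ω) :
    rankOne P φ (r • x) = r • rankOne P φ x := by
  induction r using MatRing.induction with
  | zero => rw [NUModule.zero_smul', NUModule.zero_smul', map_zero]
  | add r r' hr hr' => rw [NUModule.add_smul, NUModule.add_smul, map_add, hr, hr']
  | single P' Q t =>
    induction x using Sig.induction with
    | zero => rw [map_zero, NUModule.smul_zero', NUModule.smul_zero', map_zero]
    | add x y hx hy => rw [NUModule.smul_add, map_add, map_add, NUModule.smul_add, hx, hy]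
    | ι Q' q =>
      rw [rankOne_ι]
      change _ = toLinRing ω _ * _
      rw [toLinRing_single]
      by_cases e : P' = Q'
      · subst e
        rw [single_smul_ι, rankOne_ι]
        refine Eq.trans ?_ (single_mul_single (F := fun P : 𝒜 => ω.obj P) _ _).symm
        refine congrArg (LinRing.single P Q) (ModuleCat.hom_ext (LinearMap.ext fun p => ?_))
        exact (map_smul (ω.map t).hom _ _).symm
      · rw [single_smul_ι_ne e, map_zero]
        exact (single_mul_single_ne (F := fun P : 𝒜 => ω.obj P) e _ _).symm

variable [∀ P, Module.Finite Aᵐᵒᵖ (ω.obj P)] [∀ P, Module.Projective Aᵐᵒᵖ (ω.obj P)]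

theorem nuFlat_linRing (hS : NUFlat (CatRing 𝒜) (Sig ω)) : NUFlat (CatRing 𝒜) (LinRing ω) :=
  hS.of_factor (ev := fun k : Σ P, Fin (dualBasis ω P).n => evalLin k.1 ((dualBasis ω k.1).e k.2))
    (fun _ => evalLin_smul _ _) (fun _ => rankOne_smul _ _) (exists_finset_evalLin (dualBasis ω))

/-- Evaluation at `p` sends `x ⊗ id` in `X ⊗ S` to `x ⊗ p`, so `X ⊗ S` determines maps on `X ⊗ Σ`;
conversely the identity of `S` locally factors through `Σ`. Flatness plays no role in either
direction. -/
theorem tensorMap_linRing_eq_iff {X Y : UMod (CatRing 𝒜)} {f g : X ⟶ Y} :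
    UMod.tensorMap (LinRing ω) f = UMod.tensorMap (LinRing ω) g ↔
      UMod.tensorMap (Sig ω) f = UMod.tensorMap (Sig ω) g := by
  constructor
  · intro h
    refine tensor_hom_ext fun x P p => ?_
    have e : incl ω x P p = lmap X.carrier (evalLin P p) (evalLin_smul P p)
        (tmul (CatRing 𝒜) x (LinRing.single P P (𝟙 _))) := by
      rw [lmap_tmul, evalLin_single]; rfl
    rw [e, tensorMap_lmap, tensorMap_lmap, h]
  · exact tensorMap_eq_of_factor (fun _ => evalLin_smul _ _) (fun _ => rankOne_smul _ _)
      (exists_finset_evalLin (dualBasis ω))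

theorem nuFaithfullyFlat_linRing_iff (hS : NUFlat (CatRing 𝒜) (Sig ω)) :
    NUFaithfullyFlat (CatRing 𝒜) (LinRing ω) ↔ NUFaithfullyFlat (CatRing 𝒜) (Sig ω) := by
  simp only [NUFaithfullyFlat, hS, nuFlat_linRing hS, tensorMap_linRing_eq_iff]

/-- If `Σ† ⊗_R Σ` is flat over `A` and `S` is flat over `R`, then `Σ` is flat over `R`. -/
theorem nuFlat_sig_of_linRing (hC : IsFlat A (Comatrix ω)) (hS : NUFlat (CatRing 𝒜) (LinRing ω)) :
    NUFlat (CatRing 𝒜) (Sig ω) := by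
  intro X Y f hf
  -- Rank-one maps send `k` into the kernel of `f ⊗ S`, which is zero, so evaluating gives `k φ(p) =
  -- 0` for all `φ` and `p`. Writing `φ = ∑ φ(e_i) e_i*` moves such a scalar next to `k` in `k ⊗ (φ
  -- ⊗ p)`.
  have hk : ∀ k, tensorLin (ω := ω) f k = 0 → ∀ c : Comatrix ω, tmul A k c = 0 := by
    intro k hk
    have hz : ∀ (P : 𝒜) (φ : ω.obj P →ₗ[Aᵐᵒᵖ] A) (p : ω.obj P), op (φ p) • k = 0 := by
      intro P φ p
      have h0 : lmap X.carrier (rankOne P φ) (rankOne_smul P φ) k = 0 := by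
        refine (injective_iff_map_eq_zero _).1 (hS X Y f hf) _ ?_
        rw [tensorMap_lmap, show UMod.tensorMap (Sig ω) f k = 0 from hk, map_zero]
      have h1 : (lmap X.carrier (evalLin P p) (evalLin_smul P p)).comp
          (lmap X.carrier (rankOne P φ) (rankOne_smul P φ)) =
          DistribSMul.toAddMonoidHom _ (op (φ p)) :=
        hom_ext fun x s => congrArg (tmul (CatRing 𝒜) x) (evalLin_rankOne P φ p s)
      have h2 := DFunLike.congr_fun h1 k
      rw [AddMonoidHom.comp_apply, h0, map_zero] at h2
      exact h2.symm
    intro c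
    induction c using Comatrix.induction with
    | zero => exact tmul_zero _ _
    | add c d hc hd => rw [tmul_add, hc, hd, add_zero]
    | cmk P φ p =>
      rw [← (dualBasis ω P).sum_dual φ, sum_cmk, tmul_sum]
      refine Finset.sum_eq_zero fun i _ => ?_
      rw [← smul_cmk, ← smul_tmul, hz, zero_tmul]
  refine (injective_iff_map_eq_zero _).2 fun z hz => ?_
  -- Flatness of `Comatrix ω` places the coaction of `z` in the span of the tensors `k ⊗ c` with `k`
  -- in the kernel; these all vanish, and the coaction is injective.
  have h0 : mapC (Comatrix ω) (tensorLin f) (coactTensor ω X.carrier z) = 0 := by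
    rw [tensorLin_colinear, show tensorLin f z = 0 from hz, map_zero]
  have h1 := hC.mem_kerTensor (tensorLin f) h0
  have h2 : coactTensor ω X.carrier z = 0 := by
    refine (AddSubgroup.closure_le ⊥).2 ?_ h1
    rintro _ ⟨k, c, h, rfl⟩
    exact hk k h c
  exact (tensorObj ω X).coact_injective (h2.trans (map_zero (tensorObj ω X).coact).symm)

end LinRing

/-! ### From an equivalence to faithful flatness -/

section Equivalence

variable {A : Type u} [Ring A] {𝒜 : Type u} [SmallCategory 𝒜] {ω : 𝒜 ⥤ ModuleCat.{u} Aᵐᵒᵖ}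
variable [Preadditive 𝒜] [ω.Additive]
variable [∀ P, Module.Finite Aᵐᵒᵖ (ω.obj P)] [∀ P, Module.Projective Aᵐᵒᵖ (ω.obj P)]

/-- Injective maps of unital modules are monomorphisms, an equivalence preserves these, and over a
flat coring monomorphisms are injective. -/
theorem nuFaithfullyFlat_of_isEquivalence (hC : IsFlat A (Comatrix ω))
    [(tensorFunctor ω).IsEquivalence] : NUFaithfullyFlat (CatRing 𝒜) (Sig ω) := by
  refine ⟨fun X Y f hf => ?_, fun X Y f g h => ?_⟩
  · have := UMod.mono_of_injective f hf
    exact Comod.injective_of_mono hC ((tensorFunctor ω).map f)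
  · exact (tensorFunctor ω).map_injective (Comod.hom_ext fun z => DFunLike.congr_fun h z)

end Equivalence

/-! ### From small projective generators to faithful flatness -/

section Generators

variable {ι : Type u} {𝒞 : Type w} [Category.{u} 𝒞] [Preadditive 𝒞] {F : ι → 𝒞}

/-- Each `F i` is a retract of the projective coproduct, by the map that is the identity on the
summand `i` and zero on the others. -/
lemma IsGeneratingSetOfSmallProjectives.projective (h : IsGeneratingSetOfSmallProjectives F)
    (i : ι) : Projective (F i) := by
  obtain ⟨-, c, ⟨hc⟩, hp, -⟩ := h
  let r : c.pt ⟶ F i := Limits.Cofan.IsColimit.desc hc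
    (fun j => if e : j = i then eqToHom (congrArg F e) else 0)
  have hr : c.inj i ≫ r = 𝟙 (F i) := by
    rw [Limits.Cofan.IsColimit.fac, dif_pos rfl, eqToHom_refl]
  refine ⟨fun {E X} f e _ => ⟨c.inj i ≫ Projective.factorThru (r ≫ f) e, ?_⟩⟩
  rw [Category.assoc, Projective.factorThru_comp, ← Category.assoc, hr, Category.id_comp]

/-- Maps out of the coproduct are determined on the summands, so testing against the separator
reduces to testing against the `F i`. -/
lemma IsGeneratingSetOfSmallProjectives.eq_zero (h : IsGeneratingSetOfSmallProjectives F)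
    {X Y : 𝒞} (f : X ⟶ Y) (hf : ∀ (i : ι) (g : F i ⟶ X), g ≫ f = 0) : f = 0 := by
  obtain ⟨-, c, ⟨hc⟩, -, hs⟩ := h
  refine hs.def f 0 fun g => ?_
  refine Limits.Cofan.IsColimit.hom_ext hc _ _ fun i => ?_
  rw [← Category.assoc, hf, Limits.comp_zero, Limits.comp_zero]

/-- The entry of an element of `MatRing F` with given source and target. -/
def matEntry (P Q : ι) : MatRing F →+ (F P ⟶ F Q) := (entry P Q).comp (row P)

lemma matEntry_single (P Q : ι) (f : F P ⟶ F Q) : matEntry P Q (single P Q f) = f := by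
  rw [matEntry, AddMonoidHom.comp_apply, row_single_same, entry_of_same]

lemma matEntry_single_ne {P P' : ι} (h : P ≠ P') (Q Q' : ι) (f : F P ⟶ F Q) :
    matEntry P' Q' (single P Q f) = 0 := by
  rw [matEntry, AddMonoidHom.comp_apply, row_single_ne h, map_zero]

lemma matEntry_single_ne' (P P' : ι) {Q Q' : ι} (h : Q ≠ Q') (f : F P ⟶ F Q) :
    matEntry P' Q' (single P Q f) = 0 := by
  by_cases e : P = P'
  · subst e
    rw [matEntry, AddMonoidHom.comp_apply, row_single_same, entry_of_ne _ h]
  · exact matEntry_single_ne e _ _ _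

lemma MatRing.ext_entry {s t : MatRing F} (h : ∀ P Q, matEntry P Q s = matEntry P Q t) : s = t :=
  MatRing.ext_row fun P => DirectSum.ext fun Q => h P Q

variable {𝒟 : Type*} [Category.{u} 𝒟] [Preadditive 𝒟] (G : 𝒞 ⥤ 𝒟) [G.Additive]

lemma matEntry_map (t : MatRing F) (P Q : ι) :
    matEntry P Q (MatRing.map F G t) = G.map (matEntry P Q t) := by
  induction t using MatRing.induction with
  | zero => rw [map_zero, map_zero, map_zero, G.map_zero]
  | add s t hs ht => rw [map_add, map_add, map_add, G.map_add, hs, ht]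
  | single P' Q' f =>
    refine (congrArg (matEntry P Q) (MatRing.map_single F G P' Q' f)).trans ?_
    by_cases h : P' = P
    · by_cases h' : Q' = Q
      · subst h h'
        exact (matEntry_single (F := fun P => G.obj (F P)) _ _ _).trans
          (congrArg G.map (matEntry_single _ _ f)).symm
      · exact (matEntry_single_ne' (F := fun P => G.obj (F P)) _ _ h' _).trans
          ((congrArg G.map (matEntry_single_ne' _ _ h' f)).trans (G.map_zero _ _)).symm
    · exact (matEntry_single_ne (F := fun P => G.obj (F P)) h _ _ _).trans
        ((congrArg G.map (matEntry_single_ne h _ _ f)).trans (G.map_zero _ _)).symm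

/-- Surjectivity of the ring homomorphism is fullness on the family: only the matching entry of a
preimage matters. -/
lemma MatRing.exists_map_eq (h : Function.Surjective (MatRing.map F G)) {P Q : ι}
    (f : G.obj (F P) ⟶ G.obj (F Q)) : ∃ t : F P ⟶ F Q, G.map t = f := by
  obtain ⟨t, ht⟩ := h (InfComatrix.single (F := fun P => G.obj (F P)) P Q f)
  exact ⟨matEntry P Q t, by
    rw [← matEntry_map, ht]
    exact matEntry_single (F := fun P => G.obj (F P)) _ _ _⟩

lemma MatRing.map_injective [G.Faithful] : Function.Injective (MatRing.map F G) := by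
  intro s t h
  refine MatRing.ext_entry fun P Q => G.map_injective ?_
  rw [← matEntry_map, ← matEntry_map, h]

lemma MatRing.map_surjective (h : ∀ (P Q : ι) (f : G.obj (F P) ⟶ G.obj (F Q)), ∃ t, G.map t = f) :
    Function.Surjective (MatRing.map F G) := by
  intro s
  induction s using MatRing.induction with
  | zero => exact ⟨0, map_zero _⟩
  | add s t hs ht =>
    obtain ⟨s', rfl⟩ := hs
    obtain ⟨t', rfl⟩ := ht
    exact ⟨s' + t', map_add _ _ _⟩
  | single P Q f =>
    obtain ⟨t, rfl⟩ := h P Q f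
    exact ⟨InfComatrix.single P Q t, MatRing.map_single F G P Q t⟩

end Generators

/-! ### Presentation of `X ⊗_R Σ` by direct sums of comodules `ω P` -/

section Presentation

variable {A : Type u} [Ring A] {𝒜 : Type u} [SmallCategory 𝒜] {ω : 𝒜 ⥤ ModuleCat.{u} Aᵐᵒᵖ}
variable [Preadditive 𝒜] [ω.Additive]
variable [∀ P, Module.Finite Aᵐᵒᵖ (ω.obj P)] [∀ P, Module.Projective Aᵐᵒᵖ (ω.obj P)]

instance (P : 𝒜) : Module.Finite Aᵐᵒᵖ (comodObj ω P).carrier :=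
  inferInstanceAs (Module.Finite Aᵐᵒᵖ (ω.obj P))

variable (ω) in
/-- The comodule morphism `ω(t)`. -/
def comodMap {P Q : 𝒜} : (P ⟶ Q) →+ (comodObj ω P ⟶ comodObj ω Q) := (comodFunctor ω).mapAddHom

lemma comodMap_comp {P Q Q' : 𝒜} (s : P ⟶ Q) (t : Q ⟶ Q') :
    comodMap ω (s ≫ t) = comodMap ω s ≫ comodMap ω t := (comodFunctor ω).map_comp s t

lemma comodMap_inclComod (X : UMod (CatRing 𝒜)) {P Q : 𝒜} (t : P ⟶ Q) (x : X.carrier) :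
    comodMap ω t ≫ inclComod X x Q =
      inclComod X (op (single P Q t : CatRing 𝒜) • x) P :=
  Subtype.ext (incl_single_smul t x).symm

section Family

variable {J : Type u} (pt : J → 𝒜)

variable (ω) in
/-- A family of morphisms in `𝒜` as a comodule morphism to a direct sum. -/
def homToDsum (Q : 𝒜) :
    (⨁ j, (Q ⟶ pt j)) →+ (comodObj ω Q ⟶ dsum (fun j => comodObj ω (pt j))) :=
  DirectSum.toAddMonoid (fun j => AddMonoidHom.mk'
    (fun t => comodMap ω t ≫ dsumι (fun j => comodObj ω (pt j)) j)
    (fun s t => by rw [map_add, Preadditive.add_comp]))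

lemma homToDsum_of (Q : 𝒜) (j : J) (t : Q ⟶ pt j) :
    homToDsum ω pt Q (DirectSum.of (fun j => (Q ⟶ pt j)) j t) =
      comodMap ω t ≫ dsumι (fun j => comodObj ω (pt j)) j := DirectSum.toAddMonoid_of _ _ _

lemma homToDsum_π (Q : 𝒜) (t : ⨁ j, (Q ⟶ pt j)) (j : J) :
    homToDsum ω pt Q t ≫ dsumπ _ j = comodMap ω (t j) := by
  induction t using DirectSum.induction_on with
  | zero => rw [map_zero, Limits.zero_comp, DirectSum.zero_apply, map_zero]
  | add s t hs ht => rw [map_add, Preadditive.add_comp, DirectSum.add_apply, map_add, hs, ht]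
  | of i t =>
    rw [homToDsum_of, Category.assoc]
    by_cases h : i = j
    · subst h
      rw [dsumι_π, Category.comp_id, DirectSum.of_eq_same]
    · rw [dsumι_π_ne h, Limits.comp_zero, DirectSum.of_eq_of_ne _ _ _ (Ne.symm h), map_zero]

/-- Projections of the direct sum recover the members of the family, up to faithfulness of `ω`. -/
lemma homToDsum_injective [ω.Faithful] (Q : 𝒜) : Function.Injective (homToDsum ω pt Q) := by
  intro s t h
  refine DirectSum.ext fun j => ω.map_injective (ModuleCat.hom_ext ?_)
  have h1 := congrArg (fun f => f ≫ dsumπ _ j) h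
  simp only [homToDsum_π] at h1
  exact congrArg Subtype.val h1

/-- As `ω Q` is finitely generated, a morphism to the direct sum meets finitely many summands, and
each component comes from `𝒜` by fullness. So comodule maps to such sums can be handled as families
of morphisms of `𝒜`. -/
lemma homToDsum_surjective
    (hfull : ∀ (P Q : 𝒜) (f : comodObj ω P ⟶ comodObj ω Q), ∃ t, comodMap ω t = f) (Q : 𝒜) :
    Function.Surjective (homToDsum ω pt Q) := by
  intro f
  obtain ⟨s, hs⟩ := exists_finset_hom_dsum f
  choose t ht using fun j => hfull Q (pt j) (f ≫ dsumπ _ j)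
  refine ⟨∑ j ∈ s, DirectSum.of (fun j => (Q ⟶ pt j)) j (t j), ?_⟩
  rw [map_sum, hs]
  refine Finset.sum_congr rfl fun j _ => ?_
  rw [homToDsum_of, ht]

/-- Composition of the members of a family with a morphism. -/
def precompFamily {P Q : 𝒜} (t : P ⟶ Q) : (⨁ j, (Q ⟶ pt j)) →+ (⨁ j, (P ⟶ pt j)) :=
  DirectSum.map (fun _ => Preadditive.leftComp _ t)

lemma homToDsum_precomp {P Q : 𝒜} (t : P ⟶ Q) (s : ⨁ j, (Q ⟶ pt j)) :
    homToDsum ω pt P (precompFamily pt t s) = comodMap ω t ≫ homToDsum ω pt Q s := by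
  induction s using DirectSum.induction_on with
  | zero => rw [map_zero, map_zero, map_zero, Limits.comp_zero]
  | add s s' hs hs' => rw [map_add, map_add, map_add, Preadditive.comp_add, hs, hs']
  | of j s =>
    rw [precompFamily, DirectSum.map_of, homToDsum_of, homToDsum_of, ← Category.assoc,
      ← comodMap_comp]
    rfl

end Family

variable (X : UMod (CatRing 𝒜))

/-- The index set of the canonical cover of `X ⊗_R Σ`. -/
structure CoverIndex where
  /-- the object -/
  pt : 𝒜
  /-- the element -/
  el : X.carrier

variable (ω) in
/-- The canonical cover of `X ⊗_R Σ` by a direct sum of comodules `ω P`. -/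
def cover : dsum (fun j : CoverIndex X => comodObj ω j.pt) ⟶ tensorObj ω X :=
  dsumDesc (fun j => inclComod X j.el j.pt)

lemma cover_surjective : Function.Surjective (cover ω X).1 := by
  intro z
  change z ∈ LinearMap.range (cover ω X).1
  refine tensor_induction (p := fun z => z ∈ LinearMap.range (cover ω X).1) z (zero_mem _) ?_
    (fun x y hx hy => add_mem hx hy)
  intro x P p
  exact ⟨(dsumι (fun j : CoverIndex X => comodObj ω j.pt) ⟨P, x⟩).1 p,
    dsumDesc_ι_apply (fun j : CoverIndex X => inclComod X j.el j.pt) ⟨P, x⟩ p⟩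

/-- The element `∑ j, x j t j` of `X`. -/
def familyEl (Q : 𝒜) : (⨁ j : CoverIndex X, (Q ⟶ j.pt)) →+ X.carrier :=
  DirectSum.toAddMonoid (fun j => AddMonoidHom.mk'
    (fun t => op (single Q j.pt t : CatRing 𝒜) • j.el)
    (fun s t => by rw [map_add, MulOpposite.op_add, NUModule.add_smul]))

lemma familyEl_of (Q : 𝒜) (j : CoverIndex X) (t : Q ⟶ j.pt) :
    familyEl X Q (DirectSum.of (fun j : CoverIndex X => (Q ⟶ j.pt)) j t) =
      op (single Q j.pt t : CatRing 𝒜) • j.el := DirectSum.toAddMonoid_of _ _ _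

lemma inclComod_add (x y : X.carrier) (P : 𝒜) :
    inclComod (ω := ω) X (x + y) P = inclComod X x P + inclComod X y P :=
  Subtype.ext (incl_add x y P)

lemma inclComod_zero (P : 𝒜) : inclComod (ω := ω) X 0 P = 0 := Subtype.ext (incl_zero P)

/-- Composing with the cover turns a family `t` into the element `∑ x_j t_j` of `X`. Lifting a
morphism along the cover therefore exhibits it as `p ↦ x ⊗ p`. -/
lemma homToDsum_cover (Q : 𝒜) (t : ⨁ j : CoverIndex X, (Q ⟶ j.pt)) :
    homToDsum ω CoverIndex.pt Q t ≫ cover ω X = inclComod X (familyEl X Q t) Q := by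
  induction t using DirectSum.induction_on with
  | zero => rw [map_zero, map_zero, Limits.zero_comp, inclComod_zero]
  | add s t hs ht => rw [map_add, map_add, Preadditive.add_comp, hs, ht, inclComod_add]
  | of j t =>
    rw [homToDsum_of, familyEl_of, Category.assoc, cover, dsumι_desc, comodMap_inclComod]

lemma familyEl_precomp {P Q : 𝒜} (t : P ⟶ Q) (s : ⨁ j : CoverIndex X, (Q ⟶ j.pt)) :
    familyEl X P (precompFamily CoverIndex.pt t s) =
      op (single P Q t : CatRing 𝒜) • familyEl X Q s := by
  induction s using DirectSum.induction_on with
  | zero => rw [map_zero, map_zero, map_zero, NUModule.smul_zero']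
  | add s s' hs hs' => rw [map_add, map_add, map_add, NUModule.smul_add, hs, hs']
  | of j s =>
    rw [precompFamily, DirectSum.map_of, familyEl_of, familyEl_of, op_smul_op_smul]
    congr 2
    exact (single_mul_single (F := fun P : 𝒜 => P) s t).symm

/-- The index set of the relations between the generators of `X`. -/
structure RelIndex where
  /-- the object -/
  pt : 𝒜
  /-- the coefficients -/
  coeff : ⨁ j : CoverIndex X, (pt ⟶ j.pt)
  eq_zero : familyEl X pt coeff = 0

variable (ω) in
/-- The morphism of comodules given by the relations between the generators of `X`. -/
def relMap : dsum (fun l : RelIndex X => comodObj ω l.pt) ⟶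
    dsum (fun j : CoverIndex X => comodObj ω j.pt) :=
  dsumDesc (fun l => homToDsum ω CoverIndex.pt l.pt l.coeff)

lemma relMap_cover : relMap ω X ≫ cover ω X = 0 :=
  dsum_hom_ext fun l => by
    rw [← Category.assoc, relMap, dsumι_desc, homToDsum_cover, l.eq_zero, inclComod_zero,
      Limits.comp_zero]

lemma homToDsum_mem_range (Q : 𝒜) (t : ⨁ j : CoverIndex X, (Q ⟶ j.pt)) (ht : familyEl X Q t = 0)
    (q : ω.obj Q) : (homToDsum ω CoverIndex.pt Q t).1 q ∈ LinearMap.range (relMap ω X).1 :=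
  ⟨(dsumι (fun l : RelIndex X => comodObj ω l.pt) ⟨Q, t, ht⟩).1 q,
    dsumDesc_ι_apply (fun l : RelIndex X => homToDsum ω CoverIndex.pt l.pt l.coeff) ⟨Q, t, ht⟩ q⟩

variable (ω) in
/-- The generator of the cover that corresponds to an element `x` of `X`. -/
def gen (P : 𝒜) (x : X.carrier) : ω.obj P →ₗ[Aᵐᵒᵖ]
    (dsum (fun j : CoverIndex X => comodObj ω j.pt)).carrier :=
  (dsumι (fun j : CoverIndex X => comodObj ω j.pt) ⟨P, x⟩).1

variable (ω) in
/-- The cokernel of the relations. -/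
abbrev RelQuot : Type u :=
  (dsum (fun j : CoverIndex X => comodObj ω j.pt)).carrier ⧸ LinearMap.range (relMap ω X).1

variable (ω) in
/-- The map `p ↦ [x ⊗ p]` to the cokernel of the relations. -/
def genQuot (P : 𝒜) (x : X.carrier) : ω.obj P →ₗ[Aᵐᵒᵖ] RelQuot ω X :=
  (LinearMap.range (relMap ω X).1).mkQ ∘ₗ gen ω X P x

lemma homToDsum_of_apply {Q : 𝒜} (P : 𝒜) (x : X.carrier) (t : Q ⟶ P) (q : ω.obj Q) :
    (homToDsum ω CoverIndex.pt Q
      (DirectSum.of (fun j : CoverIndex X => (Q ⟶ j.pt)) ⟨P, x⟩ t)).1 q =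
      gen ω X P x ((ω.map t).hom q) := by
  rw [homToDsum_of]; rfl

/-- The class of a family in the cokernel of the relations, evaluated at an element. -/
def famQuot (Q : 𝒜) (q : ω.obj Q) : (⨁ j : CoverIndex X, (Q ⟶ j.pt)) →+ RelQuot ω X :=
  AddMonoidHom.mk' (fun t => (LinearMap.range (relMap ω X).1).mkQ
    ((homToDsum ω CoverIndex.pt Q t).1 q)) (fun s t => by
      rw [map_add (homToDsum ω CoverIndex.pt Q)]
      exact map_add (LinearMap.range (relMap ω X).1).mkQ _ _)

lemma famQuot_of (Q P : 𝒜) (x : X.carrier) (t : Q ⟶ P) (q : ω.obj Q) :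
    famQuot X Q q (DirectSum.of (fun j : CoverIndex X => (Q ⟶ j.pt)) ⟨P, x⟩ t) =
      genQuot ω X P x ((ω.map t).hom q) :=
  congrArg (LinearMap.range (relMap ω X).1).mkQ (homToDsum_of_apply X P x t q)

lemma famQuot_of_id (P : 𝒜) (x : X.carrier) (p : ω.obj P) :
    famQuot X P p (DirectSum.of (fun j : CoverIndex X => (P ⟶ j.pt)) ⟨P, x⟩ (𝟙 P)) =
      genQuot ω X P x p := by
  rw [famQuot_of, ω.map_id]; rfl

/-- Two families giving the same element of `X` differ by a relation. All identities among the
classes `[x ⊗ p]` needed to map `X ⊗_R Σ` to the cokernel follow from this. -/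
lemma famQuot_eq (Q : 𝒜) (q : ω.obj Q) {s t : ⨁ j : CoverIndex X, (Q ⟶ j.pt)}
    (h : familyEl X Q s = familyEl X Q t) : famQuot X Q q s = famQuot X Q q t := by
  rw [← sub_eq_zero, ← map_sub]
  exact (Submodule.Quotient.mk_eq_zero _).2 (homToDsum_mem_range X Q (s - t)
    (by rw [map_sub, h, sub_self]) q)

lemma genQuot_add (P : 𝒜) (x y : X.carrier) :
    genQuot ω X P (x + y) = genQuot ω X P x + genQuot ω X P y := by
  ext p
  rw [LinearMap.add_apply, ← famQuot_of_id, ← famQuot_of_id, ← famQuot_of_id, ← map_add]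
  refine famQuot_eq X P p ?_
  rw [map_add, familyEl_of, familyEl_of, familyEl_of]
  exact NUModule.smul_add _ _ _

lemma genQuot_single_smul {P Q : 𝒜} (t : P ⟶ Q) (x : X.carrier) (p : ω.obj P) :
    genQuot ω X P (op (single P Q t : CatRing 𝒜) • x) p =
      genQuot ω X Q x ((ω.map t).hom p) := by
  rw [← famQuot_of_id, ← famQuot_of]
  refine famQuot_eq X P p ?_
  rw [familyEl_of, familyEl_of]
  exact one_smul_single t x

lemma genQuot_single_smul_ne {P P' Q : 𝒜} (h : P ≠ P') (t : P ⟶ Q) (x : X.carrier)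
    (p : ω.obj P') : genQuot ω X P' (op (single P Q t : CatRing 𝒜) • x) p = 0 := by
  rw [← famQuot_of_id, ← map_zero (famQuot (ω := ω) X P' p)]
  refine famQuot_eq X P' p ?_
  rw [familyEl_of, map_zero]
  exact one_smul_single_ne h t x

lemma genQuot_zero (P : 𝒜) : genQuot ω X P 0 = 0 := by
  have h := genQuot_add (ω := ω) X P 0 0
  rwa [add_zero, left_eq_add] at h

/-- The map `s ↦ [x ⊗ s]` to the cokernel of the relations. -/
def sumQuot (x : X.carrier) : Sig ω →+ RelQuot ω X :=
  DirectSum.toAddMonoid (fun P => (genQuot ω X P x).toAddMonoidHom)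

lemma sumQuot_ι (x : X.carrier) (P : 𝒜) (p : ω.obj P) :
    sumQuot X x (Sig.ι ω P p) = genQuot ω X P x p := DirectSum.toAddMonoid_of _ _ _

lemma sumQuot_add (x y : X.carrier) :
    sumQuot (ω := ω) X (x + y) = sumQuot X x + sumQuot X y := by
  ext s
  induction s using Sig.induction with
  | zero => rw [map_zero, map_zero]
  | add s s' h h' => rw [map_add, map_add, h, h']
  | ι P p =>
    rw [AddMonoidHom.add_apply, sumQuot_ι, sumQuot_ι, sumQuot_ι, genQuot_add]; rfl

lemma sumQuot_balanced (x : X.carrier) (r : CatRing 𝒜) (s : Sig ω) :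
    sumQuot X (op r • x) s = sumQuot X x (r • s) := by
  induction s using Sig.induction with
  | zero => rw [map_zero, NUModule.smul_zero', map_zero]
  | add s s' h h' => rw [map_add, NUModule.smul_add, map_add, h, h']
  | ι P' p =>
    induction r using MatRing.induction with
    | zero =>
      rw [MulOpposite.op_zero, NUModule.zero_smul', NUModule.zero_smul', map_zero, sumQuot_ι,
        genQuot_zero]; rfl
    | add r r' h h' =>
      rw [MulOpposite.op_add, NUModule.add_smul, NUModule.add_smul, map_add, sumQuot_add,
        AddMonoidHom.add_apply, h, h']
    | single P Q t =>
      by_cases h : P = P'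
      · subst h
        rw [sumQuot_ι, genQuot_single_smul, single_smul_ι, sumQuot_ι]
      · rw [sumQuot_ι, genQuot_single_smul_ne X h, single_smul_ι_ne h, map_zero]

/-- The map from `X ⊗_R Σ` to the cokernel of the relations. -/
def tensorQuot : BTensor (CatRing 𝒜) X.carrier (Sig ω) →+ RelQuot ω X :=
  lift (B := CatRing 𝒜) (AddMonoidHom.mk' (sumQuot X) (sumQuot_add X)) (sumQuot_balanced X)

lemma tensorQuot_incl (x : X.carrier) (P : 𝒜) (p : ω.obj P) :
    tensorQuot X (incl ω x P p) = genQuot ω X P x p := sumQuot_ι X x P p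

lemma tensorQuot_cover (z : (dsum (fun j : CoverIndex X => comodObj ω j.pt)).carrier) :
    tensorQuot X ((cover ω X).1 z) = (LinearMap.range (relMap ω X).1).mkQ z := by
  refine dsum_induction z ?_ ?_ ?_
  · rw [map_zero, map_zero]; exact map_zero _
  · rintro ⟨P, x⟩ p
    refine (congrArg (tensorQuot X) (dsumDesc_ι_apply
      (fun j : CoverIndex X => inclComod X j.el j.pt) ⟨P, x⟩ p)).trans ?_
    exact tensorQuot_incl X x P p
  · intro a b ha hb
    rw [map_add, map_add, ← ha, ← hb]
    exact map_add (tensorQuot X) _ _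

/-- Exactness of the presentation: passage to the cokernel of the relations factors through the
cover by `tensorQuot`, so the kernel of the cover consists of relations. -/
lemma mem_range_relMap (z : (dsum (fun j : CoverIndex X => comodObj ω j.pt)).carrier)
    (hz : (cover ω X).1 z = 0) : z ∈ LinearMap.range (relMap ω X).1 := by
  rw [← Submodule.Quotient.mk_eq_zero]
  refine (tensorQuot_cover X z).symm.trans ?_
  rw [hz]
  exact map_zero (tensorQuot X)

variable (hC : IsFlat A (Comatrix ω))

/-- Exactness restated inside the category of comodules, giving an epimorphism onto the kernel to
which projectivity applies. -/
lemma kerComodLift_relMap_surjective :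
    Function.Surjective (kerComodLift hC (cover ω X) (relMap ω X) (relMap_cover X)).1 := by
  intro k
  obtain ⟨y, hy⟩ := mem_range_relMap X ((kerComodι hC (cover ω X)).1 k)
    (congrArg (fun g => g.1 k) (kerComodι_comp hC (cover ω X)))
  refine ⟨y, kerComodι_injective hC (cover ω X) ?_⟩
  rw [← hy]
  exact congrArg (fun g => g.1 y) (kerComodLift_ι hC (cover ω X) (relMap ω X) (relMap_cover X))

/-- Projectivity lifts `h` along the cover; the lift is a finite family of morphisms of `𝒜`, and its
element of `X` induces `h`. -/
theorem unitSurjective_of_projective [∀ P, Projective (comodObj ω P)]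
    (hfull : ∀ (P Q : 𝒜) (f : comodObj ω P ⟶ comodObj ω Q), ∃ t, comodMap ω t = f) :
    UnitSurjective ω X := by
  intro P h
  have : Epi (cover ω X) := Comod.epi_of_surjective _ (cover_surjective X)
  obtain ⟨t, ht⟩ := homToDsum_surjective CoverIndex.pt hfull P
    (Projective.factorThru h (cover ω X))
  exact ⟨familyEl X P t, by
    rw [← homToDsum_cover, ht, Projective.factorThru_comp]⟩

/-- Precomposing a relation with a morphism of `𝒜` multiplies its element of `X`, which is zero, by
an element of `R`. Hence combinations of relations stay relations at the level of `𝒜`. -/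
lemma exists_familyEl_eq_zero {Q : 𝒜} (s : ⨁ l : RelIndex X, (Q ⟶ l.pt)) :
    ∃ t : ⨁ j : CoverIndex X, (Q ⟶ j.pt), familyEl X Q t = 0 ∧
      homToDsum ω CoverIndex.pt Q t = homToDsum ω RelIndex.pt Q s ≫ relMap ω X := by
  induction s using DirectSum.induction_on with
  | zero => exact ⟨0, map_zero _, by rw [map_zero, map_zero, Limits.zero_comp]⟩
  | add s s' h h' =>
    obtain ⟨t, ht, e⟩ := h
    obtain ⟨t', ht', e'⟩ := h'
    exact ⟨t + t', by rw [map_add, ht, ht', add_zero], by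
      rw [map_add, map_add, Preadditive.add_comp, e, e']⟩
  | of l s =>
    exact ⟨precompFamily CoverIndex.pt s l.coeff, by
      rw [familyEl_precomp, l.eq_zero, NUModule.smul_zero'], by
      rw [homToDsum_precomp, homToDsum_of, Category.assoc, relMap, dsumι_desc]⟩

/-- If `x ⊗ p = 0` for all `p` in `ω P`, the generator `(P, x)` maps `ω P` into the kernel of the
cover, and projectivity lifts it to the relations. So the generator is itself a combination of
relations, whence `x (one P) = 0`; the idempotents together detect `x`. -/
theorem unitInjective_of_projective [ω.Faithful] [∀ P, Projective (comodObj ω P)]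
    (hC : IsFlat A (Comatrix ω))
    (hfull : ∀ (P Q : 𝒜) (f : comodObj ω P ⟶ comodObj ω Q), ∃ t, comodMap ω t = f) :
    UnitInjective ω X := by
  intro x hx
  refine eq_zero_of_one_smul fun P => ?_
  let g : ⨁ j : CoverIndex X, (P ⟶ j.pt) := DirectSum.of _ ⟨P, x⟩ (𝟙 P)
  have hg : familyEl X P g = op (one P) • x := familyEl_of X P ⟨P, x⟩ (𝟙 P)
  have hg0 : homToDsum ω CoverIndex.pt P g ≫ cover ω X = 0 := by
    rw [homToDsum_cover, hg]
    exact Subtype.ext ((incl_one_smul x P).trans (hx P))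
  have : Epi (kerComodLift hC (cover ω X) (relMap ω X) (relMap_cover X)) :=
    Comod.epi_of_surjective _ (kerComodLift_relMap_surjective X hC)
  obtain ⟨s, hs⟩ := homToDsum_surjective RelIndex.pt hfull P (Projective.factorThru
    (kerComodLift hC (cover ω X) _ hg0)
    (kerComodLift hC (cover ω X) (relMap ω X) (relMap_cover X)))
  obtain ⟨t, ht, e⟩ := exists_familyEl_eq_zero (ω := ω) X s
  -- Both families induce the same comodule morphism to the direct sum; faithfulness of `ω` brings
  -- the equality back to `𝒜`.
  have e' : t = g := homToDsum_injective (ω := ω) CoverIndex.pt P (by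
    rw [e, hs]
    have e₁ := congrArg (· ≫ kerComodι hC (cover ω X)) (Projective.factorThru_comp
      (kerComodLift hC (cover ω X) _ hg0)
      (kerComodLift hC (cover ω X) (relMap ω X) (relMap_cover X)))
    simpa only [Category.assoc, kerComodLift_ι] using e₁)
  rw [← hg, ← e', ht]

/-- A morphism from `ω P` to the kernel of `f ⊗ Σ` has the form `p ↦ x ⊗ p`. Injectivity of the unit
at `Y` turns `f x ⊗ p = 0` into vanishing in `Y`, so for injective `f` the morphism is zero; as the
`ω P` generate, the kernel vanishes. Faithfulness needs only injectivity of the unit. -/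
theorem nuFaithfullyFlat_of_generating [ω.Faithful] (hC : IsFlat A (Comatrix ω))
    (hgen : IsGeneratingSetOfSmallProjectives (fun P : 𝒜 => (comodFunctor ω).obj P))
    (hlam : Function.Bijective (lam ω)) : NUFaithfullyFlat (CatRing 𝒜) (Sig ω) := by
  have : ∀ P, Projective (comodObj ω P) := fun P => hgen.projective P
  have hfull : ∀ (P Q : 𝒜) (f : comodObj ω P ⟶ comodObj ω Q), ∃ t, comodMap ω t = f :=
    fun P Q f => MatRing.exists_map_eq (comodFunctor ω) (F := fun P : 𝒜 => P) hlam.2 f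
  have h₁ : ∀ X : UMod (CatRing 𝒜), UnitInjective ω X := fun X =>
    unitInjective_of_projective X hC hfull
  have h₂ : ∀ X : UMod (CatRing 𝒜), UnitSurjective ω X := fun X =>
    unitSurjective_of_projective X hfull
  refine ⟨fun X Y f hf => ?_, fun X Y f g h => ?_⟩
  · refine injective_of_kerComodι_eq_zero hC ((tensorFunctor ω).map f) (hgen.eq_zero _ ?_)
    intro P (k : comodObj ω P ⟶ _)
    obtain ⟨x, hx⟩ := h₂ X P (k ≫ kerComodι hC ((tensorFunctor ω).map f))
    have e' : incl ω (UMod.Hom.hom f x) P = 0 := LinearMap.ext fun p =>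
      (congrArg (fun g : comodObj ω P ⟶ tensorObj ω X => ((tensorFunctor ω).map f).1 (g.1 p))
        hx).symm.trans (congrArg (fun g => g.1 (k.1 p))
          (kerComodι_comp hC ((tensorFunctor ω).map f)))
    -- Only the part of `x` at `P` is controlled, so `x` is replaced by `x (one P)`, which defines
    -- the same morphism from `ω P`.
    have e₀ : UMod.Hom.hom f (op (one P) • x) = 0 := by
      refine h₁ Y _ fun Q => ?_
      rw [UMod.Hom.map_smul]
      by_cases h : P = Q
      · subst h
        rw [incl_one_smul, e']
      · exact incl_single_smul_ne h _ _
    have e₁ : op (one P) • x = 0 := hf (e₀.trans (map_zero (UMod.Hom.hom f)).symm)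
    refine hx.trans (Subtype.ext ?_)
    change incl ω x P = 0
    rw [← incl_one_smul, e₁, incl_zero]
  · refine UMod.hom_ext fun x => sub_eq_zero.1 (h₁ Y _ fun P => ?_)
    rw [incl_sub, sub_eq_zero]
    ext p
    exact DFunLike.congr_fun h (tmul (CatRing 𝒜) x (Sig.ι ω P p))

end Presentation

/-! ### Finitely generated comodules are small -/

section Small

variable {A : Type u} [Ring A] {C : Type u} [AddCommGroup C] [Module A C] [Module Aᵐᵒᵖ C]
  [SMulCommClass A Aᵐᵒᵖ C] [SMulCommClass Aᵐᵒᵖ A C] {D : Coring A C}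

/-- The direct sum of comodules is a coproduct. -/
def dsumIsColimit {J : Type u} (M : J → Comod D) :
    Limits.IsColimit (Limits.Cofan.mk (dsum M) (dsumι M)) :=
  Limits.Cofan.IsColimit.mk _ (fun s => dsumDesc s.inj) (fun s j => dsumι_desc s.inj j)
    (fun s _ hm => dsum_hom_ext fun j => (hm j).trans (dsumι_desc s.inj j).symm)

variable (P : Comod D)

section HomSumHom

variable {J : Type u} (M : J → Comod D)

/-- The canonical map from the direct sum of the groups of morphisms to the morphisms to the
direct sum. -/
def homDsum : (⨁ j, (P ⟶ M j)) →+ (P ⟶ dsum M) :=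
  DirectSum.toAddMonoid (fun j => Preadditive.rightComp P (dsumι M j))

lemma homDsum_of (j : J) (f : P ⟶ M j) :
    homDsum P M (DirectSum.of (fun j => (P ⟶ M j)) j f) = f ≫ dsumι M j :=
  DirectSum.toAddMonoid_of _ _ _

lemma homDsum_π (t : ⨁ j, (P ⟶ M j)) (j : J) : homDsum P M t ≫ dsumπ M j = t j := by
  induction t using DirectSum.induction_on with
  | zero => rw [map_zero, Limits.zero_comp, DirectSum.zero_apply]
  | add s t hs ht => rw [map_add, Preadditive.add_comp, DirectSum.add_apply, hs, ht]
  | of i t =>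
    rw [homDsum_of, Category.assoc]
    by_cases h : i = j
    · subst h
      rw [dsumι_π, Category.comp_id, DirectSum.of_eq_same]
    · rw [dsumι_π_ne h, Limits.comp_zero, DirectSum.of_eq_of_ne _ _ _ (Ne.symm h)]

/-- Projections give injectivity; finite generation of `P` bounds the support of a morphism and
gives surjectivity. -/
lemma homDsum_bijective [Module.Finite Aᵐᵒᵖ P.carrier] : Function.Bijective (homDsum P M) := by
  refine ⟨fun s t h => DirectSum.ext fun j => ?_, fun f => ?_⟩
  · rw [← homDsum_π, ← homDsum_π, h]
  · obtain ⟨s, hs⟩ := exists_finset_hom_dsum f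
    refine ⟨∑ j ∈ s, DirectSum.of (fun j => (P ⟶ M j)) j (f ≫ dsumπ M j), ?_⟩
    rw [map_sum]
    exact (Finset.sum_congr rfl fun j _ => homDsum_of P M j _).trans hs.symm

variable {P M} {G : Type*} [AddCommGroup G]

/-- The universal property of the group of morphisms from a finitely generated comodule to a
direct sum. -/
def homDsumDesc [Module.Finite Aᵐᵒᵖ P.carrier] (φ : ∀ j, (P ⟶ M j) →+ G) : (P ⟶ dsum M) →+ G :=
  (DirectSum.toAddMonoid φ).comp
    (AddEquiv.ofBijective (homDsum P M) (homDsum_bijective P M)).symm.toAddMonoidHom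

lemma homDsumDesc_ι [Module.Finite Aᵐᵒᵖ P.carrier] (φ : ∀ j, (P ⟶ M j) →+ G) (j : J)
    (f : P ⟶ M j) : homDsumDesc φ (f ≫ dsumι M j) = φ j f := by
  rw [← homDsum_of]
  exact (congrArg (DirectSum.toAddMonoid φ) ((AddEquiv.ofBijective (homDsum P M)
    (homDsum_bijective P M)).symm_apply_apply _)).trans (DirectSum.toAddMonoid_of _ _ _)

lemma homDsum_hom_ext [Module.Finite Aᵐᵒᵖ P.carrier] {φ ψ : (P ⟶ dsum M) →+ G}
    (h : ∀ j (f : P ⟶ M j), φ (f ≫ dsumι M j) = ψ (f ≫ dsumι M j)) : φ = ψ := by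
  ext f
  obtain ⟨t, rfl⟩ := (homDsum_bijective P M).2 f
  refine DFunLike.congr_fun (DirectSum.addHom_ext (f := φ.comp (homDsum P M))
    (g := ψ.comp (homDsum P M)) fun j f => ?_) t
  rw [AddMonoidHom.comp_apply, AddMonoidHom.comp_apply, homDsum_of, h]

end HomSumHom

/-- The functor of morphisms from a finitely generated comodule preserves coproducts. -/
theorem Comod.preservesCoproducts [Module.Finite Aᵐᵒᵖ P.carrier] (J : Type u) :
    Limits.PreservesColimitsOfShape (Discrete J) (preadditiveCoyoneda.obj (Opposite.op P)) where
  preservesColimit {K} := by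
    let M : J → Comod D := K.obj ∘ Discrete.mk
    -- Every diagram on a discrete category is isomorphic to the one built from its objects, and for
    -- that one the explicit direct sum is a colimit to test on.
    have : Limits.PreservesColimit (Discrete.functor (K.obj ∘ Discrete.mk))
        (preadditiveCoyoneda.obj (Opposite.op P)) := by
      refine Limits.preservesColimit_of_preserves_colimit_cocone (dsumIsColimit M) ?_
      refine (Limits.isColimitMapCoconeCofanMkEquiv _ M (dsumι M)).symm ?_
      exact Limits.Cofan.IsColimit.mk _
        (fun s => AddCommGrpCat.ofHom (homDsumDesc fun j => (s.inj j).hom))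
        (fun s j => AddCommGrpCat.hom_ext (AddMonoidHom.ext fun f =>
          homDsumDesc_ι (fun j => (s.inj j).hom) j f))
        (fun s m hm => AddCommGrpCat.hom_ext (homDsum_hom_ext fun j f =>
          (congrArg (fun k => k.hom f) (hm j)).trans
            (homDsumDesc_ι (fun j => (s.inj j).hom) j f).symm))
    exact Limits.preservesColimit_of_iso_diagram _ (Discrete.natIsoFunctor (F := K)).symm

end Small

/-! ### From faithful flatness to small projective generators -/

section FullyFaithful

variable {A : Type u} [Ring A] {𝒜 : Type u} [SmallCategory 𝒜] {ω : 𝒜 ⥤ ModuleCat.{u} Aᵐᵒᵖ}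
variable [Preadditive 𝒜] [ω.Additive]

lemma Sig.π_smul_ι (P Q : 𝒜) (r : CatRing 𝒜) (p : ω.obj P) :
    Sig.π ω Q (r • Sig.ι ω P p) = (ω.map (matEntry (F := fun P : 𝒜 => P) P Q r)).hom p := by
  induction r using MatRing.induction with
  | zero => rw [NUModule.zero_smul', map_zero, map_zero, ω.map_zero]; rfl
  | add r s hr hs => rw [NUModule.add_smul, map_add, map_add, ω.map_add, hr, hs]; rfl
  | single P' Q' t =>
    by_cases h : P' = P
    · subst h
      rw [single_smul_ι]
      by_cases h' : Q' = Q
      · subst h'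
        rw [Sig.π_ι, matEntry_single]
      · rw [Sig.π_ι_ne h', matEntry_single_ne' _ _ h', ω.map_zero]; rfl
    · rw [single_smul_ι_ne h, map_zero, matEntry_single_ne h, ω.map_zero]; rfl

/-- The multiplication map `R ⊗_R Σ → Σ`. -/
def mulSig : BTensor (CatRing 𝒜) (regular 𝒜).carrier (Sig ω) →+ Sig ω :=
  lift (B := CatRing 𝒜) (AddMonoidHom.mk'
    (fun r : CatRing 𝒜 => AddMonoidHom.mk' (fun s : Sig ω => r • s) (NUModule.smul_add r))
    (fun r r' => AddMonoidHom.ext fun s => NUModule.add_smul (R := CatRing 𝒜) r r' s))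
    (fun r r' s => NUModule.mul_smul (show CatRing 𝒜 from r) r' s)

variable [∀ P, Module.Finite Aᵐᵒᵖ (ω.obj P)] [∀ P, Module.Projective Aᵐᵒᵖ (ω.obj P)]

/-- Surjectivity of the unit at `R` provides `r` with `one Q ⊗ h(p) = r ⊗ p` for all `p`.
Multiplying out in `Σ` and projecting to `ω Q` shows that `h` is induced by the entry of `r` from
`P` to `Q`. -/
lemma exists_comodMap_eq (h₂ : UnitSurjective ω (regular 𝒜)) {P Q : 𝒜}
    (h : comodObj ω P ⟶ comodObj ω Q) : ∃ t : P ⟶ Q, comodMap ω t = h := by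
  obtain ⟨(r : CatRing 𝒜), hr⟩ := h₂ P (h ≫ inclComod (regular 𝒜) (one Q : CatRing 𝒜) Q)
  refine ⟨matEntry (F := fun P : 𝒜 => P) P Q r, Subtype.ext (LinearMap.ext fun (p : ω.obj P) => ?_)⟩
  let q : ω.obj Q := h.1 p
  have e : incl ω (X := (regular 𝒜).carrier) (one Q : CatRing 𝒜) Q q =
      incl ω (X := (regular 𝒜).carrier) r P p :=
    congrArg (fun g => g.1 p) hr
  have e' := congrArg (fun z => Sig.π ω Q (mulSig z)) e
  change Sig.π ω Q ((one Q : CatRing 𝒜) • Sig.ι ω Q q) =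
    Sig.π ω Q (r • Sig.ι ω P p) at e'
  rw [Sig.π_smul_ι, Sig.π_smul_ι, one, matEntry_single, ω.map_id] at e'
  exact e'.symm

theorem lam_bijective [ω.Faithful] (h₂ : UnitSurjective ω (regular 𝒜)) :
    Function.Bijective (lam ω) := by
  have : (comodFunctor ω).Faithful :=
    ⟨fun {P Q s t} h => ω.map_injective (ModuleCat.hom_ext (congrArg Subtype.val h))⟩
  exact ⟨MatRing.map_injective (F := fun P : 𝒜 => P) (comodFunctor ω),
    MatRing.map_surjective (F := fun P : 𝒜 => P) (comodFunctor ω)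
      fun P Q f => exists_comodMap_eq h₂ f⟩

lemma exists_iso_tensorObj [(tensorFunctor ω).IsEquivalence] (M : Comod (comatrixCoring ω)) :
    ∃ X, Nonempty (tensorObj ω X ≅ M) :=
  ⟨_, ⟨(tensorFunctor ω).objObjPreimageIso M⟩⟩

/-- Full faithfulness moves the epimorphism to unital modules, where epimorphisms are surjective.
Surjectivity on elements is what lifts morphisms from `ω P`. -/
lemma exists_surjective_of_epi [(tensorFunctor ω).IsEquivalence] {X Y : UMod (CatRing 𝒜)}
    (h : tensorObj ω X ⟶ tensorObj ω Y) [Epi h] :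
    ∃ g : X ⟶ Y, Function.Surjective (UMod.Hom.hom g) ∧
      ∀ P x, inclComod X x P ≫ h = inclComod Y (UMod.Hom.hom g x) P := by
  obtain ⟨g, rfl⟩ := (tensorFunctor ω).map_surjective h
  have : Epi ((tensorFunctor ω).map g) := ‹_›
  have : Epi g := (tensorFunctor ω).epi_of_epi_map this
  exact ⟨g, UMod.surjective_of_epi g, fun P x => rfl⟩

/-- Up to isomorphism the epimorphism comes from a surjection `X → Y`, and a morphism from `ω P` to
`Y ⊗_R Σ` is given by an element of `Y`, which lifts to `X`. -/
theorem projective_comodObj [(tensorFunctor ω).IsEquivalence]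
    (h₂ : ∀ X : UMod (CatRing 𝒜), UnitSurjective ω X) (P : 𝒜) : Projective (comodObj ω P) := by
  refine ⟨fun {E M} f e he => ?_⟩
  obtain ⟨X, ⟨i⟩⟩ := exists_iso_tensorObj (ω := ω) E
  obtain ⟨Y, ⟨j⟩⟩ := exists_iso_tensorObj (ω := ω) M
  obtain ⟨g, hg, hgi⟩ := exists_surjective_of_epi (i.hom ≫ e ≫ j.inv)
  obtain ⟨y, hy⟩ := h₂ Y P (f ≫ j.inv)
  obtain ⟨x, rfl⟩ := hg y
  refine ⟨inclComod X x P ≫ i.hom, ?_⟩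
  rw [← hgi, Iso.comp_inv_eq] at hy
  rw [hy]
  simp only [Category.assoc, Iso.inv_hom_id, Category.comp_id]

lemma projective_dsum {C : Type u} [AddCommGroup C] [Module A C] [Module Aᵐᵒᵖ C]
    [SMulCommClass A Aᵐᵒᵖ C] [SMulCommClass Aᵐᵒᵖ A C] {D : Coring A C} {J : Type u}
    (M : J → Comod D) [∀ j, Projective (M j)] : Projective (dsum M) :=
  ⟨fun f e _ => ⟨dsumDesc fun j => Projective.factorThru (dsumι M j ≫ f) e,
    dsum_hom_ext fun j => by
      rw [← Category.assoc, dsumι_desc, Projective.factorThru_comp]⟩⟩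

/-- Every comodule is isomorphic to some `X ⊗_R Σ`, which is generated by the images of the
morphisms `p ↦ x ⊗ p` from the summands. -/
theorem isSeparator_dsum [(tensorFunctor ω).IsEquivalence] :
    IsSeparator (dsum (fun P : 𝒜 => comodObj ω P)) := by
  refine (isSeparator_def _).2 fun M N f g h => ?_
  obtain ⟨X, ⟨i⟩⟩ := exists_iso_tensorObj (ω := ω) M
  rw [← cancel_epi i.hom]
  have key : ∀ x P, inclComod X x P ≫ i.hom ≫ f = inclComod X x P ≫ i.hom ≫ g := by
    intro x P
    -- The test morphism from `ω P` is extended by zero to the whole direct sum, so that the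
    -- hypothesis applies, and then restricted again.
    have e := congrArg (dsumι (fun P : 𝒜 => comodObj ω P) P ≫ ·)
      (h (dsumπ (fun P : 𝒜 => comodObj ω P) P ≫ inclComod X x P ≫ i.hom))
    simp only [Category.assoc] at e
    rwa [← Category.assoc, ← Category.assoc (dsumι _ P), dsumι_π, Category.id_comp,
      Category.id_comp] at e
  refine Comod.hom_ext fun z => ?_
  refine tensor_induction (p := fun z => (i.hom ≫ f).1 z = (i.hom ≫ g).1 z) z
    ((map_zero (i.hom ≫ f).1).trans (map_zero (i.hom ≫ g).1).symm)
    (fun x P p => congrArg (fun k => k.1 p) (key x P)) (fun x y hx hy => ?_)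
  exact (map_add (i.hom ≫ f).1 x y).trans ((congrArg₂ (· + ·) hx hy).trans
    (map_add (i.hom ≫ g).1 x y).symm)

theorem isGeneratingSetOfSmallProjectives [(tensorFunctor ω).IsEquivalence]
    (h₂ : ∀ X : UMod (CatRing 𝒜), UnitSurjective ω X) :
    IsGeneratingSetOfSmallProjectives (fun P : 𝒜 => (comodFunctor ω).obj P) := by
  have : ∀ P : 𝒜, Projective (comodObj ω P) := projective_comodObj h₂
  exact ⟨fun P J => Comod.preservesCoproducts (comodObj ω P) J,
    Limits.Cofan.mk (dsum (fun P : 𝒜 => comodObj ω P)) (dsumι (fun P : 𝒜 => comodObj ω P)),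
    ⟨dsumIsColimit (fun P : 𝒜 => comodObj ω P)⟩,
    projective_dsum (fun P : 𝒜 => comodObj ω P), isSeparator_dsum⟩

end FullyFaithful

end

end InfComatrix

/-! ### The equivalences, with faithful flatness of `Σ` as the hub -/

theorem mainTheorem6 {A : Type u} [Ring A] {𝒜 : Type u} [SmallCategory 𝒜] [Preadditive 𝒜]
    (ω : 𝒜 ⥤ ModuleCat.{u} Aᵐᵒᵖ) [ω.Additive] [ω.Faithful]
    [∀ P, Module.Finite Aᵐᵒᵖ (ω.obj P)] [∀ P, Module.Projective Aᵐᵒᵖ (ω.obj P)] :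
    List.TFAE [
      InfComatrix.IsFlat A (InfComatrix.Comatrix ω) ∧
        InfComatrix.IsGeneratingSetOfSmallProjectives
          (fun P : 𝒜 => (InfComatrix.comodFunctor ω).obj P) ∧
        Function.Bijective (InfComatrix.lam ω),
      InfComatrix.IsFlat A (InfComatrix.Comatrix ω) ∧
        (InfComatrix.tensorFunctor ω).IsEquivalence,
      InfComatrix.NUFaithfullyFlat (InfComatrix.CatRing 𝒜) (InfComatrix.Sig ω),
      InfComatrix.IsFlat A (InfComatrix.Comatrix ω) ∧
        InfComatrix.NUFaithfullyFlat (InfComatrix.CatRing 𝒜) (InfComatrix.LinRing ω),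
      InfComatrix.NUFlat (InfComatrix.CatRing 𝒜) (InfComatrix.Sig ω) ∧
        InfComatrix.NUFaithfullyFlat (InfComatrix.CatRing 𝒜) (InfComatrix.LinRing ω)] := by
  tfae_have 1 → 3 := fun ⟨hC, hgen, hlam⟩ =>
    InfComatrix.nuFaithfullyFlat_of_generating hC hgen hlam
  tfae_have 3 → 2 := fun h =>
    ⟨InfComatrix.isFlat_comatrix h.1, InfComatrix.tensorFunctor_isEquivalence h⟩
  tfae_have 2 → 3 := fun ⟨hC, _⟩ => InfComatrix.nuFaithfullyFlat_of_isEquivalence hC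
  tfae_have 3 → 1 := fun h =>
    have := InfComatrix.tensorFunctor_isEquivalence h
    have h₂ := InfComatrix.unitSurjective_of_faithfullyFlat h
    ⟨InfComatrix.isFlat_comatrix h.1, InfComatrix.isGeneratingSetOfSmallProjectives h₂,
      InfComatrix.lam_bijective (h₂ _)⟩
  tfae_have 3 → 4 := fun h =>
    ⟨InfComatrix.isFlat_comatrix h.1, (InfComatrix.nuFaithfullyFlat_linRing_iff h.1).2 h⟩
  tfae_have 4 → 5 := fun h => ⟨InfComatrix.nuFlat_sig_of_linRing h.1 h.2.1, h.2⟩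
  tfae_have 5 → 3 := fun h => (InfComatrix.nuFaithfullyFlat_linRing_iff h.1).1 h.2
  tfae_finish
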